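/- **Theorem 3.5.** Let $n\ge 3$ and let $\Omega\subset\mathbb{R}^2$ be a convex $n$-sided polygon (a closed region) whose vertices (corners), in cyclic order, are $\varphi(v_1),\dots,\varphi(v_n)$. Let $T=(V,E,F)$ be a finite simplicial triangulation of $\Omega$ (up to homeomorphism, that is, of the closed disk) whose boundary vertices, in cyclic order along the boundary cycle, are $v_1,\dots,v_n$; the edges of $T$ need not be straight. Let $X(\Omega,T)$ be the set of geodesic triangulations of $\Omega$ with combinatorial type $T$: the maps $\psi\colon V\to\Omega$ with $\psi(v_i)=\varphi(v_i)$ for $i=1,\dots,n$, such that sending each vertex $v$ to $\psi(v)$ and each edge of $T$, at constant speed, to the straight segment between the images of its endpoints defines an embedding of the $1$-skeleton of $T$ in the plane. Give $X(\Omega,T)$ the subspace topology from $(\mathbb{R}^2)^V$. Then $X(\Omega,T)$ is contractible (in particular, non-empty). -/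

import Mathlib

/-- The Euclidean plane. -/
abbrev Plane : Type := EuclideanSpace ℝ (Fin 2)

namespace PlanarTriangulation

/-- The graph formed by the vertices and edges of a simplicial complex. -/
def edgeGraph {V : Type*} [DecidableEq V] (K : AbstractSimplicialComplex V) : SimpleGraph V where
  Adj u v := u ≠ v ∧ ({u, v} : Finset V) ∈ K.faces
  symm := ⟨fun u v h => ⟨h.1.symm, by rw [Finset.pair_comm]; exact h.2⟩⟩
  loopless := ⟨fun _ h => h.1 rfl⟩

/-- The link of a vertex `v` in a simplicial complex of dimension two, as a graph: its vertices are
the neighbours of `v`, and two of them are joined when they span a triangle together with `v`. -/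
def linkGraph {V : Type*} [DecidableEq V] (K : AbstractSimplicialComplex V) (v : V) :
    SimpleGraph {u : V // (edgeGraph K).Adj v u} where
  Adj u w := u ≠ w ∧ ({v, u.1, w.1} : Finset V) ∈ K.faces
  symm := ⟨fun u w h => ⟨h.1.symm, by rw [Finset.pair_comm]; exact h.2⟩⟩
  loopless := ⟨fun _ h => h.1 rfl⟩

/-- The edges (simplices with two vertices) of a simplicial complex. -/
def edges {V : Type*} (K : AbstractSimplicialComplex V) : Set (Finset V) :=
  {s | s ∈ K.faces ∧ s.card = 2}

/-- The triangles (simplices with three vertices) of a simplicial complex. -/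
def triangles {V : Type*} (K : AbstractSimplicialComplex V) : Set (Finset V) :=
  {s | s ∈ K.faces ∧ s.card = 3}

/-- The triangles of a simplicial complex that contain a given simplex `e`. -/
def trianglesContaining {V : Type*} (K : AbstractSimplicialComplex V) (e : Finset V) :
    Set (Finset V) :=
  {t | t ∈ triangles K ∧ e ⊆ t}

/-- The finite simplicial complex `K` is a triangulation of the closed disk, and `b` lists its
boundary vertices in cyclic order (indices modulo `n`).

The fields `pure`, `edge_le_two` and `link_connected` say that `K` is a surface with boundary: the
link of each vertex is a cycle or a path.  By the classification of surfaces, a compact connected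
surface whose boundary is one circle is a closed disk if and only if its Euler characteristic
is `1`. -/
structure IsDiskTriangulation {V : Type*} [Fintype V] [DecidableEq V] {n : ℕ}
    (K : AbstractSimplicialComplex V) (b : ZMod n → V) : Prop where
  /-- Every simplex is contained in a triangle (so the dimension is two). -/
  pure : ∀ s ∈ K.faces, ∃ t ∈ triangles K, s ⊆ t
  /-- Every edge is contained in at most two triangles. -/
  edge_le_two : ∀ e ∈ edges K, (trianglesContaining K e).ncard ≤ 2
  /-- The link of every vertex is connected. -/
  link_connected : ∀ v, (linkGraph K v).Connected
  /-- The complex is connected. -/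
  connected : (edgeGraph K).Connected
  /-- The Euler characteristic `|V| - |E| + |F|` is `1`. -/
  euler : (Fintype.card V : ℤ) - (edges K).ncard + (triangles K).ncard = 1
  /-- The boundary vertices listed by `b` are distinct. -/
  boundary_injective : Function.Injective b
  /-- The boundary edges, i.e. the edges contained in exactly one triangle, are exactly the edges
  joining cyclically consecutive vertices of the list `b`. -/
  boundary_edges : {e | e ∈ edges K ∧ (trianglesContaining K e).ncard = 1} =
    Set.range fun i : ZMod n => ({b i, b (i + 1)} : Finset V)

/-- The closed region `Ω` spanned by the vertices of a convex polygon. -/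
def polygonRegion {n : ℕ} (φ : ZMod n → Plane) : Set Plane :=
  convexHull ℝ (Set.range φ)

/-- The points `φ i` (indices modulo `n`) are, in cyclic order, the vertices of a convex `n`-sided
polygon: they are the corners of their convex hull, and the boundary of this hull is formed by the
segments joining consecutive points. -/
structure IsConvexPolygon {n : ℕ} (φ : ZMod n → Plane) : Prop where
  three_le : 3 ≤ n
  convexIndependent : ConvexIndependent ℝ φ
  frontier_eq : frontier (polygonRegion φ) = ⋃ i : ZMod n, segment ℝ (φ i) (φ (i + 1))

/-- The geometric realization, in barycentric coordinates, of the 1-skeleton of `K`. -/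
def oneSkeleton {V : Type*} [Fintype V] (K : AbstractSimplicialComplex V) : Set (V → ℝ) :=
  {w | w ∈ stdSimplex ℝ V ∧ ∃ s ∈ K.faces, s.card ≤ 2 ∧ ∀ v, w v ≠ 0 → v ∈ s}

/-- The map from the 1-skeleton of `K` to the plane that sends each vertex `v` to `ψ v` and each
edge affinely (at constant speed) to the segment joining the images of its endpoints. -/
noncomputable def straightLineMap {V : Type*} [Fintype V] (K : AbstractSimplicialComplex V)
    (ψ : V → Plane) (w : oneSkeleton K) : Plane :=
  ∑ v, w.1 v • ψ v

/-- The space `X(Ω, T)` of geodesic triangulations of the polygon `Ω` with vertices `φ` and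
combinatorial type `T = (K, b)`.  A geodesic triangulation is given by the positions `ψ` of the
vertices, which lie in `Ω`, are prescribed by `φ` on the boundary vertices, and induce an embedding
of the 1-skeleton with straight edges.  The topology on this space is the subspace topology
from `V → Plane`. -/
def geodesicTriangulations {V : Type*} [Fintype V] {n : ℕ} (K : AbstractSimplicialComplex V)
    (b : ZMod n → V) (φ : ZMod n → Plane) : Set (V → Plane) :=
  {ψ | (∀ i, ψ (b i) = φ i) ∧ (∀ v, ψ v ∈ polygonRegion φ) ∧
    Topology.IsEmbedding (straightLineMap K ψ)}

end PlanarTriangulation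

/-!
The space of geodesic triangulations is a retract of a convex set, hence contractible. The convex
set is the space of systems of positive weights `w v u`. A system of weights determines Tutte's
drawing (`tutteMap`): the boundary vertices sit at the corners of the polygon and every interior
vertex is the mean of its neighbours, with the given weights. This is the solution of a discrete
Dirichlet problem, so by the maximum principle it exists, is unique and depends continuously on the
weights. Conversely, the neighbours of an interior vertex of a geodesic triangulation surround it,
so the vertex is their mean for some positive weights. The possible weights form a convex set, a
choice can be made continuously near each triangulation, and a partition of unity gives a continuous
global choice (`exists_continuous_balancingWeights`). By uniqueness, the drawing for these weights is
the triangulation one started with.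

What has to be shown is that Tutte's drawing is embedded
(`IsConvexCombinationMap.mem_geodesicTriangulations`), and that in an embedded drawing the neighbours
do surround each interior vertex.

For the first point, the disk is closed up to a sphere by coning off its boundary
(`IsDiskTriangulation.isTriangulatedSphere`). For an injective function on the vertices that has
lower and higher neighbours at every vertex except the two poles, the link of every vertex is cut at
least twice at non-poles and at least zero times at the poles into lower and higher parts; Euler's
formula bounds the total, so the link of a non-pole is cut exactly twice (`card_linkCut_le_two`). A
linear functional of Tutte's drawing, extended to the sphere, becomes such a function after a small
perturbation. Perturbing it in two opposite ways would contradict the count unless the functional is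
nowhere locally constant (`IsAdmissible.isRegularAt`), is not constant on a triangle
(`IsAdmissible.not_const_on_triangle`) and does not take two triangles with a common level edge to
the same side of it (`IsAdmissible.not_fold`). So the drawing is nondegenerate and has no folds
(`IsConvexCombinationMap.isUnfolded`). The perturbations are themselves solutions of Dirichlet
problems.

A drawing without folds is injective because a generic line crosses the polygon once: going from an
edge that meets the line to the next one through their common triangle, one always moves in the same
direction along the line and can stop only at the boundary of the polygon. The line leaves the convex
polygon through a single edge, so all the crossings form one chain
(`IsUnfoldedInPolygon.crossing_mem_triangle`).

For the second point, if two triangles of an embedded drawing were folded over a common edge, then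
either two edges would cross or a vertex would lie inside a triangle. The set of vertices inside
that triangle would be separated from the rest of the sphere by the three vertices of a triangle,
which is impossible in a triangulated sphere (`triangle_not_separating`). Without folds, the
triangles at an interior vertex go around it, so its neighbours surround it.
-/


set_option linter.unusedSectionVars false

namespace PlanarTriangulation

/-! ### Triangulated spheres and cuts of vertex links -/

/-- A combinatorial version of a triangulation of the sphere, given by its set `T` of triangles:
every edge lies in exactly two triangles, vertex links are connected, the complex is connected, and
the number of triangles is the one that Euler's formula predicts. Connectedness is expressed by
saying that a nonempty set of vertices closed under adjacency is everything. -/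
structure IsTriangulatedSphere {W : Type*} [Fintype W] [DecidableEq W]
    (T : Finset (Finset W)) : Prop where
  card_eq_three : ∀ t ∈ T, t.card = 3
  card_edge : ∀ t ∈ T, ∀ u ∈ t, ∀ v ∈ t, u ≠ v → (T.filter fun s => u ∈ s ∧ v ∈ s).card = 2
  link_closed : ∀ (v : W) (A : Finset W), (∃ t ∈ T, v ∈ t ∧ ∃ u ∈ t, u ≠ v ∧ u ∈ A) →
    (∀ t ∈ T, v ∈ t → ∀ u ∈ t, u ≠ v → u ∈ A → ∀ w ∈ t, w ≠ v → w ∈ A) →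
    ∀ t ∈ T, v ∈ t → ∀ u ∈ t, u ≠ v → u ∈ A
  closed : ∀ A : Finset W, A.Nonempty → (∀ t ∈ T, ∀ u ∈ t, u ∈ A → ∀ w ∈ t, w ∈ A) →
    A = Finset.univ
  card_faces : T.card + 4 = 2 * Fintype.card W

/-- Two vertices are adjacent when they are distinct and lie in a common triangle. -/
def TAdj {W : Type*} (T : Finset (Finset W)) (u v : W) : Prop :=
  u ≠ v ∧ ∃ t ∈ T, u ∈ t ∧ v ∈ t

/-- The edges of the link of `v` that leave the vertex set `A`, each recorded by the triangle it
spans with `v`. It is meant for `v ∉ A`. -/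
def linkCut {W : Type*} [DecidableEq W] (T : Finset (Finset W)) (v : W) (A : Finset W) :
    Finset (Finset W) :=
  T.filter fun t => v ∈ t ∧ (t ∩ A).card = 1

lemma TAdj.symm {W : Type*} {T : Finset (Finset W)} {u v : W} (h : TAdj T u v) : TAdj T v u :=
  ⟨h.1.symm, h.2.imp fun _ ht => ⟨ht.1, ht.2.2, ht.2.1⟩⟩

lemma exists_eq_insert_pair {W : Type*} [DecidableEq W] {t : Finset W} (ht : t.card = 3) {v : W}
    (hv : v ∈ t) : ∃ a b, v ≠ a ∧ v ≠ b ∧ a ≠ b ∧ t = {v, a, b} := by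
  have h2 : (t.erase v).card = 2 := by rw [Finset.card_erase_of_mem hv, ht]
  obtain ⟨a, b, hab, h⟩ := Finset.card_eq_two.1 h2
  have ha : a ∈ t.erase v := by rw [h]; simp
  have hb : b ∈ t.erase v := by rw [h]; simp
  refine ⟨a, b, (Finset.ne_of_mem_erase ha).symm, (Finset.ne_of_mem_erase hb).symm, hab, ?_⟩
  rw [← h, Finset.insert_erase hv]

lemma eq_insert_pair_of_mem {W : Type*} [DecidableEq W] {t : Finset W} (ht : t.card = 3)
    {a b c : W} (ha : a ∈ t) (hb : b ∈ t) (hc : c ∈ t) (hab : a ≠ b) (hac : a ≠ c) (hbc : b ≠ c) :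
    t = {a, b, c} := by
  symm
  apply Finset.eq_of_subset_of_card_le
  · intro x hx
    simp only [Finset.mem_insert, Finset.mem_singleton] at hx
    rcases hx with rfl | rfl | rfl <;> assumption
  · rw [ht, Finset.card_eq_three.2 ⟨a, b, c, hab, hac, hbc, rfl⟩]

lemma card_inter_insert_pair {W : Type*} [DecidableEq W] {v a b : W} (hab : a ≠ b) {A : Finset W}
    (hv : v ∉ A) : (({v, a, b} : Finset W) ∩ A).card =
      (if a ∈ A then 1 else 0) + (if b ∈ A then 1 else 0) := by
  by_cases ha : a ∈ A <;> by_cases hb : b ∈ A <;>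
    simp [Finset.insert_inter_of_mem, Finset.insert_inter_of_notMem, ha, hb, hv, hab]

lemma exists_sorted {W : Type*} [DecidableEq W] {h : W → ℝ} {t : Finset W} (ht : t.card = 3)
    (hinj : ∀ u ∈ t, ∀ v ∈ t, u ≠ v → h u ≠ h v) :
    ∃ a b c, h a < h b ∧ h b < h c ∧ t = {a, b, c} := by
  obtain ⟨a, b, c, hab, hac, hbc, rfl⟩ := Finset.card_eq_three.1 ht
  have h1 := hinj a (by simp) b (by simp) hab
  have h2 := hinj a (by simp) c (by simp) hac
  have h3 := hinj b (by simp) c (by simp) hbc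
  rcases lt_or_gt_of_ne h1 with h1 | h1 <;> rcases lt_or_gt_of_ne h2 with h2 | h2 <;>
    rcases lt_or_gt_of_ne h3 with h3 | h3
  · exact ⟨a, b, c, h1, h3, rfl⟩
  · exact ⟨a, c, b, h2, h3, by ext; simp; tauto⟩
  · linarith
  · exact ⟨c, a, b, h2, h1, by ext; simp; tauto⟩
  · exact ⟨b, a, c, h1, h2, by ext; simp; tauto⟩
  · linarith
  · exact ⟨b, c, a, h3, h2, by ext; simp; tauto⟩
  · exact ⟨c, b, a, h3, h1, by ext; simp; tauto⟩

section Sphere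

variable {W : Type*} [Fintype W] [DecidableEq W] {T : Finset (Finset W)}

lemma mem_linkCut (hT : IsTriangulatedSphere T) {v : W} {A : Finset W} (hv : v ∉ A)
    {t : Finset W} : t ∈ linkCut T v A ↔
      t ∈ T ∧ v ∈ t ∧ ∃ a ∈ t, ∃ b ∈ t, a ∈ A ∧ b ∉ A ∧ b ≠ v := by
  simp only [linkCut, Finset.mem_filter]
  refine and_congr_right fun ht => and_congr_right fun hvt => ?_
  obtain ⟨a, b, hva, hvb, hab, rfl⟩ := exists_eq_insert_pair (hT.card_eq_three t ht) hvt
  rw [card_inter_insert_pair hab hv]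
  by_cases ha : a ∈ A <;> by_cases hb : b ∈ A <;> simp [ha, hb, hv, hva.symm, hvb.symm]

lemma even_card_linkCut (hT : IsTriangulatedSphere T) {v : W} {A : Finset W} (hv : v ∉ A) :
    Even (linkCut T v A).card := by
  have h1 : ∑ t ∈ T.filter (fun t => v ∈ t), (t ∩ A).card =
      ∑ u ∈ A, (T.filter fun t => v ∈ t ∧ u ∈ t).card := by
    have : ∀ t ∈ T.filter (fun t => v ∈ t), (t ∩ A).card = ∑ u ∈ A, if u ∈ t then 1 else 0 := by
      intro t _
      rw [Finset.inter_comm, ← Finset.filter_mem_eq_inter, Finset.card_filter]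
    rw [Finset.sum_congr rfl this, Finset.sum_comm]
    refine Finset.sum_congr rfl fun u _ => ?_
    rw [← Finset.card_filter, Finset.filter_filter]
  have h2 : Even (∑ u ∈ A, (T.filter fun t => v ∈ t ∧ u ∈ t).card) := by
    refine Finset.even_sum _ fun u hu => ?_
    rcases (T.filter fun t => v ∈ t ∧ u ∈ t).eq_empty_or_nonempty with h | ⟨t, ht⟩
    · simp [h]
    · rw [Finset.mem_filter] at ht
      rw [hT.card_edge t ht.1 v ht.2.1 u ht.2.2 (fun h => hv (h ▸ hu))]
      exact even_two
  have h3 : ∑ t ∈ T.filter (fun t => v ∈ t), (t ∩ A).card = (linkCut T v A).card +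
      2 * ((T.filter fun t => v ∈ t).filter fun t => (t ∩ A).card = 2).card := by
    rw [linkCut, ← Finset.filter_filter, Finset.card_filter, Finset.card_filter, Finset.mul_sum,
      ← Finset.sum_add_distrib]
    refine Finset.sum_congr rfl fun t ht => ?_
    rw [Finset.mem_filter] at ht
    obtain ⟨a, b, hva, hvb, hab, rfl⟩ := exists_eq_insert_pair (hT.card_eq_three t ht.1) ht.2
    rw [card_inter_insert_pair hab hv]
    by_cases ha : a ∈ A <;> by_cases hb : b ∈ A <;> simp [ha, hb]
  rw [← h1, h3, Nat.even_add] at h2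
  exact h2.2 (even_two_mul _)

/-- The link of a vertex is a cycle, so a proper nonempty part of it is left at least twice. -/
lemma two_le_card_linkCut (hT : IsTriangulatedSphere T) {v : W} {A : Finset W} (hv : v ∉ A)
    {x y : W} (hx : TAdj T v x) (hxA : x ∈ A) (hy : TAdj T v y) (hyA : y ∉ A) :
    2 ≤ (linkCut T v A).card := by
  have hne : (linkCut T v A).Nonempty := by
    by_contra hemp
    rw [Finset.not_nonempty_iff_eq_empty] at hemp
    obtain ⟨t, ht, hvt, hxt⟩ := hx.2
    obtain ⟨s, hs, hvs, hys⟩ := hy.2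
    refine hyA (hT.link_closed v A ⟨t, ht, hvt, x, hxt, hx.1.symm, hxA⟩ ?_ s hs hvs y hys
      hy.1.symm)
    intro t ht hvt u hu huv huA w hw hwv
    by_contra hwA
    have : t ∈ linkCut T v A :=
      (mem_linkCut hT hv).2 ⟨ht, hvt, u, hu, w, hw, huA, hwA, hwv⟩
    simp [hemp] at this
  have := Finset.card_pos.2 hne
  obtain ⟨k, hk⟩ := even_card_linkCut hT hv
  omega

/-- Two arcs of the link of `v`, each cut at most twice, cannot overlap and leave a common gap
while separating the endpoints `q` and `c` of a link edge in opposite ways. The cut function is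
submodular, and the edge `qc` makes the inequality strict by two. -/
lemma linkCut_crossing (hT : IsTriangulatedSphere T) {v q c x y : W} {A B : Finset W}
    (hvA : v ∉ A) (hvB : v ∉ B) (hA : (linkCut T v A).card ≤ 2) (hB : (linkCut T v B).card ≤ 2)
    {t₀ : Finset W} (ht₀ : t₀ ∈ T) (hvt : v ∈ t₀) (hqt : q ∈ t₀) (hct : c ∈ t₀)
    (hqA : q ∈ A) (hqB : q ∉ B) (hcA : c ∉ A) (hcB : c ∈ B)
    (hx : TAdj T v x) (hxA : x ∈ A) (hxB : x ∈ B)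
    (hy : TAdj T v y) (hyA : y ∉ A) (hyB : y ∉ B) : False := by
  have hvI : v ∉ A ∩ B := fun h => hvA (Finset.mem_inter.1 h).1
  have hvU : v ∉ A ∪ B := fun h => (Finset.mem_union.1 h).elim hvA hvB
  have h1 := two_le_card_linkCut hT hvI hx (Finset.mem_inter.2 ⟨hxA, hxB⟩) hy
    (fun h => hyA (Finset.mem_inter.1 h).1)
  have h2 := two_le_card_linkCut hT hvU hx (Finset.mem_union_left _ hxA) hy
    (fun h => (Finset.mem_union.1 h).elim hyA hyB)
  have key : (linkCut T v (A ∩ B)).card + (linkCut T v (A ∪ B)).card + 2 ≤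
      (linkCut T v A).card + (linkCut T v B).card := by
    have e : ∀ C : Finset W, (linkCut T v C).card =
        ∑ t ∈ T.filter (fun t => v ∈ t), if (t ∩ C).card = 1 then 1 else 0 := by
      intro C
      rw [linkCut, ← Finset.filter_filter, Finset.card_filter]
    have e2 : ∑ t ∈ T.filter (fun t => v ∈ t), (if t = t₀ then 2 else 0) = 2 := by
      rw [Finset.sum_ite_eq' (T.filter fun t => v ∈ t) t₀, if_pos (by simp [ht₀, hvt])]
    rw [e, e, e, e, ← Finset.sum_add_distrib, ← Finset.sum_add_distrib]
    conv_lhs => rw [← e2]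
    rw [← Finset.sum_add_distrib]
    refine Finset.sum_le_sum fun t ht => ?_
    rw [Finset.mem_filter] at ht
    by_cases htt : t = t₀
    · subst htt
      have hqc : q ≠ c := fun h => hqB (h ▸ hcB)
      have hvq : v ≠ q := fun h => hvA (h ▸ hqA)
      have hvc : v ≠ c := fun h => hvB (h ▸ hcB)
      rw [eq_insert_pair_of_mem (hT.card_eq_three t ht.1) hvt hqt hct hvq hvc hqc]
      simp only [card_inter_insert_pair hqc hvA, card_inter_insert_pair hqc hvB,
        card_inter_insert_pair hqc hvI, card_inter_insert_pair hqc hvU]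
      simp [hqA, hqB, hcA, hcB]
    · obtain ⟨a, b, hva, hvb, hab, rfl⟩ := exists_eq_insert_pair (hT.card_eq_three t ht.1) ht.2
      simp only [card_inter_insert_pair hab hvA, card_inter_insert_pair hab hvB,
        card_inter_insert_pair hab hvI, card_inter_insert_pair hab hvU, if_neg htt]
      by_cases h1 : a ∈ A <;> by_cases h2 : a ∈ B <;> by_cases h3 : b ∈ A <;>
        by_cases h4 : b ∈ B <;> simp [h1, h2, h3, h4]
  omega

/-- Every triangle has exactly one vertex of middle height, so the cuts of the vertex links by the
sublevel sets have as many elements in total as there are triangles. -/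
lemma sum_card_linkCut (hT : IsTriangulatedSphere T) {h : W → ℝ}
    (hinj : ∀ u v, TAdj T u v → h u ≠ h v) :
    ∑ v, (linkCut T v (Finset.univ.filter fun u => h u < h v)).card = T.card := by
  simp only [linkCut]
  rw [Finset.sum_congr rfl fun v _ => Finset.card_filter _ T, Finset.sum_comm,
    Finset.card_eq_sum_ones]
  refine Finset.sum_congr rfl fun t ht => ?_
  obtain ⟨a, b, c, hab, hbc, rfl⟩ := exists_sorted (h := h) (hT.card_eq_three t ht)
    (fun u hu v hv huv => hinj u v ⟨huv, t, ht, hu, hv⟩)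
  have nab : a ≠ b := fun e => by simp [e] at hab
  have nbc : b ≠ c := fun e => by simp [e] at hbc
  have nac : a ≠ c := fun e => by rw [e] at hab; linarith
  rw [← Finset.card_filter]
  have : (Finset.univ.filter fun v => v ∈ ({a, b, c} : Finset W) ∧
      (({a, b, c} : Finset W) ∩ Finset.univ.filter fun u => h u < h v).card = 1) = {b} := by
    ext v
    simp only [Finset.mem_filter, Finset.mem_univ, true_and, Finset.mem_singleton]
    constructor
    · rintro ⟨hv, hc⟩
      simp only [Finset.mem_insert, Finset.mem_singleton] at hv
      rcases hv with rfl | rfl | rfl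
      · rw [card_inter_insert_pair nbc (by simp)] at hc
        simp [not_lt.2 hab.le, not_lt.2 (hab.trans hbc).le] at hc
      · rfl
      · rw [show ({a, b, v} : Finset W) = {v, a, b} by ext; simp; tauto,
          card_inter_insert_pair nab (by simp)] at hc
        simp [hbc, hab.trans hbc] at hc
    · rintro rfl
      refine ⟨by simp, ?_⟩
      rw [show ({a, v, c} : Finset W) = {v, a, c} by ext; simp; tauto,
          card_inter_insert_pair nac (by simp)]
      simp [hab, not_lt.2 hbc.le]
  rw [this, Finset.card_singleton]

/-- The vertex `v` has a strictly lower and a strictly higher neighbour. -/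
def IsRegularAt (T : Finset (Finset W)) (h : W → ℝ) (v : W) : Prop :=
  (∃ u, TAdj T v u ∧ h u < h v) ∧ ∃ u, TAdj T v u ∧ h v < h u

/-- If all vertices but two are regular for a height function without horizontal edges, then each of
them is an ordinary (non-saddle) vertex: its link is cut exactly twice by its level. This is the
discrete index formula on the sphere. -/
lemma card_linkCut_le_two (hT : IsTriangulatedSphere T) {h : W → ℝ}
    (hinj : ∀ u v, TAdj T u v → h u ≠ h v) {N S : W} (hNS : N ≠ S)
    (hreg : ∀ v, v ≠ N → v ≠ S → IsRegularAt T h v) {v : W} (hvN : v ≠ N) (hvS : v ≠ S) :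
    (linkCut T v (Finset.univ.filter fun u => h u < h v)).card ≤ 2 := by
  by_contra hlt
  push Not at hlt
  have hsum := sum_card_linkCut hT hinj
  have hlow : ∑ w ∈ Finset.univ \ {N, S}, 2 <
      ∑ w ∈ Finset.univ \ {N, S},
        (linkCut T w (Finset.univ.filter fun u => h u < h w)).card := by
    refine Finset.sum_lt_sum (fun w hw => ?_) ⟨v, by simp [hvN, hvS], hlt⟩
    simp only [Finset.mem_sdiff, Finset.mem_univ, Finset.mem_insert, Finset.mem_singleton,
      true_and, not_or] at hw
    obtain ⟨⟨x, hx, hxw⟩, y, hy, hyw⟩ := hreg w hw.1 hw.2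
    exact two_le_card_linkCut hT (by simp) hx (by simpa using hxw) hy
      (by simpa using hyw.le)
  have hle : ∑ w ∈ Finset.univ \ {N, S},
      (linkCut T w (Finset.univ.filter fun u => h u < h w)).card ≤
      ∑ w, (linkCut T w (Finset.univ.filter fun u => h u < h w)).card :=
    Finset.sum_le_sum_of_subset (Finset.subset_univ _)
  have hcard : (Finset.univ \ {N, S} : Finset W).card + 2 = Fintype.card W := by
    rw [← Finset.card_pair hNS, Finset.card_sdiff_add_card_eq_card (Finset.subset_univ _),
      Finset.card_univ]
  rw [Finset.sum_const, smul_eq_mul] at hlow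
  have := hT.card_faces
  omega

end Sphere

/-! ### Discrete harmonic functions -/

/-- The maximum principle: if every vertex of `I` with a lower neighbour has a higher one, the
maximum is attained off `I`. -/
lemma exists_notMem_forall_le {V : Type*} [Finite V] {G : SimpleGraph V} (hG : G.Connected)
    {I : Set V} (hI : ∃ v, v ∉ I) (f : V → ℝ)
    (hf : ∀ v ∈ I, (∃ u, G.Adj v u ∧ f u < f v) → ∃ u, G.Adj v u ∧ f v < f u) :
    ∃ v, v ∉ I ∧ ∀ u, f u ≤ f v := by
  obtain ⟨v₀, hv₀⟩ := hI
  have : Nonempty V := ⟨v₀⟩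
  obtain ⟨m, hm⟩ := Finite.exists_max f
  by_contra! hcon
  have step : ∀ v, f v = f m → ∀ u, G.Adj v u → f u = f m := by
    intro v hv u hvu
    have hvI : v ∈ I := by
      by_contra hvI
      obtain ⟨u, hu⟩ := hcon v hvI
      linarith [hm u]
    by_contra hu
    obtain ⟨x, -, hx⟩ := hf v hvI ⟨u, hvu, by rw [hv]; exact lt_of_le_of_ne (hm u) hu⟩
    linarith [hm x]
  have hall : ∀ v, f v = f m := by
    intro v
    have hreach : Relation.ReflTransGen G.Adj m v :=
      (SimpleGraph.reachable_iff_reflTransGen m v).1 (hG m v)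
    induction hreach with
    | refl => rfl
    | tail _ hbc ih => exact step _ ih _ hbc
  obtain ⟨u, hu⟩ := hcon v₀ hv₀
  linarith [hall v₀, hm u]

lemma flat_or_regular_of_sum_eq_zero {V : Type*} [Fintype V] {r : V → Prop} [DecidablePred r]
    {w : V → ℝ} (hw : ∀ u, r u → 0 < w u) {f : V → ℝ} {x : ℝ}
    (hs : ∑ u, (if r u then w u else 0) * (f u - x) = 0) :
    (∀ u, r u → f u = x) ∨ ((∃ u, r u ∧ f u < x) ∧ ∃ u, r u ∧ x < f u) := by
  by_cases h1 : ∃ u, r u ∧ f u < x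
  · by_cases h2 : ∃ u, r u ∧ x < f u
    · exact Or.inr ⟨h1, h2⟩
    · exfalso
      push Not at h2
      obtain ⟨u, hu, hux⟩ := h1
      have : ∑ u, (if r u then w u else 0) * (f u - x) < 0 := by
        refine Finset.sum_neg' (fun v _ => ?_) ⟨u, Finset.mem_univ _, ?_⟩
        · split_ifs with hv
          · exact mul_nonpos_of_nonneg_of_nonpos (hw v hv).le (by linarith [h2 v hv])
          · simp
        · rw [if_pos hu]
          exact mul_neg_of_pos_of_neg (hw u hu) (by linarith)
      linarith
  · left
    push Not at h1
    have h3 := (Finset.sum_eq_zero_iff_of_nonneg (fun v _ => by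
      split_ifs with hv
      · exact mul_nonneg (hw v hv).le (by linarith [h1 v hv])
      · simp)).1 hs
    intro u hu
    have := h3 u (Finset.mem_univ _)
    rw [if_pos hu] at this
    rcases mul_eq_zero.1 this with h | h
    · exact absurd h (hw u hu).ne'
    · linarith

open Classical in
/-- The matrix of the Dirichlet problem with interior vertices `I` and edge weights `w`: it sends
`f` to its weighted Laplacian at the vertices of `I` and to its value at the other vertices. -/
noncomputable def dirichletMatrix {V : Type*} [Fintype V] (G : SimpleGraph V) (I : Set V)
    (w : V → V → ℝ) : Matrix V V ℝ := fun v u =>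
  if v ∈ I then (if G.Adj v u then w v u else 0) -
    (if u = v then ∑ x, (if G.Adj v x then w v x else 0) else 0)
  else if u = v then 1 else 0

open Classical in
lemma dirichletMatrix_mulVec {V : Type*} [Fintype V] (G : SimpleGraph V) (I : Set V)
    (w : V → V → ℝ) (f : V → ℝ) (v : V) : (dirichletMatrix G I w).mulVec f v =
      if v ∈ I then ∑ u, (if G.Adj v u then w v u else 0) * (f u - f v) else f v := by
  simp only [Matrix.mulVec, dotProduct, dirichletMatrix]
  by_cases hv : v ∈ I
  · simp only [hv, if_true, sub_mul, Finset.sum_sub_distrib, mul_sub]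
    congr 1
    simp [Finset.sum_mul]
  · simp [hv]

lemma det_dirichletMatrix_ne_zero {V : Type*} [Fintype V] [DecidableEq V] {G : SimpleGraph V}
    (hG : G.Connected) {I : Set V} (hI : ∃ v, v ∉ I) {w : V → V → ℝ}
    (hw : ∀ v u, G.Adj v u → 0 < w v u) : (dirichletMatrix G I w).det ≠ 0 := by
  classical
  intro hdet
  obtain ⟨f, hf0, hf⟩ := Matrix.exists_mulVec_eq_zero_iff.2 hdet
  have hoff : ∀ v, v ∉ I → f v = 0 := by
    intro v hv
    have := congrFun hf v
    rwa [dirichletMatrix_mulVec, if_neg hv] at this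
  have hon : ∀ v ∈ I, (∀ u, G.Adj v u → f u = f v) ∨
      ((∃ u, G.Adj v u ∧ f u < f v) ∧ ∃ u, G.Adj v u ∧ f v < f u) := by
    intro v hv
    have := congrFun hf v
    rw [dirichletMatrix_mulVec, if_pos hv] at this
    exact flat_or_regular_of_sum_eq_zero (hw v) this
  obtain ⟨a, ha, hamax⟩ := exists_notMem_forall_le hG hI f (fun v hv ⟨u, hu, hlt⟩ => by
    rcases hon v hv with h | h
    · rw [h u hu] at hlt; exact absurd hlt (lt_irrefl _)
    · exact h.2)
  obtain ⟨b, hb, hbmax⟩ := exists_notMem_forall_le hG hI (fun v => - f v)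
    (fun v hv ⟨u, hu, hlt⟩ => by
      rcases hon v hv with h | ⟨⟨x, hx, hx'⟩, -⟩
      · rw [h u hu] at hlt; exact absurd hlt (lt_irrefl _)
      · exact ⟨x, hx, by simpa using hx'⟩)
  apply hf0
  funext v
  have h1 := hamax v
  have h2 := hbmax v
  rw [hoff a ha] at h1
  rw [hoff b hb] at h2
  simp only [Pi.zero_apply]
  linarith

section Sphere

variable {W : Type*} [Fintype W] [DecidableEq W] {T : Finset (Finset W)}

/-- The graph of the vertices and edges of a set of triangles. -/
def triangleGraph {W : Type*} (T : Finset (Finset W)) : SimpleGraph W where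
  Adj := TAdj T
  symm := ⟨fun _ _ h => h.symm⟩
  loopless := ⟨fun _ h => h.1 rfl⟩

lemma triangleGraph_connected (hT : IsTriangulatedSphere T) [Nonempty W] :
    (triangleGraph T).Connected := by
  classical
  refine (SimpleGraph.connected_iff _).2 ⟨fun a b => ?_, inferInstance⟩
  have h := hT.closed (Finset.univ.filter fun v => (triangleGraph T).Reachable a v)
    ⟨a, by simp⟩ (by
      intro t ht u hu hua w hw
      simp only [Finset.mem_filter, Finset.mem_univ, true_and] at hua ⊢
      by_cases huw : u = w
      · rwa [← huw]
      · exact hua.trans (SimpleGraph.Adj.reachable (G := triangleGraph T) ⟨huw, t, ht, hu, hw⟩))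
  have hb : b ∈ Finset.univ.filter fun v => (triangleGraph T).Reachable a v := by
    rw [h]; simp
  simpa using hb

/-- `f` is constant on the closed neighbourhood of `v`, or takes both smaller and larger values on
it. -/
def IsBalancedAt (T : Finset (Finset W)) (f : W → ℝ) (v : W) : Prop :=
  (∀ u, TAdj T v u → f u = f v) ∨ IsRegularAt T f v

lemma IsBalancedAt.neg {f : W → ℝ} {v : W} (h : IsBalancedAt T f v) :
    IsBalancedAt T (fun u => - f u) v := by
  rcases h with h | ⟨⟨x, hx, hx'⟩, y, hy, hy'⟩
  · exact Or.inl fun u hu => congrArg Neg.neg (h u hu)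
  · exact Or.inr ⟨⟨y, hy, by simpa using hy'⟩, x, hx, by simpa using hx'⟩

/-- The discrete Dirichlet problem has a solution depending linearly on the data. -/
lemma exists_balanced_extension (hT : IsTriangulatedSphere T) {I : Set W} (hI : ∃ v, v ∉ I) :
    ∃ E : (W → ℝ) →ₗ[ℝ] (W → ℝ), (∀ g, ∀ v, v ∉ I → E g v = g v) ∧
      ∀ g, ∀ v ∈ I, IsBalancedAt T (E g) v := by
  classical
  have : Nonempty W := hI.nonempty
  set M := dirichletMatrix (triangleGraph T) I (fun _ _ => 1)
  have hM : IsUnit M.det := (det_dirichletMatrix_ne_zero (triangleGraph_connected hT) hI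
    (fun _ _ _ => one_pos)).isUnit
  let P : (W → ℝ) →ₗ[ℝ] (W → ℝ) :=
    LinearMap.pi fun v => if v ∈ I then 0 else LinearMap.proj v
  have hP : ∀ g v, P g v = if v ∈ I then 0 else g v := by
    intro g v
    simp only [P, LinearMap.pi_apply]
    split_ifs <;> rfl
  have hE : ∀ g v, (if v ∈ I then ∑ u, (if (triangleGraph T).Adj v u then 1 else 0) *
      (M⁻¹.mulVec (P g) u - M⁻¹.mulVec (P g) v) else M⁻¹.mulVec (P g) v) =
      if v ∈ I then 0 else g v := by
    intro g v
    have := dirichletMatrix_mulVec (triangleGraph T) I (fun _ _ => 1) (M⁻¹.mulVec (P g)) v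
    rw [Matrix.mulVec_mulVec, Matrix.mul_nonsing_inv _ hM, Matrix.one_mulVec] at this
    rw [← hP, this]
  refine ⟨M⁻¹.mulVecLin ∘ₗ P, fun g v hv => ?_, fun g v hv => ?_⟩
  · have := hE g v
    rw [if_neg hv, if_neg hv] at this
    exact this
  · have := hE g v
    rw [if_pos hv, if_pos hv] at this
    exact flat_or_regular_of_sum_eq_zero (r := fun u => TAdj T v u) (w := fun _ => 1)
      (fun _ _ => one_pos) this

lemma nonneg_of_balanced (hT : IsTriangulatedSphere T) {I : Set W} (hI : ∃ v, v ∉ I)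
    {f : W → ℝ} (hf : ∀ v ∈ I, IsBalancedAt T f v) (h0 : ∀ v, v ∉ I → 0 ≤ f v) (v : W) :
    0 ≤ f v := by
  have : Nonempty W := ⟨v⟩
  obtain ⟨a, ha, hmax⟩ := exists_notMem_forall_le (triangleGraph_connected hT) hI
    (fun v => - f v) (fun v hv ⟨u, hu, hlt⟩ => by
      rcases (hf v hv).neg with h | h
      · rw [show -f u = -f v from h u hu] at hlt; exact absurd hlt (lt_irrefl _)
      · exact h.2)
  linarith [hmax v, h0 a ha]

/-! ### Separating sets of vertices in a triangulated sphere -/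

lemma eq_or_eq_of_common_edge (hT : IsTriangulatedSphere T) {t₁ t₂ t₃ : Finset W} (h₁ : t₁ ∈ T)
    (h₂ : t₂ ∈ T) (h₃ : t₃ ∈ T) (hne : t₁ ≠ t₂) {u v : W} (huv : u ≠ v) (u₁ : u ∈ t₁)
    (v₁ : v ∈ t₁) (u₂ : u ∈ t₂) (v₂ : v ∈ t₂) (u₃ : u ∈ t₃) (v₃ : v ∈ t₃) :
    t₃ = t₁ ∨ t₃ = t₂ := by
  have h := hT.card_edge t₁ h₁ u u₁ v v₁ huv
  have : ({t₁, t₂} : Finset (Finset W)) = T.filter fun s => u ∈ s ∧ v ∈ s := by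
    apply Finset.eq_of_subset_of_card_le
    · intro s hs
      simp only [Finset.mem_insert, Finset.mem_singleton] at hs
      rcases hs with rfl | rfl <;> simp [*]
    · rw [h, Finset.card_pair hne]
  have h3 : t₃ ∈ ({t₁, t₂} : Finset (Finset W)) := by rw [this]; simp [*]
  simpa using h3

/-- A set `C` of vertices whose closed neighbourhood is not everything has at least three outer
neighbours `p`, `q`, `r`. They can be chosen with triangles joining `pq` and `pr` to `C`, and with
`p` adjacent to a vertex away from `C`. -/
lemma exists_three_neighbours (hT : IsTriangulatedSphere T) {C : Finset W} {N : W}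
    (hne : C.Nonempty) (hN : N ∉ C) (hNC : ∀ c ∈ C, ¬ TAdj T c N) :
    ∃ p q r c c' y, p ∉ C ∧ q ∉ C ∧ r ∉ C ∧ p ≠ q ∧ p ≠ r ∧ q ≠ r ∧ c ∈ C ∧ c' ∈ C ∧
      ({p, q, c} : Finset W) ∈ T ∧ ({p, r, c'} : Finset W) ∈ T ∧ TAdj T p y ∧ y ∉ C ∧
      ∀ c ∈ C, ¬ TAdj T c y := by
  classical
  have hclosed : ∃ t ∈ T, ∃ p ∈ t, (p ∈ C ∨ ∃ c ∈ C, TAdj T c p) ∧ ∃ y ∈ t,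
      ¬ (y ∈ C ∨ ∃ c ∈ C, TAdj T c y) := by
    by_contra! hcon
    have := hT.closed (Finset.univ.filter fun v => v ∈ C ∨ ∃ c ∈ C, TAdj T c v)
      (hne.imp fun c hc => by simp [hc]) (by
        intro t ht u hu huA w hw
        simp only [Finset.mem_filter, Finset.mem_univ, true_and] at huA ⊢
        exact hcon t ht u hu huA w hw)
    have hmem : N ∈ Finset.univ.filter fun v => v ∈ C ∨ ∃ c ∈ C, TAdj T c v := by
      rw [this]; simp
    simp only [Finset.mem_filter, Finset.mem_univ, true_and] at hmem
    rcases hmem with h | ⟨c, hc, h⟩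
    · exact hN h
    · exact hNC c hc h
  obtain ⟨t, ht, p, hpt, hpY, y, hyt, hyY⟩ := hclosed
  have hpy : p ≠ y := fun h => hyY (h ▸ hpY)
  have hpy' : TAdj T p y := ⟨hpy, t, ht, hpt, hyt⟩
  push Not at hyY
  have hpC : p ∉ C := fun h => hyY.2 p h hpy'
  obtain ⟨c₀, hc₀, hc₀p⟩ := hpY.resolve_left hpC
  have h2 := two_le_card_linkCut hT hpC hc₀p.symm hc₀ hpy' hyY.1
  obtain ⟨t₁, ht₁, t₂, ht₂, ht₁₂⟩ := Finset.one_lt_card.1 h2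
  obtain ⟨hT₁, hp₁, a₁, ha₁, b₁, hb₁, haC₁, hbC₁, hbp₁⟩ := (mem_linkCut hT hpC).1 ht₁
  obtain ⟨hT₂, hp₂, a₂, ha₂, b₂, hb₂, haC₂, hbC₂, hbp₂⟩ := (mem_linkCut hT hpC).1 ht₂
  have eq₁ : t₁ = {p, b₁, a₁} := eq_insert_pair_of_mem (hT.card_eq_three _ hT₁) hp₁ hb₁ ha₁
    hbp₁.symm (fun h => hpC (h ▸ haC₁)) (fun h => hbC₁ (h ▸ haC₁))
  have eq₂ : t₂ = {p, b₂, a₂} := eq_insert_pair_of_mem (hT.card_eq_three _ hT₂) hp₂ hb₂ ha₂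
    hbp₂.symm (fun h => hpC (h ▸ haC₂)) (fun h => hbC₂ (h ▸ haC₂))
  by_cases hbb : b₁ = b₂
  · -- Both cut edges end at the same vertex `b₁`; a third one leaves `C ∪ {b₁}`.
    subst hbb
    have hpA : p ∉ insert b₁ C := by simp [hpC, hbp₁.symm]
    have hyb : y ≠ b₁ := by
      rintro rfl
      exact hyY.2 a₁ haC₁ ⟨fun h => hbC₁ (h ▸ haC₁), t₁, hT₁, ha₁, hb₁⟩
    have h3 := two_le_card_linkCut hT hpA hc₀p.symm (Finset.mem_insert_of_mem hc₀) hpy'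
      (by simp [hyb, hyY.1])
    obtain ⟨t₃, ht₃⟩ := Finset.card_pos.1 (by omega : 0 < (linkCut T p (insert b₁ C)).card)
    obtain ⟨hT₃, hp₃, a, ha, b, hb, haC, hbC, hbp⟩ := (mem_linkCut hT hpA).1 ht₃
    simp only [Finset.mem_insert, not_or] at haC hbC
    rcases haC with rfl | haC
    · exfalso
      rcases eq_or_eq_of_common_edge hT hT₁ hT₂ hT₃ ht₁₂ hbp₁ hb₁ hp₁ hb₂ hp₂ ha hp₃ with h | h
      · rw [h, eq₁] at hb
        simp only [Finset.mem_insert, Finset.mem_singleton] at hb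
        rcases hb with h | h | h
        exacts [hbp h, hbC.1 h, hbC.2 (h ▸ haC₁)]
      · rw [h, eq₂] at hb
        simp only [Finset.mem_insert, Finset.mem_singleton] at hb
        rcases hb with h | h | h
        exacts [hbp h, hbC.1 h, hbC.2 (h ▸ haC₂)]
    · have eq₃ : t₃ = {p, b, a} := eq_insert_pair_of_mem (hT.card_eq_three _ hT₃) hp₃ hb ha
        hbp.symm (fun h => hpC (h ▸ haC)) (fun h => hbC.2 (h ▸ haC))
      exact ⟨p, b₁, b, a₁, a, y, hpC, hbC₁, hbC.2, hbp₁.symm, hbp.symm, Ne.symm hbC.1, haC₁,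
        haC, eq₁ ▸ hT₁, eq₃ ▸ hT₃, hpy', hyY⟩
  · exact ⟨p, b₁, b₂, a₁, a₂, y, hpC, hbC₁, hbC₂, hbp₁.symm, hbp₂.symm, hbb, haC₁, haC₂,
      eq₁ ▸ hT₁, eq₂ ▸ hT₂, hpy', hyY⟩

/-- The three vertices of a triangle of a triangulated sphere do not separate it: every nonempty
set of other vertices that misses some further vertex has a neighbour outside the triangle. -/
lemma triangle_not_separating (hT : IsTriangulatedSphere T) {t : Finset W} (ht : t ∈ T)
    {C : Finset W} (hne : C.Nonempty) (hCt : ∀ c ∈ C, c ∉ t)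
    (hC : ∀ c ∈ C, ∀ u, TAdj T c u → u ∈ C ∨ u ∈ t) {N : W} (hN : N ∉ C) (hNt : N ∉ t) :
    False := by
  obtain ⟨p, q, r, c, c', y, hpC, hqC, hrC, hpq, hpr, hqr, hc, hc', hpqc, hprc, hpy, hyC, hyn⟩ :=
    exists_three_neighbours hT hne hN (fun c hc h => (hC c hc N h).elim hN hNt)
  have ne : ∀ {x c}, x ∉ C → c ∈ C → c ≠ x := fun hx hc h => hx (h ▸ hc)
  have hcq : TAdj T c q := ⟨ne hqC hc, _, hpqc, by simp, by simp⟩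
  have hcp : TAdj T c p := ⟨ne hpC hc, _, hpqc, by simp, by simp⟩
  have hcr : TAdj T c' r := ⟨ne hrC hc', _, hprc, by simp, by simp⟩
  have hqt := (hC c hc q hcq).resolve_left hqC
  have hpt := (hC c hc p hcp).resolve_left hpC
  have hrt := (hC c' hc' r hcr).resolve_left hrC
  have ht_eq := eq_insert_pair_of_mem (hT.card_eq_three t ht) hpt hqt hrt hpq hpr hqr
  have hpA : p ∉ insert q (insert r C) := by simp [hpC, hpq, hpr]
  have hyq : y ≠ q := by rintro rfl; exact hyn c hc hcq
  have hyr : y ≠ r := by rintro rfl; exact hyn c' hc' hcr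
  have h2 := two_le_card_linkCut hT hpA hcp.symm
    (Finset.mem_insert_of_mem (Finset.mem_insert_of_mem hc)) hpy (by simp [hyq, hyr, hyC])
  obtain ⟨s, hs⟩ := Finset.card_pos.1
    (by omega : 0 < (linkCut T p (insert q (insert r C))).card)
  obtain ⟨hsT, hps, a, ha, b, hb, haA, hbA, hbp⟩ := (mem_linkCut hT hpA).1 hs
  simp only [Finset.mem_insert, not_or] at haA hbA
  have hbt : b ∉ t := by rw [ht_eq]; simp [hbp, hbA.1, hbA.2.1]
  rcases haA with rfl | rfl | haC
  · rcases eq_or_eq_of_common_edge hT ht hpqc hsT (fun h => hCt c hc (h ▸ by simp)) hpq hpt hqt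
      (by simp) (by simp) hps ha with h | h
    · exact hbt (h ▸ hb)
    · rw [h] at hb
      simp only [Finset.mem_insert, Finset.mem_singleton] at hb
      rcases hb with h | h | h
      exacts [hbp h, hbA.1 h, hbA.2.2 (h ▸ hc)]
  · rcases eq_or_eq_of_common_edge hT ht hprc hsT (fun h => hCt c' hc' (h ▸ by simp)) hpr hpt hrt
      (by simp) (by simp) hps ha with h | h
    · exact hbt (h ▸ hb)
    · rw [h] at hb
      simp only [Finset.mem_insert, Finset.mem_singleton] at hb
      rcases hb with h | h | h
      exacts [hbp h, hbA.2.1 h, hbA.2.2 (h ▸ hc')]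
  · exact (hC a haC b ⟨fun h => hbA.2.2 (h ▸ haC), s, hsT, ha, hb⟩).elim hbA.2.2 hbt

end Sphere

/-! ### Height functions on a triangulated sphere -/

section Sphere

variable {W : Type*} [Fintype W] [DecidableEq W] {T : Finset (Finset W)}

/-- A height function with a strict maximum at `N` that is regular, or constant on the closed
neighbourhood, at every vertex other than `N` and `S`. -/
structure IsAdmissible (T : Finset (Finset W)) (N S : W) (h : W → ℝ) : Prop where
  ne : N ≠ S
  lt_top : ∀ u, u ≠ N → h u < h N
  balanced : ∀ v, v ≠ N → v ≠ S → IsBalancedAt T h v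

lemma exists_perturbation (h g : W → ℝ) :
    ∃ ε : ℝ, 0 < ε ∧ ∀ u v, h u < h v → h u + ε * g u < h v + ε * g v := by
  have h1 : ∀ᶠ ε : ℝ in nhdsWithin 0 (Set.Ioi 0), ∀ u v, h u < h v →
      h u + ε * g u < h v + ε * g v := by
    refine Filter.eventually_all.2 fun u => Filter.eventually_all.2 fun v => ?_
    by_cases huv : h u < h v
    · have hc : Filter.Tendsto (fun ε : ℝ => h v + ε * g v - (h u + ε * g u)) (nhds 0)
          (nhds (h v + 0 * g v - (h u + 0 * g u))) := Continuous.tendsto (by fun_prop) 0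
      have := (hc.eventually_const_lt (u := 0) (by linarith)).filter_mono
        (nhdsWithin_le_nhds (s := Set.Ioi 0))
      filter_upwards [this] with ε hε _
      linarith
    · exact Filter.Eventually.of_forall fun _ h => absurd h huv
  obtain ⟨ε, hε, hpos⟩ := (h1.and self_mem_nhdsWithin).exists
  exact ⟨ε, hpos, hε⟩

lemma IsRegularAt.refine {h h' : W → ℝ} (hh : ∀ u v, h u < h v → h' u < h' v) {v : W}
    (hv : IsRegularAt T h v) : IsRegularAt T h' v :=
  ⟨hv.1.imp fun _ hx => ⟨hx.1, hh _ _ hx.2⟩, hv.2.imp fun _ hx => ⟨hx.1, hh _ _ hx.2⟩⟩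

/-- An admissible height function can be perturbed by a function that is balanced where the height
function fails to be regular. -/
lemma IsAdmissible.exists_perturb {N S : W} {h : W → ℝ} (hh : IsAdmissible T N S h) {g : W → ℝ}
    (hg : ∀ v, v ≠ N → v ≠ S → ¬ IsRegularAt T h v → IsBalancedAt T g v) :
    ∃ h', IsAdmissible T N S h' ∧ (∀ u v, h u < h v → h' u < h' v) ∧
      ∀ u v, h u = h v → g u < g v → h' u < h' v := by
  obtain ⟨ε, hε, href⟩ := exists_perturbation h g
  refine ⟨fun v => h v + ε * g v, ⟨hh.ne, fun u hu => href _ _ (hh.lt_top u hu),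
    fun v hN hS => ?_⟩, href, fun u v huv hguv => ?_⟩
  · by_cases hreg : IsRegularAt T h v
    · exact Or.inr (hreg.refine href)
    · have hflat := (hh.balanced v hN hS).resolve_right hreg
      rcases hg v hN hS hreg with hgv | ⟨⟨x, hx, hxv⟩, y, hy, hyv⟩
      · exact Or.inl fun u hu => by simp only [hflat u hu, hgv u hu]
      · refine Or.inr ⟨⟨x, hx, ?_⟩, y, hy, ?_⟩
        · simp only [hflat x hx]
          gcongr
        · simp only [hflat y hy]
          gcongr
  · simp only [huv]
    gcongr

/-- The vertices that can be reached from `c₀` through non-regular vertices. They have at least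
three outer neighbours, all of them regular or equal to `S`. -/
lemma IsAdmissible.exists_flat_component (hT : IsTriangulatedSphere T) {N S : W} {h : W → ℝ}
    (hh : IsAdmissible T N S h) {c₀ : W} (hN : c₀ ≠ N) (hS : c₀ ≠ S)
    (hc₀ : ¬ IsRegularAt T h c₀) :
    ∃ p q r c c', (∀ x ∈ [p, q, r], x ≠ N ∧ (x ≠ S → IsRegularAt T h x)) ∧
      p ≠ q ∧ p ≠ r ∧ q ≠ r ∧ ({p, q, c} : Finset W) ∈ T ∧ h p = h c ∧ h q = h c ∧
      (c ≠ N ∧ c ≠ S ∧ ¬ IsRegularAt T h c) ∧ (c' ≠ N ∧ c' ≠ S ∧ ¬ IsRegularAt T h c') ∧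
      TAdj T c' r ∧ Relation.ReflTransGen (fun a b => TAdj T a b ∧
        (a ≠ N ∧ a ≠ S ∧ ¬ IsRegularAt T h a) ∧ (b ≠ N ∧ b ≠ S ∧ ¬ IsRegularAt T h b)) c c' := by
  classical
  set F : W → Prop := fun v => v ≠ N ∧ v ≠ S ∧ ¬ IsRegularAt T h v with hF
  set R : W → W → Prop := fun a b => TAdj T a b ∧ F a ∧ F b with hR
  have : Std.Symm R := ⟨fun a b hab => ⟨hab.1.symm, hab.2.2, hab.2.1⟩⟩
  set C : Finset W := Finset.univ.filter fun v => F v ∧ Relation.ReflTransGen R c₀ v with hC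
  have memC : ∀ v, v ∈ C ↔ F v ∧ Relation.ReflTransGen R c₀ v := by simp [hC]
  have hflat : ∀ v, F v → ∀ u, TAdj T v u → h u = h v := fun v hv =>
    (hh.balanced v hv.1 hv.2.1).resolve_right hv.2.2
  obtain ⟨p, q, r, c, c', y, hpC, hqC, hrC, hpq, hpr, hqr, hc, hc', hpqc, hprc, -⟩ :=
    exists_three_neighbours hT (C := C) (N := N) ⟨c₀, (memC _).2 ⟨⟨hN, hS, hc₀⟩, .refl⟩⟩
      (fun h => ((memC _).1 h).1.1 rfl) (fun c hc hcN => by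
        have hcF := ((memC _).1 hc).1
        have := hflat c hcF N hcN
        linarith [hh.lt_top c hcF.1])
  have ne : ∀ {x c}, x ∉ C → c ∈ C → c ≠ x := fun hx hc h => hx (h ▸ hc)
  have hcq : TAdj T c q := ⟨ne hqC hc, _, hpqc, by simp, by simp⟩
  have hcp : TAdj T c p := ⟨ne hpC hc, _, hpqc, by simp, by simp⟩
  have hcr : TAdj T c' r := ⟨ne hrC hc', _, hprc, by simp, by simp⟩
  have hout : ∀ c ∈ C, ∀ x, x ∉ C → TAdj T c x → x ≠ N ∧ (x ≠ S → IsRegularAt T h x) := by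
    intro c hc x hx hcx
    obtain ⟨hcF, hcr⟩ := (memC _).1 hc
    have hxN : x ≠ N := by
      rintro rfl
      have := hflat c hcF x hcx
      linarith [hh.lt_top c hcF.1]
    refine ⟨hxN, fun hxS => ?_⟩
    by_contra hreg
    exact hx ((memC _).2 ⟨⟨hxN, hxS, hreg⟩, hcr.tail ⟨hcx, hcF, hxN, hxS, hreg⟩⟩)
  have hcm := (memC _).1 hc
  have hcm' := (memC _).1 hc'
  refine ⟨p, q, r, c, c', ?_, hpq, hpr, hqr, hpqc, hflat c hcm.1 p hcp, hflat c hcm.1 q hcq,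
    hcm.1, hcm'.1, hcr, (Std.Symm.symm _ _ hcm.2).trans hcm'.2⟩
  intro x hx
  simp only [List.mem_cons, List.not_mem_nil, or_false] at hx
  rcases hx with rfl | rfl | rfl
  exacts [hout c hc _ hpC hcp, hout c hc _ hqC hcq, hout c' hc' _ hrC hcr]

/-- Every admissible height function can be refined to one that is regular at all vertices but `N`
and `S` and has no horizontal edges. -/
lemma IsAdmissible.exists_generic (hT : IsTriangulatedSphere T) {N S : W} {h : W → ℝ}
    (hh : IsAdmissible T N S h) :
    ∃ h', (∀ u v, h u < h v → h' u < h' v) ∧ (∀ u v, TAdj T u v → h' u ≠ h' v) ∧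
      ∀ v, v ≠ N → v ≠ S → IsRegularAt T h' v := by
  classical
  induction hk : (Finset.univ.filter fun v => v ≠ N ∧ v ≠ S ∧ ¬ IsRegularAt T h v).card
    using Nat.strong_induction_on generalizing h with
  | _ k ih =>
  by_cases hflat : ∃ c₀, c₀ ≠ N ∧ c₀ ≠ S ∧ ¬ IsRegularAt T h c₀
  · -- Lift one outer neighbour of a component of flat vertices, and extend harmonically.
    obtain ⟨c₀, hN, hS, hc₀⟩ := hflat
    obtain ⟨p, q, r, c, c', hpqr, hpq, -, -, hpqc, hpc, hqc, hcF, -⟩ :=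
      hh.exists_flat_component hT hN hS hc₀
    set I : Set W := {v | v ≠ N ∧ v ≠ S ∧ ¬ IsRegularAt T h v} with hI
    have hnI : ∀ x ∈ [p, q, r], x ∉ I := fun x hx hxI =>
      hxI.2.2 ((hpqr x hx).2 hxI.2.1)
    obtain ⟨E, hE, hEb⟩ := exists_balanced_extension hT (I := I) ⟨p, hnI p (by simp)⟩
    set g := E (Pi.single p 1) with hg
    have hgp : g p = 1 := by rw [hg, hE _ p (hnI p (by simp))]; simp
    have hgq : g q = 0 := by rw [hg, hE _ q (hnI q (by simp))]; simp [hpq.symm]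
    obtain ⟨h', hadm, href, htie⟩ := hh.exists_perturb (g := g)
      (fun v h1 h2 h3 => hEb _ v ⟨h1, h2, h3⟩)
    have hlt : (Finset.univ.filter fun v => v ≠ N ∧ v ≠ S ∧ ¬ IsRegularAt T h' v).card < k := by
      rw [← hk]
      refine Finset.card_lt_card ((Finset.ssubset_iff_of_subset fun v hv => ?_).2 ⟨c, ?_, ?_⟩)
      · simp only [Finset.mem_filter, Finset.mem_univ, true_and] at hv ⊢
        exact ⟨hv.1, hv.2.1, fun h => hv.2.2 (h.refine href)⟩
      · simpa using hcF
      · simp only [Finset.mem_filter, Finset.mem_univ, true_and, not_and, not_not]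
        intro _ _
        refine (hadm.balanced c hcF.1 hcF.2.1).resolve_left fun hfl => ?_
        have hcp : c ≠ p := by rintro rfl; exact hnI c (by simp) hcF
        have hcq : c ≠ q := by rintro rfl; exact hnI c (by simp) hcF
        have h1 := hfl p ⟨hcp, _, hpqc, by simp, by simp⟩
        have h2 := hfl q ⟨hcq, _, hpqc, by simp, by simp⟩
        have h3 := htie q p (hqc.trans hpc.symm) (by rw [hgp, hgq]; exact one_pos)
        linarith
    obtain ⟨h'', href', hrest⟩ := ih _ hlt hadm rfl
    exact ⟨h'', fun u v huv => href' _ _ (href _ _ huv), hrest⟩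
  · push Not at hflat
    obtain ⟨h', hadm, href, htie⟩ := hh.exists_perturb
      (g := fun v => ((Fintype.equivFin W v : ℕ) : ℝ)) (fun v h1 h2 h3 => absurd (hflat v h1 h2) h3)
    refine ⟨h', href, fun u v huv => ?_, fun v h1 h2 => (hflat v h1 h2).refine href⟩
    rcases lt_trichotomy (h u) (h v) with h1 | h1 | h1
    · exact (href _ _ h1).ne
    · have hne : (Fintype.equivFin W u : ℕ) ≠ (Fintype.equivFin W v : ℕ) := fun e =>
        huv.1 ((Fintype.equivFin W).injective (Fin.ext e))
      rcases lt_or_gt_of_ne hne with h2 | h2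
      · exact (htie u v h1 (by exact_mod_cast h2)).ne
      · exact (htie v u h1.symm (by exact_mod_cast h2)).ne'
    · exact (href _ _ h1).ne'

/-- Two refinements of a height function cannot order the vertices of a triangle as `q < p < c` and
`c < p < q` if `p` is regular: the link of `p` is cut only twice, and this determines on which side
of the edge `qc` of the link the vertices above `p` lie. -/
lemma not_two_orders (hT : IsTriangulatedSphere T) {N S : W} {h h₁ h₂ : W → ℝ}
    (hh₁ : IsAdmissible T N S h₁) (hh₂ : IsAdmissible T N S h₂)
    (href₁ : ∀ u v, h u < h v → h₁ u < h₁ v) (href₂ : ∀ u v, h u < h v → h₂ u < h₂ v)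
    {p q c : W} {t : Finset W} (ht : t ∈ T) (hpt : p ∈ t) (hqt : q ∈ t) (hct : c ∈ t)
    (hpN : p ≠ N) (hpS : p ≠ S) (hp : IsRegularAt T h p)
    (hqp₁ : h₁ q < h₁ p) (hpc₁ : h₁ p < h₁ c) (hcp₂ : h₂ c < h₂ p) (hpq₂ : h₂ p < h₂ q) :
    False := by
  obtain ⟨k₁, hk₁, hinj₁, hreg₁⟩ := hh₁.exists_generic hT
  obtain ⟨k₂, hk₂, hinj₂, hreg₂⟩ := hh₂.exists_generic hT
  obtain ⟨⟨x, hx, hxp⟩, y, hy, hyp⟩ := hp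
  have hx₁ := hk₁ _ _ (href₁ _ _ hxp)
  have hx₂ := hk₂ _ _ (href₂ _ _ hxp)
  have hy₁ := hk₁ _ _ (href₁ _ _ hyp)
  have hy₂ := hk₂ _ _ (href₂ _ _ hyp)
  have h1 := hk₁ _ _ hqp₁
  have h2 := hk₁ _ _ hpc₁
  have h3 := hk₂ _ _ hcp₂
  have h4 := hk₂ _ _ hpq₂
  refine linkCut_crossing hT (A := Finset.univ.filter fun u => k₁ u < k₁ p)
    (B := Finset.univ.filter fun u => k₂ u < k₂ p) (by simp) (by simp)
    (card_linkCut_le_two hT hinj₁ hh₁.ne hreg₁ hpN hpS)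
    (card_linkCut_le_two hT hinj₂ hh₁.ne hreg₂ hpN hpS) ht hpt hqt hct
    ?_ ?_ ?_ ?_ hx ?_ ?_ hy ?_ ?_ <;> simp [*, le_of_lt]

/-- Admissible height functions are regular at all vertices other than `N` and `S`. -/
theorem IsAdmissible.isRegularAt (hT : IsTriangulatedSphere T) {N S : W} {h : W → ℝ}
    (hh : IsAdmissible T N S h) {c₀ : W} (hN : c₀ ≠ N) (hS : c₀ ≠ S) : IsRegularAt T h c₀ := by
  by_contra hc₀
  obtain ⟨p, q, r, c, c', hpqr, hpq, hpr, hqr, hpqc, hpc, hqc, hcF, hcF', hcr, hcc⟩ :=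
    hh.exists_flat_component hT hN hS hc₀
  set I : Set W := {v | v ≠ N ∧ v ≠ S ∧ ¬ IsRegularAt T h v} with hI
  have hnI : ∀ x ∈ [p, q, r], x ∉ I := fun x hx hxI => hxI.2.2 ((hpqr x hx).2 hxI.2.1)
  have hex : ∃ v, v ∉ I := ⟨p, hnI p (by simp)⟩
  obtain ⟨E, hE, hEb⟩ := exists_balanced_extension hT hex
  -- The harmonic extension of the indicator function of `r` is positive on the flat component.
  have hnn : ∀ v, 0 ≤ E (Pi.single r 1) v :=
    nonneg_of_balanced hT hex (hEb _) fun v hv => by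
      rw [hE _ v hv]
      by_cases hvr : v = r <;> simp [hvr]
  have hprop : ∀ a ∈ I, E (Pi.single r 1) a = 0 → ∀ b, TAdj T a b →
      E (Pi.single r 1) b = 0 := by
    intro a ha ha0 b hab
    rcases hEb (Pi.single r 1) a ha with hfl | ⟨⟨x, -, hx⟩, -⟩
    · rw [hfl b hab, ha0]
    · linarith [hnn x]
  have hpos : 0 < E (Pi.single r 1) c := by
    refine lt_of_le_of_ne (hnn c) fun h0 => ?_
    have h0' : E (Pi.single r 1) c' = 0 := by
      refine Relation.ReflTransGen.head_induction_on
        (motive := fun a _ => E (Pi.single r 1) a = 0 → E (Pi.single r 1) c' = 0) hcc id ?_ h0.symm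
      intro a b hab _ ih ha
      exact ih (hprop a hab.2.1 ha b hab.1)
    have := hprop c' hcF' h0' r hcr
    rw [hE _ r (hnI r (by simp))] at this
    simp at this
  -- By linearity there is a harmonic function separating any two outer neighbours around `c`.
  have key : ∀ p q, p ∈ [p, q, r] → p ∉ I → q ∉ I → r ∉ I → p ≠ q → p ≠ r → q ≠ r →
      ∃ g : W → ℝ, (∀ v ∈ I, IsBalancedAt T g v) ∧ g p = 0 ∧ g q = 1 ∧ g c < 0 := by
    intro p q _ hp hq hr hpq hpr hqr
    set M := (E (Pi.single q 1) c + 1) / E (Pi.single r 1) c with hM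
    have hval : ∀ v, E (Pi.single q 1 - M • Pi.single r 1) v =
        E (Pi.single q 1) v - M * E (Pi.single r 1) v := by
      intro v
      rw [map_sub, map_smul]
      rfl
    refine ⟨E (Pi.single q 1 - M • Pi.single r 1), hEb _, ?_, ?_, ?_⟩
    · rw [hval, hE _ p hp, hE _ p hp]; simp [hpq, hpr]
    · rw [hval, hE _ q hq, hE _ q hq]; simp [hqr]
    · rw [hval, hM, div_mul_cancel₀ _ hpos.ne']; linarith
  have main : ∀ p q, p ∉ I → q ∉ I → p ≠ q → p ≠ r → q ≠ r → ({p, q, c} : Finset W) ∈ T →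
      h p = h c → h q = h c → p ≠ N → p ≠ S → False := by
    intro p q hp hq hpq hpr hqr hpqc hpc hqc hpN hpS
    obtain ⟨g, hg, hgp, hgq, hgc⟩ := key p q (by simp) hp hq (hnI r (by simp)) hpq hpr hqr
    obtain ⟨h₁, hadm₁, href₁, htie₁⟩ := hh.exists_perturb (g := g)
      (fun v h1 h2 h3 => hg v ⟨h1, h2, h3⟩)
    obtain ⟨h₂, hadm₂, href₂, htie₂⟩ := hh.exists_perturb (g := fun v => - g v)
      (fun v h1 h2 h3 => (hg v ⟨h1, h2, h3⟩).neg)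
    have hreg : IsRegularAt T h p := by
      by_contra hreg
      exact hp ⟨hpN, hpS, hreg⟩
    exact not_two_orders hT hadm₂ hadm₁ href₂ href₁ hpqc (p := p) (q := q) (c := c) (by simp)
      (by simp) (by simp) hpN hpS hreg
      (htie₂ _ _ (hqc.trans hpc.symm) (by linarith)) (htie₂ _ _ hpc (by linarith))
      (htie₁ _ _ hpc.symm (by linarith)) (htie₁ _ _ (hpc.trans hqc.symm) (by linarith))
  have hp := hnI p (by simp)
  have hq := hnI q (by simp)
  by_cases hpS : p = S
  · exact main q p hq hp hpq.symm hqr hpr (by rwa [Finset.insert_comm]) hqc hpc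
      (hpqr q (by simp)).1 (fun h => hpq (hpS.trans h.symm))
  · exact main p q hp hq hpq hpr hqr hpqc hpc hqc (hpqr p (by simp)).1 hpS

/-- An admissible height function is not constant on a triangle away from `N` and `S`. -/
theorem IsAdmissible.not_const_on_triangle (hT : IsTriangulatedSphere T) {N S : W} {h : W → ℝ}
    (hh : IsAdmissible T N S h) {p q c : W} (ht : ({p, q, c} : Finset W) ∈ T)
    (hpq : p ≠ q) (hpc : p ≠ c) (hqc : q ≠ c)
    (hpN : p ≠ N) (hpS : p ≠ S) (hq : h q = h p) (hc : h c = h p) : False := by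
  set g : W → ℝ := Pi.single q 1 - Pi.single c 1 with hg
  have hgp : g p = 0 := by simp [hg, hpq, hpc]
  have hgq : g q = 1 := by simp [hg, hqc]
  have hgc : g c = -1 := by simp [hg, hqc.symm]
  obtain ⟨h₁, hadm₁, href₁, htie₁⟩ := hh.exists_perturb (g := g)
    (fun v h1 h2 h3 => absurd (hh.isRegularAt hT h1 h2) h3)
  obtain ⟨h₂, hadm₂, href₂, htie₂⟩ := hh.exists_perturb (g := fun v => - g v)
    (fun v h1 h2 h3 => absurd (hh.isRegularAt hT h1 h2) h3)
  exact not_two_orders hT hadm₂ hadm₁ href₂ href₁ ht (p := p) (q := q) (c := c) (by simp)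
    (by simp) (by simp) hpN hpS (hh.isRegularAt hT hpN hpS)
    (htie₂ _ _ hq (by linarith)) (htie₂ _ _ hc.symm (by linarith))
    (htie₁ _ _ hc (by linarith)) (htie₁ _ _ hq.symm (by linarith))

/-- The two triangles at a horizontal edge do not both lie above it. -/
theorem IsAdmissible.not_fold (hT : IsTriangulatedSphere T) {N S : W} {h : W → ℝ}
    (hh : IsAdmissible T N S h) {a b c d : W} (hc : ({a, b, c} : Finset W) ∈ T)
    (hd : ({a, b, d} : Finset W) ∈ T) (hab : a ≠ b) (hcd : c ≠ d)
    (haN : a ≠ N) (haS : a ≠ S) (hb : h b = h a) (hac : h a < h c) (had : h a < h d) : False := by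
  have hac' : a ≠ c := fun e => by rw [e] at hac; exact lt_irrefl _ hac
  have hbc' : b ≠ c := fun e => by rw [← e, hb] at hac; exact lt_irrefl _ hac
  have had' : a ≠ d := fun e => by rw [e] at had; exact lt_irrefl _ had
  have hbd' : b ≠ d := fun e => by rw [← e, hb] at had; exact lt_irrefl _ had
  obtain ⟨h₁, hadm₁, href₁, htie₁⟩ := hh.exists_perturb (g := Pi.single a 1)
    (fun v h1 h2 h3 => absurd (hh.isRegularAt hT h1 h2) h3)
  obtain ⟨k, hk, hinj, hreg⟩ := hadm₁.exists_generic hT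
  have hba := hk _ _ (htie₁ b a hb (by simp [hab.symm]))
  obtain ⟨⟨x, hx, hxa⟩, -⟩ := hh.isRegularAt hT haN haS
  have hxa' := hk _ _ (href₁ _ _ hxa)
  have hkc := hk _ _ (href₁ _ _ hac)
  have hkd := hk _ _ (href₁ _ _ had)
  set A : Finset W := Finset.univ.filter fun u => k u < k a with hA
  have hcut : (linkCut T a A).card ≤ 2 := card_linkCut_le_two hT hinj hh.ne hreg haN haS
  have haA : a ∉ A := by simp [hA]
  have hbA : b ∈ A := by simp [hA, hba]
  have hcA : c ∉ A := by simp [hA, hkc.le]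
  have hdA : d ∉ A := by simp [hA, hkd.le]
  have haB : a ∉ A.erase b := fun h => haA (Finset.mem_of_mem_erase h)
  have hxb : x ≠ b := fun e => by rw [e, hb] at hxa; exact lt_irrefl _ hxa
  have h2 := two_le_card_linkCut hT haB hx (by simp [hA, hxa', hxb])
    (y := c) ⟨hac', _, hc, by simp, by simp⟩ (by simp [hcA])
  have hne : ({a, b, c} : Finset W) ≠ {a, b, d} := fun e => by
    have : c ∈ ({a, b, d} : Finset W) := e ▸ by simp
    simp only [Finset.mem_insert, Finset.mem_singleton] at this
    rcases this with h | h | h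
    exacts [hac' h.symm, hbc' h.symm, hcd h]
  have hcard : ∀ z, ({a, b, z} : Finset W) ∈ T → b ≠ z → z ∉ A → a ≠ z →
      {a, b, z} ∈ linkCut T a A ∧ {a, b, z} ∉ linkCut T a (A.erase b) := by
    intro z hz hbz hzA haz
    simp only [linkCut, Finset.mem_filter, hz, true_and,
      card_inter_insert_pair hbz haA, card_inter_insert_pair hbz haB]
    simp [hbA, hzA]
  have hsub : insert {a, b, c} (insert {a, b, d} (linkCut T a (A.erase b))) ⊆
      linkCut T a A := by
    intro t ht
    simp only [Finset.mem_insert] at ht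
    rcases ht with rfl | rfl | ht
    · exact (hcard c hc hbc' hcA hac').1
    · exact (hcard d hd hbd' hdA had').1
    · obtain ⟨htT, hat, x, hxt, y, hyt, hxA, hyA, hya⟩ := (mem_linkCut hT haB).1 ht
      refine (mem_linkCut hT haA).2 ⟨htT, hat, x, hxt, y, hyt, Finset.mem_of_mem_erase hxA, ?_,
        hya⟩
      intro hyA'
      have hyb : y = b := by
        by_contra hyb
        exact hyA (Finset.mem_erase.2 ⟨hyb, hyA'⟩)
      subst hyb
      rcases eq_or_eq_of_common_edge hT hc hd htT hne hab (by simp) (by simp) (by simp) (by simp)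
        hat hyt with rfl | rfl
      · exact (hcard c hc hbc' hcA hac').2 ht
      · exact (hcard d hd hbd' hdA had').2 ht
  have := Finset.card_le_card hsub
  rw [Finset.card_insert_of_notMem, Finset.card_insert_of_notMem] at this
  · omega
  · exact (hcard d hd hbd' hdA had').2
  · simp only [Finset.mem_insert, not_or]
    exact ⟨hne, (hcard c hc hbc' hcA hac').2⟩

end Sphere

/-! ### Coning off the boundary of a triangulated disk -/

lemma insert_face {V : Type*} {K : AbstractSimplicialComplex V} {s t : Finset V}
    (ht : t ∈ K.faces) (hst : s ⊆ t) (hs : s.Nonempty) : s ∈ K.faces :=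
  (K.isRelLowerSet_faces ht).2 hst hs

lemma adj_of_mem_triangle {V : Type*} [DecidableEq V] {K : AbstractSimplicialComplex V}
    {t : Finset V} (ht : t ∈ triangles K) {u v : V} (hu : u ∈ t) (hv : v ∈ t) (huv : u ≠ v) :
    (edgeGraph K).Adj u v :=
  ⟨huv, insert_face ht.1 (by intro x; simp; rintro (rfl | rfl) <;> assumption) (by simp)⟩

lemma mem_edges_iff_adj {V : Type*} [DecidableEq V] {K : AbstractSimplicialComplex V} {u v : V}
    (huv : u ≠ v) : ({u, v} : Finset V) ∈ edges K ↔ (edgeGraph K).Adj u v := by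
  simp [edges, edgeGraph, huv]

/-- The triangles of the sphere obtained from a triangulated disk by joining all boundary edges to
a new vertex `none`. -/
noncomputable def sphereTriangles {V : Type*} [Fintype V] [DecidableEq V] {n : ℕ}
    (K : AbstractSimplicialComplex V) (b : ZMod n → V) : Finset (Finset (Option V)) :=
  (Set.toFinite {t : Finset (Option V) | (∃ s ∈ triangles K, t = s.image some) ∨
    ∃ i, t = {none, some (b i), some (b (i + 1))}}).toFinset

section Disk

variable {V : Type*} [Fintype V] [DecidableEq V] {n : ℕ} {K : AbstractSimplicialComplex V}
  {b : ZMod n → V}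

lemma mem_sphereTriangles {t : Finset (Option V)} : t ∈ sphereTriangles K b ↔
    (∃ s ∈ triangles K, t = s.image some) ∨ ∃ i, t = {none, some (b i), some (b (i + 1))} := by
  simp [sphereTriangles]

lemma image_some_mem_sphereTriangles {s : Finset V} :
    s.image some ∈ sphereTriangles K b ↔ s ∈ triangles K := by
  rw [mem_sphereTriangles]
  constructor
  · rintro (⟨s', hs', h⟩ | ⟨i, h⟩)
    · rwa [Finset.image_injective (Option.some_injective V) h]
    · have : none ∈ s.image some := by rw [h]; simp
      simp at this
  · exact fun h => Or.inl ⟨s, h, rfl⟩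

lemma triple_mem_sphereTriangles {u v w : V} (h : ({u, v, w} : Finset V) ∈ triangles K) :
    ({some u, some v, some w} : Finset (Option V)) ∈ sphereTriangles K b := by
  have := (image_some_mem_sphereTriangles (b := b)).2 h
  simpa [Finset.image_insert] using this

lemma cone_mem_sphereTriangles (K : AbstractSimplicialComplex V) (b : ZMod n → V) (i : ZMod n) :
    ({none, some (b i), some (b (i + 1))} : Finset (Option V)) ∈ sphereTriangles K b :=
  mem_sphereTriangles.2 (Or.inr ⟨i, rfl⟩)

lemma zmod_one_ne_zero (hn : 3 ≤ n) : (1 : ZMod n) ≠ 0 := by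
  have : Fact (1 < n) := ⟨by omega⟩
  exact one_ne_zero

lemma zmod_two_ne_zero (hn : 3 ≤ n) : (2 : ZMod n) ≠ 0 := by
  intro h
  have h2 : ((2 : ℕ) : ZMod n) = 0 := by exact_mod_cast h
  rw [ZMod.natCast_eq_zero_iff] at h2
  have := Nat.le_of_dvd (by norm_num) h2
  omega

lemma boundary_pair_injective (hn : 3 ≤ n) (hb : Function.Injective b) {i j : ZMod n}
    (h : ({b i, b (i + 1)} : Finset V) = {b j, b (j + 1)}) : i = j := by
  have hi : b i ∈ ({b j, b (j + 1)} : Finset V) := h ▸ by simp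
  have hi' : b (i + 1) ∈ ({b j, b (j + 1)} : Finset V) := h ▸ by simp
  simp only [Finset.mem_insert, Finset.mem_singleton, hb.eq_iff] at hi hi'
  rcases hi with hi | hi
  · exact hi
  · rcases hi' with hi' | hi'
    · exfalso
      apply zmod_two_ne_zero hn
      have : j + 1 + 1 = j := by rw [← hi, hi']
      linear_combination this
    · exact add_right_cancel hi'

lemma IsDiskTriangulation.adj_boundary (hD : IsDiskTriangulation K b) (i : ZMod n) :
    ({b i, b (i + 1)} : Finset V) ∈ edges K ∧
      (trianglesContaining K {b i, b (i + 1)}).ncard = 1 := by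
  have : ({b i, b (i + 1)} : Finset V) ∈
      Set.range fun i : ZMod n => ({b i, b (i + 1)} : Finset V) := ⟨i, rfl⟩
  rwa [← hD.boundary_edges] at this

lemma IsDiskTriangulation.ncard_eq_two (hD : IsDiskTriangulation K b) {e : Finset V}
    (he : e ∈ edges K) (hbd : ∀ i, e ≠ {b i, b (i + 1)}) :
    (trianglesContaining K e).ncard = 2 := by
  have h2 := hD.edge_le_two e he
  obtain ⟨t, ht, het⟩ := hD.pure e he.1
  have h0 : 0 < (trianglesContaining K e).ncard :=
    (Set.ncard_pos (Set.toFinite _)).2 ⟨t, ht, het⟩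
  have h1 : (trianglesContaining K e).ncard ≠ 1 := by
    intro h1
    have : e ∈ {e | e ∈ edges K ∧ (trianglesContaining K e).ncard = 1} := ⟨he, h1⟩
    rw [hD.boundary_edges] at this
    obtain ⟨i, hi⟩ := this
    exact hbd i hi.symm
  omega

lemma IsDiskTriangulation.boundary_ne (hD : IsDiskTriangulation K b) (hn : 3 ≤ n) (i : ZMod n) :
    b i ≠ b (i + 1) := fun h => by
  have := hD.boundary_injective h
  exact zmod_one_ne_zero hn (by linear_combination -this)

lemma IsDiskTriangulation.tAdj_some_iff (hD : IsDiskTriangulation K b) {u v : V} :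
    TAdj (sphereTriangles K b) (some u) (some v) ↔ (edgeGraph K).Adj u v := by
  constructor
  · rintro ⟨huv, t, ht, hu, hv⟩
    have huv' : u ≠ v := fun h => huv (congrArg some h)
    rcases mem_sphereTriangles.1 ht with ⟨s, hs, rfl⟩ | ⟨i, rfl⟩
    · simp only [Finset.mem_image, Option.some.injEq, exists_eq_right] at hu hv
      exact adj_of_mem_triangle hs hu hv huv'
    · have h := (hD.adj_boundary i).1
      simp only [Finset.mem_insert, Finset.mem_singleton, Option.some.injEq, reduceCtorEq,
        false_or] at hu hv
      rcases hu with rfl | rfl <;> rcases hv with rfl | rfl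
      · exact absurd rfl huv'
      · exact ⟨huv', h.1⟩
      · exact ⟨huv', by rw [Finset.pair_comm]; exact h.1⟩
      · exact absurd rfl huv'
  · intro h
    obtain ⟨t, ht, huv⟩ := hD.pure _ h.2
    exact ⟨fun e => h.1 (Option.some_injective _ e), _, image_some_mem_sphereTriangles.2 ht,
      by simpa using huv (by simp), by simpa using huv (by simp)⟩

lemma IsDiskTriangulation.tAdj_none_iff {v : V} :
    TAdj (sphereTriangles K b) (some v) none ↔ v ∈ Set.range b := by
  constructor
  · rintro ⟨-, t, ht, hv, hN⟩
    rcases mem_sphereTriangles.1 ht with ⟨s, hs, rfl⟩ | ⟨i, rfl⟩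
    · simp at hN
    · simp only [Finset.mem_insert, Finset.mem_singleton, Option.some.injEq, reduceCtorEq,
        false_or] at hv
      rcases hv with rfl | rfl
      exacts [⟨i, rfl⟩, ⟨i + 1, rfl⟩]
  · rintro ⟨i, rfl⟩
    exact ⟨by simp, _, cone_mem_sphereTriangles K b i, by simp, by simp⟩

lemma cone_injective (hn : 3 ≤ n) (hb : Function.Injective b) {i j : ZMod n}
    (h : ({none, some (b i), some (b (i + 1))} : Finset (Option V)) =
      {none, some (b j), some (b (j + 1))}) : i = j := by
  apply boundary_pair_injective hn hb
  ext x
  have : some x ∈ ({none, some (b i), some (b (i + 1))} : Finset (Option V)) ↔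
      some x ∈ ({none, some (b j), some (b (j + 1))} : Finset (Option V)) := by rw [h]
  simpa using this

lemma IsDiskTriangulation.card_sphere_edge (hD : IsDiskTriangulation K b) (hn : 3 ≤ n)
    {u v : Option V} (huv : TAdj (sphereTriangles K b) u v) :
    ((sphereTriangles K b).filter fun s => u ∈ s ∧ v ∈ s).card = 2 := by
  have hnone : ∀ v : V, TAdj (sphereTriangles K b) (some v) none →
      ((sphereTriangles K b).filter fun s => some v ∈ s ∧ none ∈ s).card = 2 := by
    intro v hv
    obtain ⟨i, rfl⟩ := IsDiskTriangulation.tAdj_none_iff.1 hv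
    have hne : ({none, some (b i), some (b (i + 1))} : Finset (Option V)) ≠
        {none, some (b (i - 1)), some (b (i - 1 + 1))} := fun h => by
      have := cone_injective hn hD.boundary_injective h
      exact zmod_one_ne_zero hn (by linear_combination this)
    rw [← Finset.card_pair hne]
    congr 1
    ext t
    simp only [Finset.mem_filter, Finset.mem_insert, Finset.mem_singleton]
    constructor
    · rintro ⟨ht, hit, hNt⟩
      rcases mem_sphereTriangles.1 ht with ⟨s, hs, rfl⟩ | ⟨j, rfl⟩
      · simp at hNt
      · simp only [Finset.mem_insert, Finset.mem_singleton, Option.some.injEq, reduceCtorEq,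
          false_or, hD.boundary_injective.eq_iff] at hit
        rcases hit with rfl | rfl
        · exact Or.inl rfl
        · right; simp
    · rintro (rfl | rfl)
      · exact ⟨cone_mem_sphereTriangles K b i, by simp, by simp⟩
      · exact ⟨cone_mem_sphereTriangles K b (i - 1), by simp, by simp⟩
  rcases u with _ | u
  · rcases v with _ | v
    · exact absurd rfl huv.1
    · simp only [and_comm (a := none ∈ _)]
      exact hnone v huv.symm
  · rcases v with _ | v
    · exact hnone u huv
    · have hadj := hD.tAdj_some_iff.1 huv
      have he := (mem_edges_iff_adj hadj.1).2 hadj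
      have hsub : ∀ s : Finset V, ({u, v} : Finset V) ⊆ s ↔ u ∈ s ∧ v ∈ s := by
        intro s; simp [Finset.insert_subset_iff]
      by_cases hbd : ∃ i, ({u, v} : Finset V) = {b i, b (i + 1)}
      · obtain ⟨i, hi⟩ := hbd
        have h1 := (hD.adj_boundary i).2
        rw [← hi, Set.ncard_eq_one] at h1
        obtain ⟨s, hs⟩ := h1
        have hsm : s ∈ trianglesContaining K {u, v} := by rw [hs]; rfl
        have hne : s.image some ≠ {none, some (b i), some (b (i + 1))} := fun h => by
          have : none ∈ s.image some := by rw [h]; simp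
          simp at this
        rw [← Finset.card_pair hne]
        congr 1
        ext t
        simp only [Finset.mem_filter, Finset.mem_insert, Finset.mem_singleton]
        constructor
        · rintro ⟨ht, hut, hvt⟩
          rcases mem_sphereTriangles.1 ht with ⟨s', hs', rfl⟩ | ⟨j, rfl⟩
          · left
            have : s' ∈ trianglesContaining K {u, v} :=
              ⟨hs', (hsub _).2 ⟨by simpa using hut, by simpa using hvt⟩⟩
            rw [hs] at this
            rw [show s' = s from this]
          · right
            have : ({u, v} : Finset V) = {b j, b (j + 1)} := by
              apply Finset.eq_of_subset_of_card_le
              · exact (hsub _).2 ⟨by simpa using hut, by simpa using hvt⟩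
              · rw [Finset.card_pair hadj.1]; exact Finset.card_le_two
            rw [boundary_pair_injective hn hD.boundary_injective (hi.symm.trans this)]
        · have hu' : u ∈ ({b i, b (i + 1)} : Finset V) := by rw [← hi]; simp
          have hv' : v ∈ ({b i, b (i + 1)} : Finset V) := by rw [← hi]; simp
          have := (hsub s).1 hsm.2
          rintro (rfl | rfl)
          · exact ⟨image_some_mem_sphereTriangles.2 hsm.1, by simpa using this.1,
              by simpa using this.2⟩
          · exact ⟨cone_mem_sphereTriangles K b i, by simpa using hu', by simpa using hv'⟩
      · push Not at hbd
        obtain ⟨s₁, s₂, hne, hs⟩ := Set.ncard_eq_two.1 (hD.ncard_eq_two he hbd)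
        have hne' : s₁.image some ≠ s₂.image some := fun h =>
          hne (Finset.image_injective (Option.some_injective V) h)
        have hm₁ : s₁ ∈ trianglesContaining K {u, v} := by rw [hs]; simp
        have hm₂ : s₂ ∈ trianglesContaining K {u, v} := by rw [hs]; simp
        rw [← Finset.card_pair hne']
        congr 1
        ext t
        simp only [Finset.mem_filter, Finset.mem_insert, Finset.mem_singleton]
        constructor
        · rintro ⟨ht, hut, hvt⟩
          rcases mem_sphereTriangles.1 ht with ⟨s', hs', rfl⟩ | ⟨j, rfl⟩
          · have : s' ∈ trianglesContaining K {u, v} :=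
              ⟨hs', (hsub _).2 ⟨by simpa using hut, by simpa using hvt⟩⟩
            rw [hs] at this
            rcases this with rfl | rfl <;> simp
          · exfalso
            apply hbd j
            apply Finset.eq_of_subset_of_card_le
            · exact (hsub _).2 ⟨by simpa using hut, by simpa using hvt⟩
            · rw [Finset.card_pair hadj.1]; exact Finset.card_le_two
        · have h1 := (hsub s₁).1 hm₁.2
          have h2 := (hsub s₂).1 hm₂.2
          rintro (rfl | rfl)
          · exact ⟨image_some_mem_sphereTriangles.2 hm₁.1, by simpa using h1.1, by simpa using h1.2⟩
          · exact ⟨image_some_mem_sphereTriangles.2 hm₂.1, by simpa using h2.1, by simpa using h2.2⟩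

lemma zmod_forall_of_succ [NeZero n] {P : ZMod n → Prop} {i₀ : ZMod n} (h0 : P i₀)
    (h : ∀ i, P i → P (i + 1)) (i : ZMod n) : P i := by
  have : ∀ k : ℕ, P (i₀ + k) := by
    intro k
    induction k with
    | zero => simpa using h0
    | succ k ih => rw [Nat.cast_succ, ← add_assoc]; exact h _ ih
  have h1 := this (i - i₀).val
  rw [ZMod.natCast_zmod_val] at h1
  simpa using h1

lemma IsDiskTriangulation.card_triangles (hD : IsDiskTriangulation K b) (hn : 3 ≤ n) :
    3 * (triangles K).ncard + n = 2 * (edges K).ncard := by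
  classical
  have : NeZero n := ⟨by omega⟩
  set F := (Set.toFinite (triangles K)).toFinset with hF
  set E := (Set.toFinite (edges K)).toFinset with hE
  set B : Finset (Finset V) := Finset.univ.image fun i : ZMod n => ({b i, b (i + 1)} : Finset V)
    with hB
  have hBcard : B.card = n := by
    rw [hB, Finset.card_image_of_injective _ fun i j h =>
      boundary_pair_injective hn hD.boundary_injective h, Finset.card_univ, ZMod.card]
  have hBE : B ⊆ E := by
    intro e he
    simp only [hB, Finset.mem_image, Finset.mem_univ, true_and] at he
    obtain ⟨i, rfl⟩ := he
    simpa [hE] using (hD.adj_boundary i).1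
  have h1 : ∀ t ∈ F, (E.filter fun e => e ⊆ t).card = 3 := by
    intro t ht
    have ht' : t ∈ triangles K := by simpa [hF] using ht
    have : E.filter (fun e => e ⊆ t) = t.powersetCard 2 := by
      ext e
      simp only [hE, Finset.mem_filter, Set.Finite.mem_toFinset, Finset.mem_powersetCard, edges,
        Set.mem_ofPred_eq]
      constructor
      · rintro ⟨⟨-, h⟩, h'⟩; exact ⟨h', h⟩
      · rintro ⟨h, h'⟩
        exact ⟨⟨insert_face ht'.1 h (Finset.card_pos.1 (by omega)), h'⟩, h⟩
    rw [this, Finset.card_powersetCard, ht'.2]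
    rfl
  have h2 : ∀ e ∈ E, (F.filter fun t => e ⊆ t).card + (if e ∈ B then 1 else 0) = 2 := by
    intro e he
    have he' : e ∈ edges K := by simpa [hE] using he
    have hc : (F.filter fun t => e ⊆ t).card = (trianglesContaining K e).ncard := by
      rw [← Set.ncard_coe_finset]
      congr 1
      ext t
      simp [hF, trianglesContaining]
    rw [hc]
    split_ifs with heB
    · simp only [hB, Finset.mem_image, Finset.mem_univ, true_and] at heB
      obtain ⟨i, rfl⟩ := heB
      rw [(hD.adj_boundary i).2]
    · rw [hD.ncard_eq_two he' fun i hi => heB (by rw [hi, hB]; simp)]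
  have h3 := Finset.sum_congr rfl h2
  rw [Finset.sum_add_distrib, ← Finset.card_filter, Finset.filter_mem_eq_inter,
    Finset.inter_eq_right.2 hBE, hBcard, Finset.sum_const, smul_eq_mul] at h3
  have h4 : ∑ e ∈ E, (F.filter fun t => e ⊆ t).card = ∑ t ∈ F, (E.filter fun e => e ⊆ t).card := by
    simp only [Finset.card_filter]
    exact Finset.sum_comm
  rw [h4, Finset.sum_congr rfl h1, Finset.sum_const, smul_eq_mul] at h3
  have hFc : (triangles K).ncard = F.card := by
    rw [← Set.ncard_coe_finset, hF, Set.Finite.coe_toFinset]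
  have hEc : (edges K).ncard = E.card := by
    rw [← Set.ncard_coe_finset, hE, Set.Finite.coe_toFinset]
  omega

/-- Coning off the boundary of a triangulated disk gives a triangulated sphere. -/
theorem IsDiskTriangulation.isTriangulatedSphere (hD : IsDiskTriangulation K b) (hn : 3 ≤ n) :
    IsTriangulatedSphere (sphereTriangles K b) := by
  classical
  have : NeZero n := ⟨by omega⟩
  refine ⟨?_, ?_, ?_, ?_, ?_⟩
  · intro t ht
    rcases mem_sphereTriangles.1 ht with ⟨s, hs, rfl⟩ | ⟨i, rfl⟩
    · rw [Finset.card_image_of_injective _ (Option.some_injective V), hs.2]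
    · rw [Finset.card_eq_three]
      exact ⟨none, some (b i), some (b (i + 1)), by simp, by simp,
        by simpa using hD.boundary_ne hn i, rfl⟩
  · exact fun t ht u hu v hv huv => hD.card_sphere_edge hn ⟨huv, t, ht, hu, hv⟩
  · intro v A hex hcl
    rcases v with _ | v
    · have hA : ∀ i, some (b i) ∈ A := by
        obtain ⟨t, ht, hvt, u, hu, huv, huA⟩ := hex
        obtain ⟨u, rfl⟩ := Option.ne_none_iff_exists'.1 huv
        obtain ⟨i, rfl⟩ := IsDiskTriangulation.tAdj_none_iff.1
          (⟨by simp, t, ht, hu, hvt⟩ : TAdj (sphereTriangles K b) (some u) none)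
        exact zmod_forall_of_succ (i₀ := i) huA fun j hj =>
          hcl _ (cone_mem_sphereTriangles K b j) (by simp) _ (by simp) (by simp) hj _ (by simp)
            (by simp)
      intro t ht hvt u hu huv
      obtain ⟨u, rfl⟩ := Option.ne_none_iff_exists'.1 huv
      obtain ⟨i, rfl⟩ := IsDiskTriangulation.tAdj_none_iff.1
          (⟨by simp, t, ht, hu, hvt⟩ : TAdj (sphereTriangles K b) (some u) none)
      exact hA i
    · have hnb : ∃ u, (edgeGraph K).Adj v u ∧ some u ∈ A := by
        obtain ⟨t, ht, hvt, u, hu, huv, huA⟩ := hex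
        rcases u with _ | u
        · rcases mem_sphereTriangles.1 ht with ⟨s, hs, rfl⟩ | ⟨i, rfl⟩
          · simp at hu
          · have h := hcl _ ht hvt _ hu huv huA
            simp only [Finset.mem_insert, Finset.mem_singleton, Option.some.injEq, reduceCtorEq,
              false_or] at hvt
            rcases hvt with rfl | rfl
            · exact ⟨b (i + 1), (mem_edges_iff_adj (hD.boundary_ne hn i)).1
                (hD.adj_boundary i).1, h _ (by simp) (by simpa using (hD.boundary_ne hn i).symm)⟩
            · exact ⟨b i, ((mem_edges_iff_adj (hD.boundary_ne hn i)).1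
                (hD.adj_boundary i).1).symm, h _ (by simp) (by simpa using hD.boundary_ne hn i)⟩
        · exact ⟨u, hD.tAdj_some_iff.1 ⟨huv.symm, t, ht, hvt, hu⟩, huA⟩
      have hall : ∀ u, (edgeGraph K).Adj v u → some u ∈ A := by
        obtain ⟨u₀, hu₀, hu₀A⟩ := hnb
        intro u hu
        have hreach : Relation.ReflTransGen (linkGraph K v).Adj ⟨u₀, hu₀⟩ ⟨u, hu⟩ :=
          (SimpleGraph.reachable_iff_reflTransGen _ _).1 ((hD.link_connected v).preconnected _ _)
        have : ∀ w, Relation.ReflTransGen (linkGraph K v).Adj ⟨u₀, hu₀⟩ w → some w.1 ∈ A := by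
          intro w hw
          induction hw with
          | refl => exact hu₀A
          | @tail x y _ hxy ih =>
            have hxy1 : x.1 ≠ y.1 := fun h => hxy.1 (Subtype.ext h)
            have ht : ({v, x.1, y.1} : Finset V) ∈ triangles K :=
              ⟨hxy.2, Finset.card_eq_three.2 ⟨_, _, _, x.2.1, y.2.1, hxy1, rfl⟩⟩
            exact hcl _ (triple_mem_sphereTriangles ht) (by simp) _ (by simp)
              (by simpa using x.2.1.symm) ih _ (by simp) (by simpa using y.2.1.symm)
        exact this _ hreach
      intro t ht hvt u hu huv
      rcases u with _ | u
      · rcases mem_sphereTriangles.1 ht with ⟨s, hs, rfl⟩ | ⟨i, rfl⟩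
        · simp at hu
        · have hvt' := hvt
          simp only [Finset.mem_insert, Finset.mem_singleton, Option.some.injEq, reduceCtorEq,
            false_or] at hvt'
          rcases hvt' with rfl | rfl
          · exact hcl _ ht hvt (some (b (i + 1))) (by simp)
              (by simpa using (hD.boundary_ne hn i).symm)
              (hall _ ((mem_edges_iff_adj (hD.boundary_ne hn i)).1 (hD.adj_boundary i).1)) _ hu huv
          · exact hcl _ ht hvt (some (b i)) (by simp) (by simpa using hD.boundary_ne hn i)
              (hall _ ((mem_edges_iff_adj (hD.boundary_ne hn i)).1 (hD.adj_boundary i).1).symm)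
              _ hu huv
      · exact hall u (hD.tAdj_some_iff.1 ⟨huv.symm, t, ht, hvt, hu⟩)
  · intro A hA hcl
    have hstep : ∀ u v, TAdj (sphereTriangles K b) u v → u ∈ A → v ∈ A := by
      rintro u v ⟨-, t, ht, hu, hv⟩ huA
      exact hcl t ht u hu huA v hv
    have hsome : ∃ v, some v ∈ A := by
      obtain ⟨x, hx⟩ := hA
      rcases x with _ | v
      · exact ⟨b 0, hcl _ (cone_mem_sphereTriangles K b 0) _ (by simp) hx _ (by simp)⟩
      · exact ⟨v, hx⟩
    obtain ⟨v₀, hv₀⟩ := hsome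
    have hall : ∀ v, some v ∈ A := by
      intro v
      have hreach : Relation.ReflTransGen (edgeGraph K).Adj v₀ v :=
        (SimpleGraph.reachable_iff_reflTransGen _ _).1 (hD.connected v₀ v)
      induction hreach with
      | refl => exact hv₀
      | tail _ h ih => exact hstep _ _ (hD.tAdj_some_iff.2 h) ih
    ext x
    simp only [Finset.mem_univ, iff_true]
    rcases x with _ | v
    · exact hcl _ (cone_mem_sphereTriangles K b 0) (some (b 0)) (by simp) (hall _) _ (by simp)
    · exact hall v
  · have h1 := hD.card_triangles hn
    have h2 := hD.euler
    have hT : (sphereTriangles K b).card = (triangles K).ncard + n := by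
      have : sphereTriangles K b =
          (Set.toFinite (triangles K)).toFinset.image (fun s => s.image some) ∪
          Finset.univ.image fun i : ZMod n =>
            ({none, some (b i), some (b (i + 1))} : Finset (Option V)) := by
        ext t
        simp only [mem_sphereTriangles, Finset.mem_union, Finset.mem_image,
          Set.Finite.mem_toFinset, Finset.mem_univ, true_and, eq_comm]
      rw [this, Finset.card_union_of_disjoint, Finset.card_image_of_injective,
        Finset.card_image_of_injective, Finset.card_univ, ZMod.card, ← Set.ncard_coe_finset,
        Set.Finite.coe_toFinset]
      · exact fun i j h => cone_injective hn hD.boundary_injective h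
      · exact Finset.image_injective (Option.some_injective V)
      · rw [Finset.disjoint_left]
        intro t ht ht'
        simp only [Finset.mem_image, Finset.mem_univ, true_and] at ht ht'
        obtain ⟨s, -, rfl⟩ := ht
        obtain ⟨i, hi⟩ := ht'
        have : none ∈ s.image some := by rw [← hi]; simp
        simp at this
    rw [hT, Fintype.card_option]
    omega

end Disk

/-! ### The cross product in the plane -/

/-- The cross product of two plane vectors, as a linear function of the second one. Every linear
functional on the plane has this form; its level lines have the direction of the first vector. -/
noncomputable def cross (a : Plane) : Plane →ₗ[ℝ] ℝ where
  toFun x := a 0 * x 1 - a 1 * x 0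
  map_add' x y := by simp; ring
  map_smul' c x := by simp; ring

lemma cross_apply (a x : Plane) : cross a x = a 0 * x 1 - a 1 * x 0 := rfl

lemma cross_self (a : Plane) : cross a a = 0 := by rw [cross_apply]; ring

lemma cross_comm (a x : Plane) : cross a x = - cross x a := by rw [cross_apply, cross_apply]; ring

lemma cross_neg_left (a x : Plane) : cross (-a) x = - cross a x := by
  simp [cross_apply]; ring

lemma cross_smul_left (s : ℝ) (a x : Plane) : cross (s • a) x = s * cross a x := by
  simp [cross_apply]; ring

lemma plane_ext {x y : Plane} (h0 : x 0 = y 0) (h1 : x 1 = y 1) : x = y := by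
  ext i
  fin_cases i
  · exact h0
  · exact h1

/-- Cramer's rule in the plane. -/
lemma cross_smul_eq (a b d : Plane) : cross a b • d = cross d b • a - cross d a • b := by
  apply plane_ext <;> simp [cross_apply] <;> ring

lemma eq_smul_of_cross_eq_zero {a x : Plane} (ha : a ≠ 0) (h : cross a x = 0) :
    ∃ s : ℝ, x = s • a := by
  have hsq : a 0 ^ 2 + a 1 ^ 2 ≠ 0 := by
    intro h0
    apply ha
    apply plane_ext
    · simp only [PiLp.zero_apply]; nlinarith [sq_nonneg (a 0), sq_nonneg (a 1)]
    · simp only [PiLp.zero_apply]; nlinarith [sq_nonneg (a 0), sq_nonneg (a 1)]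
  rw [cross_apply] at h
  refine ⟨(a 0 * x 0 + a 1 * x 1) / (a 0 ^ 2 + a 1 ^ 2), ?_⟩
  apply plane_ext <;> simp only [PiLp.smul_apply, smul_eq_mul] <;>
    rw [div_mul_eq_mul_div, eq_div_iff hsq]
  · linear_combination -(a 1) * h
  · linear_combination (a 0) * h

lemma exists_cross_pos {d : Plane} (hd : d ≠ 0) : ∃ x, 0 < cross d x := by
  refine ⟨!₂[-(d 1), d 0], ?_⟩
  simp only [cross_apply, Matrix.cons_val_zero, Matrix.cons_val_one]
  by_contra h
  apply hd
  apply plane_ext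
  · simp only [PiLp.zero_apply]; nlinarith [sq_nonneg (d 0), sq_nonneg (d 1)]
  · simp only [PiLp.zero_apply]; nlinarith [sq_nonneg (d 0), sq_nonneg (d 1)]

lemma exists_eq_cross (f : Plane →ₗ[ℝ] ℝ) : ∃ a, f = cross a := by
  refine ⟨!₂[f !₂[0, 1], - f !₂[1, 0]], LinearMap.ext fun x => ?_⟩
  have hx : x = x 0 • !₂[(1 : ℝ), 0] + x 1 • !₂[(0 : ℝ), 1] := by
    apply plane_ext <;> simp
  conv_lhs => rw [hx]
  rw [map_add, map_smul, map_smul, cross_apply]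
  simp
  ring

lemma cross_linear_left (r s : ℝ) (a b x : Plane) :
    cross (r • a + s • b) x = r * cross a x + s * cross b x := by
  simp [cross_apply]; ring

/-- The dot product in coordinates. -/
def dot (a x : Plane) : ℝ := a 0 * x 0 + a 1 * x 1

lemma dot_self_pos {d : Plane} (hd : d ≠ 0) : 0 < dot d d := by
  by_contra h
  rw [dot] at h
  apply hd
  apply plane_ext
  · simp only [PiLp.zero_apply]; nlinarith [sq_nonneg (d 0), sq_nonneg (d 1)]
  · simp only [PiLp.zero_apply]; nlinarith [sq_nonneg (d 0), sq_nonneg (d 1)]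

lemma dot_self_mul_cross (d x y : Plane) :
    dot d d * cross x y = dot d x * cross d y - dot d y * cross d x := by
  simp only [dot, cross_apply]; ring

/-! ### Vectors surrounding the origin -/

/-- If every vector of a finite family has another one of the family strictly on its left, then the
family is not contained in a closed half-plane. -/
lemma exists_cross_pos_of_surrounding {ι : Type*} {N : Finset ι} (hN : N.Nonempty) {e : ι → Plane}
    (hL : ∀ u ∈ N, ∃ w ∈ N, 0 < cross (e u) (e w)) {d : Plane} (hd : d ≠ 0) :
    ∃ u ∈ N, 0 < cross d (e u) := by
  classical
  by_contra! hcon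
  have hdd := dot_self_pos hd
  by_cases hneg : ∃ u ∈ N, cross d (e u) < 0
  · -- Take the vector closest to the direction of `d` among those strictly on its right.
    obtain ⟨u₀, hu₀, hu₀'⟩ := hneg
    obtain ⟨u, hu, hmax⟩ := Finset.exists_max_image (N.filter fun u => cross d (e u) < 0)
      (fun u => - (dot d (e u) / cross d (e u))) ⟨u₀, by simp [hu₀, hu₀']⟩
    rw [Finset.mem_filter] at hu
    obtain ⟨w, hw, huw⟩ := hL u hu.1
    have h1 := dot_self_mul_cross d (e u) (e w)
    have h2 : 0 < dot d d * cross (e u) (e w) := mul_pos hdd huw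
    rcases (hcon w hw).lt_or_eq with h | h
    · have h3 := hmax w (by simp [hw, h])
      rw [neg_le_neg_iff, ← neg_div_neg_eq (dot d (e u)), ← neg_div_neg_eq (dot d (e w)),
        div_le_div_iff₀ (neg_pos.2 hu.2) (neg_pos.2 h)] at h3
      linarith
    · rw [h, mul_zero, zero_sub] at h1
      have hdw : 0 < dot d (e w) := by nlinarith
      obtain ⟨x, hx, hwx⟩ := hL w hw
      have h4 := dot_self_mul_cross d (e w) (e x)
      rw [h, mul_zero, sub_zero] at h4
      have h5 : 0 < dot d d * cross (e w) (e x) := mul_pos hdd hwx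
      rw [h4] at h5
      have := hcon x hx
      nlinarith
  · push Not at hneg
    obtain ⟨u, hu⟩ := hN
    obtain ⟨w, hw, huw⟩ := hL u hu
    have h1 := dot_self_mul_cross d (e u) (e w)
    rw [le_antisymm (hcon u hu) (hneg u hu), le_antisymm (hcon w hw) (hneg w hw)] at h1
    have := mul_pos hdd huw
    linarith

/-- If every vector of a finite family has others of the family strictly on its left and on its
right, then the sectors spanned by such pairs cover the plane. -/
lemma exists_sector_of_surrounding {ι : Type*} {N : Finset ι} (hN : N.Nonempty) {e : ι → Plane}
    {R : ι → ι → Prop} (hL : ∀ u ∈ N, ∃ w ∈ N, 0 < cross (e u) (e w))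
    (hR : ∀ u ∈ N, ∃ w ∈ N, R u w ∧ cross (e u) (e w) < 0) {d : Plane} (hd : d ≠ 0) :
    ∃ u ∈ N, ∃ w ∈ N, R u w ∧ ∃ α β : ℝ, 0 ≤ α ∧ 0 ≤ β ∧ d = α • e u + β • e w := by
  classical
  obtain ⟨u₀, hu₀, hu₀'⟩ := exists_cross_pos_of_surrounding hN hL hd
  obtain ⟨u, hu, hmax⟩ := Finset.exists_max_image (N.filter fun u => 0 < cross d (e u))
    (fun u => dot d (e u) / cross d (e u)) ⟨u₀, by simp [hu₀, hu₀']⟩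
  rw [Finset.mem_filter] at hu
  obtain ⟨w, hw, hRuw, huw⟩ := hR u hu.1
  have hdd := dot_self_pos hd
  have h1 := dot_self_mul_cross d (e u) (e w)
  have h2 : dot d d * cross (e u) (e w) < 0 := mul_neg_of_pos_of_neg hdd huw
  have hdw : cross d (e w) ≤ 0 := by
    by_contra! h
    have h3 := hmax w (by simp [hw, h])
    rw [div_le_div_iff₀ h hu.2] at h3
    linarith
  refine ⟨u, hu.1, w, hw, hRuw, cross d (e w) / cross (e u) (e w),
    -(cross d (e u) / cross (e u) (e w)), div_nonneg_of_nonpos hdw huw.le,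
    neg_nonneg.2 (div_nonpos_of_nonneg_of_nonpos hu.2.le huw.le), ?_⟩
  have h3 := cross_smul_eq (e u) (e w) d
  rw [neg_smul, ← sub_eq_add_neg, div_eq_inv_mul, div_eq_inv_mul, mul_smul, mul_smul, ← smul_sub,
    ← h3, smul_smul, inv_mul_cancel₀ huw.ne, one_smul]

/-! ### Convex polygons -/

section Polygon

variable {n : ℕ} {φ : ZMod n → Plane}

lemma mem_polygonRegion (φ : ZMod n → Plane) (i : ZMod n) : φ i ∈ polygonRegion φ :=
  subset_convexHull ℝ _ ⟨i, rfl⟩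

lemma le_cross_of_mem_polygonRegion {d : Plane} {c : ℝ} (h : ∀ i, c ≤ cross d (φ i)) {x : Plane}
    (hx : x ∈ polygonRegion φ) : c ≤ cross d x := by
  have hconv : Convex ℝ {x | c ≤ cross d x} := convex_halfSpace_ge (cross d).isLinear c
  exact convexHull_min (by rintro _ ⟨i, rfl⟩; exact h i) hconv hx

lemma IsConvexPolygon.notMem_segment (hφ : IsConvexPolygon φ) {i j k : ZMod n} (hij : i ≠ j)
    (hik : i ≠ k) : φ i ∉ segment ℝ (φ j) (φ k) := by
  intro h
  have := hφ.convexIndependent {j, k} i (by rwa [Set.image_pair, convexHull_pair])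
  rcases this with h | h
  exacts [hij h, hik h]

lemma IsConvexPolygon.injective (hφ : IsConvexPolygon φ) : Function.Injective φ :=
  hφ.convexIndependent.injective

lemma IsConvexPolygon.cross_ne_zero (hφ : IsConvexPolygon φ) {i j k : ZMod n} (hij : i ≠ j)
    (hik : i ≠ k) (hjk : j ≠ k) : cross (φ j - φ i) (φ k - φ i) ≠ 0 := by
  intro h
  obtain ⟨s, hs⟩ := eq_smul_of_cross_eq_zero
    (sub_ne_zero.2 fun h => hij (hφ.injective h.symm)) h
  have hk : φ k = φ i + s • (φ j - φ i) := by rw [← hs]; abel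
  rcases lt_or_ge s 0 with hs0 | hs0
  · apply hφ.notMem_segment hij hik
    have h1 : (1 - s) ≠ 0 := by linarith
    refine ⟨-s / (1 - s), 1 / (1 - s), div_nonneg (by linarith) (by linarith),
      div_nonneg (by linarith) (by linarith), by field_simp; ring, ?_⟩
    rw [hk]
    apply plane_ext <;> simp <;> field_simp <;> ring
  · rcases le_or_gt s 1 with hs1 | hs1
    · apply hφ.notMem_segment hik.symm hjk.symm
      refine ⟨1 - s, s, by linarith, hs0, by ring, ?_⟩
      rw [hk]
      apply plane_ext <;> simp <;> ring
    · apply hφ.notMem_segment hij.symm hjk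
      have h1 : s ≠ 0 := by linarith
      refine ⟨(s - 1) / s, 1 / s, div_nonneg (by linarith) (by linarith),
        div_nonneg (by linarith) (by linarith), by field_simp; ring, ?_⟩
      rw [hk]
      apply plane_ext <;> simp <;> field_simp <;> ring

lemma IsConvexPolygon.interior_nonempty (hφ : IsConvexPolygon φ) :
    (interior (polygonRegion φ)).Nonempty := by
  rw [polygonRegion, interior_convexHull_nonempty_iff_affineSpan_eq_top, eq_top_iff]
  intro x _
  have h2 := zmod_two_ne_zero hφ.three_le
  have h1 := zmod_one_ne_zero hφ.three_le
  have hc := hφ.cross_ne_zero (i := 0) (j := 1) (k := 2) h1.symm h2.symm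
    (fun h => h1 (by linear_combination -h))
  have hm : ∀ i, φ i ∈ affineSpan ℝ (Set.range φ) := fun i => subset_affineSpan ℝ _ ⟨i, rfl⟩
  have hd : ∀ i, φ i - φ 0 ∈ (affineSpan ℝ (Set.range φ)).direction := fun i =>
    AffineSubspace.vsub_mem_direction (hm i) (hm 0)
  have hx := cross_smul_eq (φ 1 - φ 0) (φ 2 - φ 0) (x - φ 0)
  have hxd : x - φ 0 ∈ (affineSpan ℝ (Set.range φ)).direction := by
    rw [← one_smul ℝ (x - φ 0), ← inv_mul_cancel₀ hc, mul_smul, hx]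
    exact Submodule.smul_mem _ _ (Submodule.sub_mem _ (Submodule.smul_mem _ _ (hd 1))
      (Submodule.smul_mem _ _ (hd 2)))
  have := AffineSubspace.vadd_mem_of_mem_direction hxd (hm 0)
  simpa using this

/-- The line through a side of a convex polygon has all other corners strictly on one side. -/
lemma IsConvexPolygon.exists_side (hφ : IsConvexPolygon φ) (i : ZMod n) :
    ∃ κ : ℝ, ∀ j, j ≠ i → j ≠ i + 1 → 0 < κ * cross (φ (i + 1) - φ i) (φ j - φ i) := by
  have hi : i ≠ i + 1 := fun h => zmod_one_ne_zero hφ.three_le (by linear_combination -h)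
  have hm : midpoint ℝ (φ i) (φ (i + 1)) ∈ frontier (polygonRegion φ) := by
    rw [hφ.frontier_eq]
    exact Set.mem_iUnion.2 ⟨i, midpoint_mem_segment _ _⟩
  obtain ⟨f, hf⟩ := geometric_hahn_banach_open_point
    (convex_convexHull ℝ (Set.range φ)).interior isOpen_interior hm.2
  have hle : ∀ x ∈ polygonRegion φ, f x ≤ f (midpoint ℝ (φ i) (φ (i + 1))) := by
    intro x hx
    have hxc : x ∈ closure (interior (polygonRegion φ)) := by
      rw [polygonRegion, (convex_convexHull ℝ
        (Set.range φ)).closure_interior_eq_closure_of_nonempty_interior hφ.interior_nonempty]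
      exact subset_closure hx
    exact closure_minimal (t := {x | f x ≤ f (midpoint ℝ (φ i) (φ (i + 1)))})
      (fun y hy => (hf y hy).le) (isClosed_le f.continuous continuous_const) hxc
  have hmid : f (midpoint ℝ (φ i) (φ (i + 1))) = (f (φ i) + f (φ (i + 1))) / 2 := by
    rw [midpoint_eq_smul_add, map_smul, map_add, smul_eq_mul, invOf_eq_inv]
    ring
  have h1 := hle _ (mem_polygonRegion φ i)
  have h2 := hle _ (mem_polygonRegion φ (i + 1))
  obtain ⟨a, ha⟩ := exists_eq_cross (f : Plane →ₗ[ℝ] ℝ)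
  have hfa : ∀ x, f x = cross a x := fun x => by rw [← ha]; rfl
  have ha0 : a ≠ 0 := by
    rintro rfl
    obtain ⟨x, hx⟩ := hφ.interior_nonempty
    have := hf x hx
    rw [hfa, hfa, cross_apply, cross_apply] at this
    simp at this
  have hzero : cross a (φ (i + 1) - φ i) = 0 := by rw [map_sub, ← hfa, ← hfa]; linarith
  obtain ⟨s, hs⟩ := eq_smul_of_cross_eq_zero ha0 hzero
  refine ⟨-s, fun j hji hji' => ?_⟩
  have hne := hφ.cross_ne_zero hi hji.symm hji'.symm
  have hj := hle _ (mem_polygonRegion φ j)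
  have e : cross (φ (i + 1) - φ i) (φ j - φ i) = s * (f (φ j) - f (φ i)) := by
    rw [hs, hfa, hfa, ← map_sub]
    simp only [cross_apply, PiLp.smul_apply, smul_eq_mul]
    ring
  have hs0 : s ≠ 0 := by rintro rfl; rw [e] at hne; simp at hne
  have hlt : f (φ j) - f (φ i) < 0 := by
    refine lt_of_le_of_ne (by linarith) fun h => hne (by rw [e, h, mul_zero])
  rw [e]
  nlinarith [mul_self_pos.2 hs0]

/-- Two distinct corners on a supporting line are consecutive. -/
lemma IsConvexPolygon.consecutive (hφ : IsConvexPolygon φ) {d : Plane} (hd : d ≠ 0) {c : ℝ}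
    (h : ∀ i, c ≤ cross d (φ i)) {i j : ZMod n} (hi : cross d (φ i) = c) (hj : cross d (φ j) = c) :
    ∃ k, (i = k ∨ i = k + 1) ∧ (j = k ∨ j = k + 1) := by
  set m := midpoint ℝ (φ i) (φ j) with hm
  have hmid : ∀ e x, cross e (m - x) = (cross e (φ i - x) + cross e (φ j - x)) / 2 := by
    intro e x
    rw [hm, midpoint_eq_smul_add, invOf_eq_inv, map_sub, map_smul, map_add, smul_eq_mul, map_sub,
      map_sub]
    ring
  have hmc : cross d m = c := by
    have := hmid d 0
    simp only [sub_zero] at this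
    rw [this, hi, hj]; ring
  have hmem : m ∈ polygonRegion φ := (convex_convexHull ℝ (Set.range φ)).segment_subset
    (mem_polygonRegion φ i) (mem_polygonRegion φ j) (midpoint_mem_segment _ _)
  have hfr : m ∈ frontier (polygonRegion φ) := by
    refine ⟨subset_closure hmem, fun hint => ?_⟩
    obtain ⟨x, hx⟩ := exists_cross_pos hd
    have hcont : Filter.Tendsto (fun ε : ℝ => m - ε • x) (nhds 0) (nhds (m - (0 : ℝ) • x)) :=
      Continuous.tendsto (by fun_prop) 0
    rw [zero_smul, sub_zero] at hcont
    have hev := (hcont.eventually (isOpen_interior.mem_nhds hint)).filter_mono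
      (nhdsWithin_le_nhds (s := Set.Ioi 0))
    obtain ⟨ε, hε, hpos⟩ := (hev.and self_mem_nhdsWithin).exists
    have := le_cross_of_mem_polygonRegion h (interior_subset hε)
    rw [map_sub, map_smul, hmc, smul_eq_mul] at this
    have hpos' : 0 < ε := hpos
    nlinarith
  rw [hφ.frontier_eq] at hfr
  obtain ⟨k, hk⟩ := Set.mem_iUnion.1 hfr
  obtain ⟨κ, hκ⟩ := hφ.exists_side k
  have hnn : ∀ l, 0 ≤ κ * cross (φ (k + 1) - φ k) (φ l - φ k) := by
    intro l
    by_cases h1 : l = k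
    · simp [h1]
    by_cases h2 : l = k + 1
    · simp [h2, cross_self]
    exact (hκ l h1 h2).le
  have hz : cross (φ (k + 1) - φ k) (m - φ k) = 0 := by
    obtain ⟨s, t, -, -, hst, hm'⟩ := hk
    have : m - φ k = t • (φ (k + 1) - φ k) := by
      rw [← hm', show s = 1 - t by linarith, sub_smul, one_smul, smul_sub]
      abel
    rw [this, map_smul, cross_self, smul_zero]
  have hsum := hmid (φ (k + 1) - φ k) (φ k)
  rw [hz] at hsum
  have hsum' : κ * cross (φ (k + 1) - φ k) (φ i - φ k) +
      κ * cross (φ (k + 1) - φ k) (φ j - φ k) = 0 := by linear_combination (-2 * κ) * hsum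
  refine ⟨k, ?_, ?_⟩
  · by_contra! hcon
    have := hκ i hcon.1 hcon.2
    have := hnn j
    linarith
  · by_contra! hcon
    have := hκ j hcon.1 hcon.2
    have := hnn i
    linarith

/-- A corner that is not lowest has a strictly lower adjacent corner. -/
lemma IsConvexPolygon.exists_lower (hφ : IsConvexPolygon φ) (d : Plane) {i j : ZMod n}
    (hj : cross d (φ j) < cross d (φ i)) :
    cross d (φ (i - 1)) < cross d (φ i) ∨ cross d (φ (i + 1)) < cross d (φ i) := by
  by_contra! hcon
  have h1 := zmod_one_ne_zero hφ.three_le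
  have h2 := zmod_two_ne_zero hφ.three_le
  have e1 : i + 1 ≠ i - 1 := fun h => h2 (by linear_combination h)
  have e2 : i - 1 ≠ i := fun h => h1 (by linear_combination -h)
  have e3 : i + 1 ≠ i := fun h => h1 (by linear_combination h)
  obtain ⟨κ, hκ⟩ := hφ.exists_side i
  obtain ⟨κ', hκ'⟩ := hφ.exists_side (i - 1)
  simp only [sub_add_cancel] at hκ'
  have hji : j ≠ i := by rintro rfl; exact lt_irrefl _ hj
  set a := φ (i - 1) - φ i with ha
  set c := φ (i + 1) - φ i with hc
  set x := φ j - φ i with hx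
  have hca : 0 < κ * cross c a := hκ _ e2 e1.symm
  have hcx : 0 ≤ κ * cross c x := by
    by_cases h : j = i + 1
    · rw [hx, h, ← hc, cross_self, mul_zero]
    · exact (hκ j hji h).le
  have hshift : ∀ y, cross (φ i - φ (i - 1)) (y - φ (i - 1)) = - cross a (y - φ i) := by
    intro y
    rw [ha]
    simp only [cross_apply, PiLp.sub_apply]
    ring
  have hac : 0 < κ' * - cross a c := by
    have := hκ' _ e1 e3
    rwa [hshift] at this
  have hax : 0 ≤ κ' * - cross a x := by
    by_cases h : j = i - 1
    · rw [hx, h, ← ha, cross_self, neg_zero, mul_zero]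
    · have := hκ' j h hji
      rw [hshift] at this
      exact this.le
  have hda : 0 ≤ cross d a := by rw [ha, map_sub]; linarith [hcon.1]
  have hdc : 0 ≤ cross d c := by rw [hc, map_sub]; linarith [hcon.2]
  have hdx : cross d x < 0 := by rw [hx, map_sub]; linarith
  have key : cross c a * cross d x = cross c x * cross d a + (- cross a x) * cross d c := by
    simp only [cross_apply]; ring
  have hanti : cross c a = - cross a c := cross_comm c a
  rcases lt_trichotomy (cross c a) 0 with h | h | h
  · have hκn : κ < 0 := by nlinarith
    have hκn' : κ' < 0 := by nlinarith
    have p1 : cross c x ≤ 0 := by nlinarith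
    have p2 : - cross a x ≤ 0 := by nlinarith
    nlinarith [mul_pos_of_neg_of_neg h hdx, mul_nonneg_of_nonpos_of_nonpos p1 (neg_nonpos.2 hda),
      mul_nonneg_of_nonpos_of_nonpos p2 (neg_nonpos.2 hdc)]
  · rw [h, mul_zero] at hca
    exact lt_irrefl _ hca
  · have hκn : 0 < κ := by nlinarith
    have hκn' : 0 < κ' := by nlinarith
    have p1 : 0 ≤ cross c x := by nlinarith
    have p2 : 0 ≤ - cross a x := by nlinarith
    nlinarith [mul_neg_of_pos_of_neg h hdx, mul_nonneg p1 hda, mul_nonneg p2 hdc]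

/-- Every corner is the unique lowest one for some linear functional. -/
lemma IsConvexPolygon.exists_strict_min (hφ : IsConvexPolygon φ) (i : ZMod n) :
    ∃ d, ∀ j, j ≠ i → cross d (φ i) < cross d (φ j) := by
  have h2 := zmod_two_ne_zero hφ.three_le
  obtain ⟨κ, hκ⟩ := hφ.exists_side i
  obtain ⟨κ', hκ'⟩ := hφ.exists_side (i - 1)
  simp only [sub_add_cancel] at hκ'
  refine ⟨κ • (φ (i + 1) - φ i) + κ' • (φ i - φ (i - 1)), fun j hj => ?_⟩
  rw [← sub_pos, ← map_sub, cross_linear_left]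
  have hshift : cross (φ i - φ (i - 1)) (φ j - φ i) =
      cross (φ i - φ (i - 1)) (φ j - φ (i - 1)) := by
    simp only [cross_apply, PiLp.sub_apply]
    ring
  rw [hshift]
  by_cases h1 : j = i + 1
  · have := hκ' j (fun h => h2 (by linear_combination h - h1)) hj
    rw [h1, cross_self, mul_zero, zero_add, ← h1]
    exact this
  · have p1 := hκ j hj h1
    by_cases h3 : j = i - 1
    · rw [h3, sub_self, map_zero, mul_zero, add_zero, ← h3]
      exact p1
    · linarith [hκ' j h3 hj]

end Polygon

/-! ### Straight-line maps without folds -/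

/-- The straight-line extension of `ψ` to the triangles of `K` is nondegenerate on each triangle,
and two triangles with a common edge lie on opposite sides of it. -/
structure IsUnfolded {V : Type*} [DecidableEq V] (K : AbstractSimplicialComplex V)
    (ψ : V → Plane) : Prop where
  nondegenerate : ∀ u v x, ({u, v, x} : Finset V) ∈ triangles K →
    cross (ψ v - ψ u) (ψ x - ψ u) ≠ 0
  opposite : ∀ u v x y, ({u, v, x} : Finset V) ∈ triangles K →
    ({u, v, y} : Finset V) ∈ triangles K → x ≠ y →
    cross (ψ v - ψ u) (ψ x - ψ u) * cross (ψ v - ψ u) (ψ y - ψ u) < 0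

/-- The map `ψ` takes the prescribed values at the boundary vertices, and for every linear
functional an interior vertex lies strictly between its neighbours or level with all of them. This
is what remains of the equation that places each interior vertex at a weighted mean of its
neighbours. -/
structure IsConvexCombinationMap {V : Type*} [DecidableEq V] {n : ℕ}
    (K : AbstractSimplicialComplex V) (b : ZMod n → V) (φ : ZMod n → Plane) (ψ : V → Plane) :
    Prop where
  boundary : ∀ i, ψ (b i) = φ i
  balanced : ∀ v, v ∉ Set.range b → ∀ d,
    (∀ u, (edgeGraph K).Adj v u → cross d (ψ u) = cross d (ψ v)) ∨
    ((∃ u, (edgeGraph K).Adj v u ∧ cross d (ψ u) < cross d (ψ v)) ∧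
      ∃ u, (edgeGraph K).Adj v u ∧ cross d (ψ v) < cross d (ψ u))

lemma cross_eq_zero_of_parallel {d x y : Plane} (hd : d ≠ 0) (hx : cross d x = 0)
    (hy : cross d y = 0) : cross x y = 0 := by
  have h := dot_self_mul_cross d x y
  rw [hx, hy, mul_zero, mul_zero, sub_zero] at h
  exact (mul_eq_zero.1 h).resolve_left (dot_self_pos hd).ne'

lemma ne_of_mem_triangles {V : Type*} [DecidableEq V] {K : AbstractSimplicialComplex V}
    {u v x : V} (h : ({u, v, x} : Finset V) ∈ triangles K) : u ≠ v ∧ u ≠ x ∧ v ≠ x := by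
  have h3 := h.2
  refine ⟨?_, ?_, ?_⟩
  · rintro rfl
    rw [Finset.insert_eq_of_mem (by simp)] at h3
    have := Finset.card_le_two (a := u) (b := x)
    omega
  · rintro rfl
    rw [Finset.pair_comm, Finset.insert_eq_of_mem (by simp)] at h3
    have := Finset.card_le_two (a := u) (b := v)
    omega
  · rintro rfl
    rw [Finset.pair_eq_singleton] at h3
    have := Finset.card_le_two (a := u) (b := v)
    omega

section Tutte

variable {V : Type*} [Fintype V] [DecidableEq V] {n : ℕ} {K : AbstractSimplicialComplex V}
  {b : ZMod n → V} {φ : ZMod n → Plane} {ψ : V → Plane}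

/-- Three points of the polygon's corner set are not collinear. -/
lemma IsConvexPolygon.not_level (hφ : IsConvexPolygon φ) {d : Plane} (hd : d ≠ 0) {c : ℝ}
    {i j k : ZMod n} (hij : i ≠ j) (hik : i ≠ k) (hjk : j ≠ k) (hi : cross d (φ i) = c)
    (hj : cross d (φ j) = c) (hk : cross d (φ k) = c) : False :=
  hφ.cross_ne_zero hij hik hjk (cross_eq_zero_of_parallel hd (by rw [map_sub, hi, hj, sub_self])
    (by rw [map_sub, hi, hk, sub_self]))

lemma isClosed_polygonRegion (hφ : IsConvexPolygon φ) : IsClosed (polygonRegion φ) := by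
  have : NeZero n := ⟨by have := hφ.three_le; omega⟩
  exact (Set.finite_range φ).isCompact_convexHull (𝕜 := ℝ).isClosed

lemma IsConvexCombinationMap.mem_polygonRegion (hD : IsDiskTriangulation K b)
    (hφ : IsConvexPolygon φ) (hψ : IsConvexCombinationMap K b φ ψ) (v : V) :
    ψ v ∈ polygonRegion φ := by
  by_contra hv
  obtain ⟨f, c, hfv, hf⟩ := geometric_hahn_banach_point_closed
    (convex_convexHull ℝ (Set.range φ)) (isClosed_polygonRegion hφ) hv
  obtain ⟨a, ha⟩ := exists_eq_cross (f : Plane →ₗ[ℝ] ℝ)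
  have hfa : ∀ x, f x = cross a x := fun x => by rw [← ha]; rfl
  obtain ⟨u, hu, hmax⟩ := exists_notMem_forall_le hD.connected (I := {v | v ∉ Set.range b})
    ⟨b 0, by simp⟩ (fun v => - cross a (ψ v)) (fun v hv ⟨u, hu, hlt⟩ => by
      rcases hψ.balanced v hv a with h | h
      · rw [h u hu] at hlt; exact absurd hlt (lt_irrefl _)
      · exact h.1.imp fun x hx => ⟨hx.1, neg_lt_neg hx.2⟩)
  have hu' : u ∈ Set.range b := not_not.1 hu
  obtain ⟨i, rfl⟩ := hu'
  have h1 := hmax v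
  have h2 := hf _ (PlanarTriangulation.mem_polygonRegion φ i)
  rw [hfa] at h2 hfv
  rw [hψ.boundary] at h1
  linarith

/-- Interior vertices lie strictly above every lower supporting line of the polygon. -/
lemma IsConvexCombinationMap.lt_of_notMem_range (hD : IsDiskTriangulation K b)
    (hφ : IsConvexPolygon φ) (hψ : IsConvexCombinationMap K b φ ψ) {d : Plane} (hd : d ≠ 0) {c : ℝ}
    (hc : ∀ i, c ≤ cross d (φ i)) {v : V} (hv : v ∉ Set.range b) : c < cross d (ψ v) := by
  classical
  have hle : ∀ v, c ≤ cross d (ψ v) := fun v =>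
    le_cross_of_mem_polygonRegion hc (hψ.mem_polygonRegion hD hφ v)
  refine lt_of_le_of_ne (hle v) fun hvc => ?_
  set C : Finset (Option V) :=
    (Finset.univ.filter fun v => v ∉ Set.range b ∧ cross d (ψ v) = c).image some with hC
  have memC : ∀ v, some v ∈ C ↔ v ∉ Set.range b ∧ cross d (ψ v) = c := by simp [hC]
  have hnone : none ∉ C := by simp [hC]
  have hout : ∀ x ∈ C, ∀ p, p ∉ C → TAdj (sphereTriangles K b) x p →
      ∃ i, p = some (b i) ∧ cross d (φ i) = c := by
    intro x hx p hp hxp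
    rcases x with _ | x
    · exact absurd hx hnone
    have hx' := (memC x).1 hx
    rcases p with _ | p
    · exact absurd (IsDiskTriangulation.tAdj_none_iff.1 hxp) hx'.1
    have hadj := hD.tAdj_some_iff.1 hxp
    have hpc : cross d (ψ p) = c := by
      rcases hψ.balanced x hx'.1 d with h | ⟨⟨y, -, hy⟩, -⟩
      · rw [h p hadj, hx'.2]
      · linarith [hle y, hx'.2]
    have hpb : p ∈ Set.range b := by
      by_contra hpb
      exact hp ((memC p).2 ⟨hpb, hpc⟩)
    obtain ⟨i, rfl⟩ := hpb
    exact ⟨i, rfl, by rw [← hψ.boundary, hpc]⟩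
  obtain ⟨p, q, r, x, x', y, hpC, hqC, hrC, hpq, hpr, hqr, hx, hx', hpqx, hprx, -⟩ :=
    exists_three_neighbours (hD.isTriangulatedSphere hφ.three_le) (C := C) (N := none)
      ⟨some v, (memC v).2 ⟨hv, hvc.symm⟩⟩ hnone (fun x hx h => by
        obtain ⟨i, hi, -⟩ := hout x hx none hnone h
        cases hi)
  have ne : ∀ {x c}, x ∉ C → c ∈ C → c ≠ x := fun hx hc h => hx (h ▸ hc)
  obtain ⟨i, rfl, hi⟩ := hout x hx p hpC ⟨ne hpC hx, _, hpqx, by simp, by simp⟩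
  obtain ⟨j, rfl, hj⟩ := hout x hx q hqC ⟨ne hqC hx, _, hpqx, by simp, by simp⟩
  obtain ⟨k, rfl, hk⟩ := hout x' hx' r hrC ⟨ne hrC hx', _, hprx, by simp, by simp⟩
  exact hφ.not_level hd (fun h => hpq (by rw [h])) (fun h => hpr (by rw [h]))
    (fun h => hqr (by rw [h])) hi hj hk

lemma IsDiskTriangulation.adj_succ (hD : IsDiskTriangulation K b) (hn : 3 ≤ n) (i : ZMod n) :
    (edgeGraph K).Adj (b i) (b (i + 1)) :=
  (mem_edges_iff_adj (hD.boundary_ne hn i)).1 (hD.adj_boundary i).1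

/-- A linear functional gives an admissible height function on the sphere: the cone vertex is put
above everything, and one lowest boundary vertex is pushed down to break a possible tie with the
only other boundary vertex at its level. -/
lemma IsConvexCombinationMap.exists_isAdmissible (hD : IsDiskTriangulation K b)
    (hφ : IsConvexPolygon φ) (hψ : IsConvexCombinationMap K b φ ψ) {d : Plane} (hd : d ≠ 0) :
    ∃ (i₀ : ZMod n) (h : Option V → ℝ), (∀ i, cross d (φ i₀) ≤ cross d (φ i)) ∧
      IsAdmissible (sphereTriangles K b) none (some (b i₀)) h ∧
      ∀ v, v ≠ b i₀ → h (some v) = cross d (ψ v) := by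
  have hn := hφ.three_le
  have : NeZero n := ⟨by omega⟩
  obtain ⟨i₀, hi₀⟩ := Finite.exists_min fun i => cross d (φ i)
  have : Nonempty V := ⟨b 0⟩
  obtain ⟨m, hm⟩ := Finite.exists_max fun v => cross d (ψ v)
  have hint : ∀ v, v ∉ Set.range b → cross d (φ i₀) < cross d (ψ v) := fun v hv =>
    hψ.lt_of_notMem_range hD hφ hd hi₀ hv
  set h : Option V → ℝ := fun x =>
    x.elim (cross d (ψ m) + 1) fun v => cross d (ψ v) - if v = b i₀ then 1 else 0 with hh
  have hval : ∀ v, v ≠ b i₀ → h (some v) = cross d (ψ v) := by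
    intro v hv; simp [hh, hv]
  have hval₀ : h (some (b i₀)) = cross d (φ i₀) - 1 := by simp [hh, hψ.boundary]
  have hle : ∀ v, h (some v) ≤ cross d (ψ v) := by
    intro v
    by_cases hv : v = b i₀
    · rw [hv, hval₀, hψ.boundary]; linarith
    · rw [hval v hv]
  have htop : ∀ v, h (some v) < h none := by
    intro v
    have : h none = cross d (ψ m) + 1 := rfl
    linarith [hle v, hm v]
  refine ⟨i₀, h, hi₀, ⟨by simp, fun u hu => ?_, fun x hxN hxS => ?_⟩, hval⟩
  · obtain ⟨u, rfl⟩ := Option.ne_none_iff_exists'.1 hu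
    exact htop u
  · obtain ⟨v, rfl⟩ := Option.ne_none_iff_exists'.1 hxN
    have hv₀ : v ≠ b i₀ := fun e => hxS (by rw [e])
    by_cases hv : v ∈ Set.range b
    · obtain ⟨j, rfl⟩ := hv
      refine Or.inr ⟨?_, none, IsDiskTriangulation.tAdj_none_iff.2 ⟨j, rfl⟩, htop _⟩
      rw [hval _ hv₀, hψ.boundary]
      have hji : j ≠ i₀ := fun e => hv₀ (by rw [e])
      have hnext : ∀ k, TAdj (sphereTriangles K b) (some (b k)) (some (b (k + 1))) := fun k =>
        hD.tAdj_some_iff.2 (hD.adj_succ hn k)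
      rcases (hi₀ j).lt_or_eq with hlt | heq
      · rcases hφ.exists_lower d hlt with h1 | h1
        · refine ⟨some (b (j - 1)), ?_, lt_of_le_of_lt (hle _) (by rwa [hψ.boundary])⟩
          have := hnext (j - 1)
          rw [sub_add_cancel] at this
          exact this.symm
        · exact ⟨some (b (j + 1)), hnext j, lt_of_le_of_lt (hle _) (by rwa [hψ.boundary])⟩
      · refine ⟨some (b i₀), ?_, by rw [hval₀]; linarith⟩
        obtain ⟨k, hk1, hk2⟩ := hφ.consecutive hd hi₀ rfl heq.symm
        rcases hk1 with rfl | rfl <;> rcases hk2 with rfl | rfl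
        · exact absurd rfl hji
        · exact (hnext _).symm
        · exact hnext _
        · exact absurd rfl hji
    · have hvi := hint v hv
      have hnb : ∀ x, TAdj (sphereTriangles K b) (some v) x →
          ∃ u, x = some u ∧ (edgeGraph K).Adj v u := by
        intro x hx
        rcases x with _ | u
        · exact absurd (IsDiskTriangulation.tAdj_none_iff.1 hx) hv
        · exact ⟨u, rfl, hD.tAdj_some_iff.1 hx⟩
      rcases hψ.balanced v hv d with hf | ⟨⟨x, hx, hxv⟩, y, hy, hyv⟩
      · left
        intro x hx
        obtain ⟨u, rfl, hu⟩ := hnb x hx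
        have hu₀ : u ≠ b i₀ := by
          rintro rfl
          have := hf _ hu
          rw [hψ.boundary] at this
          linarith
        rw [hval _ hu₀, hval _ hv₀, hf u hu]
      · right
        rw [IsRegularAt, hval _ hv₀]
        refine ⟨⟨some x, hD.tAdj_some_iff.2 hx, lt_of_le_of_lt (hle x) hxv⟩,
          some y, hD.tAdj_some_iff.2 hy, ?_⟩
        have hy₀ : y ≠ b i₀ := by
          rintro rfl
          rw [hψ.boundary] at hyv
          linarith
        rwa [hval _ hy₀]

/-- Tutte's theorem, local form: a convex combination map with strictly convex boundary has no
degenerate triangles and no folds. -/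
theorem IsConvexCombinationMap.isUnfolded (hD : IsDiskTriangulation K b)
    (hφ : IsConvexPolygon φ) (hψ : IsConvexCombinationMap K b φ ψ) : IsUnfolded K ψ := by
  have hn := hφ.three_le
  have hT := hD.isTriangulatedSphere hn
  have hbd : ∀ d i₀, d ≠ 0 → (∀ i, cross d (φ i₀) ≤ cross d (φ i)) → ∀ v,
      cross d (ψ v) = cross d (φ i₀) → ∃ i, v = b i ∧ cross d (φ i) = cross d (φ i₀) := by
    intro d i₀ hd hi₀ v hv
    by_cases hvb : v ∈ Set.range b
    · obtain ⟨i, rfl⟩ := hvb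
      exact ⟨i, rfl, by rw [← hψ.boundary, hv]⟩
    · exact absurd hv (hψ.lt_of_notMem_range hD hφ hd hi₀ hvb).ne'
  have hnd : ∀ u v x, ({u, v, x} : Finset V) ∈ triangles K →
      cross (ψ v - ψ u) (ψ x - ψ u) ≠ 0 := by
    intro u v x ht h0
    obtain ⟨huv, hux, hvx⟩ := ne_of_mem_triangles ht
    obtain ⟨d, hd, hv, hx⟩ : ∃ d : Plane, d ≠ 0 ∧ cross d (ψ v) = cross d (ψ u) ∧
        cross d (ψ x) = cross d (ψ u) := by
      simp only [← sub_eq_zero (b := cross _ (ψ u)), ← map_sub]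
      by_cases h1 : ψ v - ψ u = 0
      · by_cases h2 : ψ x - ψ u = 0
        · refine ⟨!₂[1, 0], fun h => ?_, by rw [h1, map_zero], by rw [h2, map_zero]⟩
          have := congrArg (fun y : Plane => y 0) h
          simp at this
        · exact ⟨_, h2, by rw [h1, map_zero], cross_self _⟩
      · exact ⟨_, h1, cross_self _, h0⟩
    obtain ⟨i₀, h, hi₀, hadm, hval⟩ := hψ.exists_isAdmissible hD hφ hd
    by_cases hmin : cross d (ψ u) = cross d (φ i₀)
    · obtain ⟨i, rfl, hi⟩ := hbd d i₀ hd hi₀ u hmin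
      obtain ⟨j, rfl, hj⟩ := hbd d i₀ hd hi₀ v (hv.trans hmin)
      obtain ⟨k, rfl, hk⟩ := hbd d i₀ hd hi₀ x (hx.trans hmin)
      exact hφ.not_level hd (fun h => huv (by rw [h])) (fun h => hux (by rw [h]))
        (fun h => hvx (by rw [h])) hi hj hk
    · have hne : ∀ w, cross d (ψ w) = cross d (ψ u) → w ≠ b i₀ := by
        rintro w hw rfl
        rw [hψ.boundary] at hw
        exact hmin hw.symm
      refine hadm.not_const_on_triangle hT (triple_mem_sphereTriangles ht) (by simpa using huv)
        (by simpa using hux) (by simpa using hvx) (by simp) (by simpa using hne u rfl) ?_ ?_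
      · rw [hval _ (hne v hv), hval _ (hne u rfl), hv]
      · rw [hval _ (hne x hx), hval _ (hne u rfl), hx]
  refine ⟨hnd, fun u v x y hx hy hxy => ?_⟩
  by_contra! hge
  have hx0 := hnd u v x hx
  have hy0 := hnd u v y hy
  obtain ⟨huv, hux, hvx⟩ := ne_of_mem_triangles hx
  obtain ⟨d, hd, hv, hxd, hyd⟩ : ∃ d : Plane, d ≠ 0 ∧ cross d (ψ v) = cross d (ψ u) ∧
      cross d (ψ u) < cross d (ψ x) ∧ cross d (ψ u) < cross d (ψ y) := by
    simp only [← sub_eq_zero (b := cross _ (ψ u)), ← sub_pos (b := cross _ (ψ u)), ← map_sub]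
    have hne : ψ v - ψ u ≠ 0 := by
      intro h
      rw [h, cross_apply] at hx0
      simp at hx0
    rcases lt_or_gt_of_ne hx0 with h | h
    · refine ⟨-(ψ v - ψ u), neg_ne_zero.2 hne, ?_, ?_, ?_⟩
      · rw [cross_neg_left, cross_self, neg_zero]
      · rw [cross_neg_left]; linarith
      · rw [cross_neg_left]
        have : cross (ψ v - ψ u) (ψ y - ψ u) < 0 := lt_of_le_of_ne (by nlinarith) hy0
        linarith
    · exact ⟨_, hne, cross_self _, h, lt_of_le_of_ne (by nlinarith) hy0.symm⟩
  obtain ⟨i₀, h, hi₀, hadm, hval⟩ := hψ.exists_isAdmissible hD hφ hd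
  have hle : ∀ v, cross d (φ i₀) ≤ cross d (ψ v) := fun v =>
    le_cross_of_mem_polygonRegion hi₀ (hψ.mem_polygonRegion hD hφ v)
  by_cases hmin : cross d (ψ u) = cross d (φ i₀)
  · -- The common edge would be a boundary edge, which lies in one triangle only.
    obtain ⟨i, rfl, hi⟩ := hbd d i₀ hd hi₀ u hmin
    obtain ⟨j, rfl, hj⟩ := hbd d i₀ hd hi₀ v (hv.trans hmin)
    obtain ⟨k, hk1, hk2⟩ := hφ.consecutive hd hi₀ hi hj
    have he : ({b i, b j} : Finset V) = {b k, b (k + 1)} := by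
      rcases hk1 with rfl | rfl <;> rcases hk2 with rfl | rfl
      · exact absurd rfl huv
      · rfl
      · exact Finset.pair_comm _ _
      · exact absurd rfl huv
    obtain ⟨s, hs⟩ := Set.ncard_eq_one.1 (hD.adj_boundary k).2
    have h1 : ({b i, b j, x} : Finset V) ∈ trianglesContaining K {b k, b (k + 1)} :=
      ⟨hx, by rw [← he]; intro z; simp; tauto⟩
    have h2 : ({b i, b j, y} : Finset V) ∈ trianglesContaining K {b k, b (k + 1)} :=
      ⟨hy, by rw [← he]; intro z; simp; tauto⟩
    rw [hs, Set.mem_singleton_iff] at h1 h2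
    have hxm : x ∈ ({b i, b j, y} : Finset V) := by rw [h2, ← h1]; simp
    simp only [Finset.mem_insert, Finset.mem_singleton] at hxm
    rcases hxm with h | h | h
    exacts [hux h.symm, hvx h.symm, hxy h]
  · have hne : ∀ w, cross d (ψ u) ≤ cross d (ψ w) → w ≠ b i₀ := by
      rintro w hw rfl
      rw [hψ.boundary] at hw
      exact hmin (le_antisymm hw (hle u))
    refine hadm.not_fold hT (triple_mem_sphereTriangles hx) (triple_mem_sphereTriangles hy)
      (by simpa using huv) (by simpa using hxy) (by simp) (by simpa using hne u le_rfl) ?_ ?_ ?_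
    · rw [hval _ (hne v hv.ge), hval _ (hne u le_rfl), hv]
    · rwa [hval _ (hne x hxd.le), hval _ (hne u le_rfl)]
    · rwa [hval _ (hne y hyd.le), hval _ (hne u le_rfl)]

end Tutte

/-! ### Slicing an unfolded map by a line -/

section Disk

variable {V : Type*} [Fintype V] [DecidableEq V] {n : ℕ} {K : AbstractSimplicialComplex V}
  {b : ZMod n → V} {φ : ZMod n → Plane} {ψ : V → Plane}

lemma exists_third_vertex {t : Finset V} (ht : t ∈ triangles K) {u v : V} (hu : u ∈ t)
    (hv : v ∈ t) (huv : u ≠ v) : ∃ x, t = {u, v, x} := by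
  obtain ⟨a, c, hua, huc, hac, rfl⟩ := exists_eq_insert_pair ht.2 hu
  simp only [Finset.mem_insert, Finset.mem_singleton] at hv
  rcases hv with rfl | rfl | rfl
  · exact absurd rfl huv
  · exact ⟨c, rfl⟩
  · exact ⟨a, by rw [Finset.pair_comm]⟩

lemma IsDiskTriangulation.exists_triangle (hD : IsDiskTriangulation K b) {u v : V}
    (huv : (edgeGraph K).Adj u v) : ∃ x, ({u, v, x} : Finset V) ∈ triangles K := by
  obtain ⟨t, ht, hs⟩ := hD.pure _ huv.2
  obtain ⟨x, rfl⟩ := exists_third_vertex ht (hs (by simp)) (hs (by simp)) huv.1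
  exact ⟨x, ht⟩

lemma IsDiskTriangulation.exists_two_triangles (hD : IsDiskTriangulation K b) {u v : V}
    (huv : (edgeGraph K).Adj u v) (hbd : ∀ i, ({u, v} : Finset V) ≠ {b i, b (i + 1)}) :
    ∃ x y, x ≠ y ∧ ({u, v, x} : Finset V) ∈ triangles K ∧ ({u, v, y} : Finset V) ∈ triangles K := by
  obtain ⟨s₁, s₂, hne, hs⟩ :=
    Set.ncard_eq_two.1 (hD.ncard_eq_two ((mem_edges_iff_adj huv.1).2 huv) hbd)
  have h₁ : s₁ ∈ trianglesContaining K {u, v} := by rw [hs]; simp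
  have h₂ : s₂ ∈ trianglesContaining K {u, v} := by rw [hs]; simp
  obtain ⟨x, rfl⟩ := exists_third_vertex h₁.1 (h₁.2 (by simp)) (h₁.2 (by simp)) huv.1
  obtain ⟨y, rfl⟩ := exists_third_vertex h₂.1 (h₂.2 (by simp)) (h₂.2 (by simp)) huv.1
  exact ⟨x, y, fun h => hne (by rw [h]), h₁.1, h₂.1⟩

lemma IsUnfolded.exists_left_right (hU : IsUnfolded K ψ) (hD : IsDiskTriangulation K b) {u v : V}
    (huv : (edgeGraph K).Adj u v) (hbd : ∀ i, ({u, v} : Finset V) ≠ {b i, b (i + 1)}) :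
    (∃ x, ({u, v, x} : Finset V) ∈ triangles K ∧ 0 < cross (ψ v - ψ u) (ψ x - ψ u)) ∧
    ∃ x, ({u, v, x} : Finset V) ∈ triangles K ∧ cross (ψ v - ψ u) (ψ x - ψ u) < 0 := by
  obtain ⟨x, y, hxy, hx, hy⟩ := hD.exists_two_triangles huv hbd
  rcases mul_neg_iff.1 (hU.opposite u v x y hx hy hxy) with h | h
  · exact ⟨⟨x, hx, h.1⟩, y, hy, h.2⟩
  · exact ⟨⟨y, hy, h.2⟩, x, hx, h.1⟩

/-- The triangles at an interior vertex of an unfolded map surround it. -/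
lemma IsUnfolded.surrounding (hU : IsUnfolded K ψ) (hD : IsDiskTriangulation K b) {v : V}
    (hv : v ∉ Set.range b) {N : Finset V} (hN : ∀ u, u ∈ N ↔ (edgeGraph K).Adj v u) :
    N.Nonempty ∧ (∀ u ∈ N, ∃ w ∈ N, 0 < cross (ψ u - ψ v) (ψ w - ψ v)) ∧
      ∀ u ∈ N, ∃ w ∈ N, ({v, u, w} : Finset V) ∈ triangles K ∧
        cross (ψ u - ψ v) (ψ w - ψ v) < 0 := by
  have hbd : ∀ u i, ({v, u} : Finset V) ≠ {b i, b (i + 1)} := by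
    intro u i h
    have : v ∈ ({b i, b (i + 1)} : Finset V) := h ▸ by simp
    simp only [Finset.mem_insert, Finset.mem_singleton] at this
    rcases this with rfl | rfl
    exacts [hv ⟨i, rfl⟩, hv ⟨i + 1, rfl⟩]
  have hadj : ∀ u w, ({v, u, w} : Finset V) ∈ triangles K → w ∈ N := fun u w h =>
    (hN w).2 (adj_of_mem_triangle h (by simp) (by simp) (ne_of_mem_triangles h).2.1)
  refine ⟨?_, fun u hu => ?_, fun u hu => ?_⟩
  · obtain ⟨u⟩ := (hD.link_connected v).nonempty
    exact ⟨u.1, (hN _).2 u.2⟩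
  · obtain ⟨⟨w, hw, h⟩, -⟩ := hU.exists_left_right hD ((hN u).1 hu) (hbd u)
    exact ⟨w, hadj u w hw, h⟩
  · obtain ⟨-, w, hw, h⟩ := hU.exists_left_right hD ((hN u).1 hu) (hbd u)
    exact ⟨w, hadj u w hw, hw, h⟩

/-- The edges crossing the line `cross d = c`, oriented upwards. -/
def CrossingEdge (K : AbstractSimplicialComplex V) (ψ : V → Plane) (d : Plane) (c : ℝ) : Type _ :=
  {e : V × V // (edgeGraph K).Adj e.1 e.2 ∧ cross d (ψ e.1) < c ∧ c < cross d (ψ e.2)}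

namespace CrossingEdge

variable {d : Plane} {c : ℝ}

/-- The lower endpoint of a crossing edge. -/
def lo (e : CrossingEdge K ψ d c) : V := e.1.1

/-- The upper endpoint of a crossing edge. -/
def hi (e : CrossingEdge K ψ d c) : V := e.1.2

lemma adj (e : CrossingEdge K ψ d c) : (edgeGraph K).Adj e.lo e.hi := e.2.1

lemma lo_lt (e : CrossingEdge K ψ d c) : cross d (ψ e.lo) < c := e.2.2.1

lemma lt_hi (e : CrossingEdge K ψ d c) : c < cross d (ψ e.hi) := e.2.2.2

lemma ext {e e' : CrossingEdge K ψ d c} (h1 : e.lo = e'.lo) (h2 : e.hi = e'.hi) : e = e' :=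
  Subtype.ext (Prod.ext h1 h2)

/-- The position of the crossing point on the edge. -/
noncomputable def time (e : CrossingEdge K ψ d c) : ℝ :=
  (c - cross d (ψ e.lo)) / (cross d (ψ e.hi) - cross d (ψ e.lo))

/-- The point at which the edge meets the line. -/
noncomputable def point (e : CrossingEdge K ψ d c) : Plane :=
  ψ e.lo + e.time • (ψ e.hi - ψ e.lo)

/-- The coordinate along the line, increasing to the left of upward edges, of the crossing point. -/
noncomputable def pos (e : CrossingEdge K ψ d c) : ℝ := - dot d e.point

lemma time_pos (e : CrossingEdge K ψ d c) : 0 < e.time :=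
  div_pos (by linarith [e.lo_lt]) (by linarith [e.lo_lt, e.lt_hi])

lemma time_lt_one (e : CrossingEdge K ψ d c) : e.time < 1 := by
  rw [time, div_lt_one (by linarith [e.lo_lt, e.lt_hi])]
  linarith [e.lt_hi]

lemma cross_point (e : CrossingEdge K ψ d c) : cross d e.point = c := by
  have : cross d (ψ e.hi) - cross d (ψ e.lo) ≠ 0 := by linarith [e.lo_lt, e.lt_hi]
  rw [point, map_add, map_smul, map_sub, smul_eq_mul, time, div_mul_cancel₀ _ this]
  ring

lemma point_mem_segment (e : CrossingEdge K ψ d c) :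
    e.point ∈ segment ℝ (ψ e.lo) (ψ e.hi) := by
  refine ⟨1 - e.time, e.time, by linarith [e.time_lt_one], e.time_pos.le, by ring, ?_⟩
  rw [point, smul_sub, sub_smul, one_smul]
  abel

lemma cross_point_sub (e : CrossingEdge K ψ d c) :
    cross (ψ e.hi - ψ e.lo) (e.point - ψ e.lo) = 0 := by
  rw [point, add_sub_cancel_left, map_smul, cross_self, smul_zero]

/-- For points of the line, being to the left of a crossing edge is measured by `pos`. -/
lemma exists_cross_eq (e : CrossingEdge K ψ d c) (hd : d ≠ 0) :
    ∃ k : ℝ, 0 < k ∧ ∀ z, cross d z = c →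
      cross (ψ e.hi - ψ e.lo) (z - ψ e.lo) = k * (- dot d z - e.pos) := by
  have hdd := dot_self_pos hd
  refine ⟨(cross d (ψ e.hi) - cross d (ψ e.lo)) / dot d d,
    div_pos (by linarith [e.lo_lt, e.lt_hi]) hdd, fun z hz => ?_⟩
  have h1 := dot_self_mul_cross d (ψ e.hi - ψ e.lo) (z - e.point)
  have h2 : cross d (z - e.point) = 0 := by rw [map_sub, hz, e.cross_point, sub_self]
  have h3 : cross (ψ e.hi - ψ e.lo) (z - ψ e.lo) = cross (ψ e.hi - ψ e.lo) (z - e.point) := by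
    have := e.cross_point_sub
    rw [map_sub] at this
    rw [map_sub, map_sub]
    linarith
  have h4 : dot d (z - e.point) = dot d z + e.pos := by
    simp only [pos, dot, PiLp.sub_apply]; ring
  rw [h2, h4, map_sub (cross d)] at h1
  rw [h3, div_mul_eq_mul_div, eq_div_iff hdd.ne']
  linarith

lemma point_eq_of_pos_eq {e e' : CrossingEdge K ψ d c} (hd : d ≠ 0) (h : e.pos = e'.pos) :
    e.point = e'.point := by
  have h1 : cross d (e.point - e'.point) = 0 := by
    rw [map_sub, e.cross_point, e'.cross_point, sub_self]
  obtain ⟨s, hs⟩ := eq_smul_of_cross_eq_zero hd h1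
  have h2 : dot d (e.point - e'.point) = 0 := by
    simp only [pos, dot] at h
    simp only [dot, PiLp.sub_apply]
    linarith
  have h3 : s * dot d d = 0 := by
    rw [← h2, hs]
    simp only [dot, PiLp.smul_apply, smul_eq_mul]
    ring
  rcases mul_eq_zero.1 h3 with h4 | h4
  · rw [h4, zero_smul] at hs
    exact sub_eq_zero.1 hs
  · exact absurd h4 (dot_self_pos hd).ne'

/-- In a triangle with two crossing edges, the crossing point of the second one lies on the same
side of the first one as the third vertex. -/
lemma exists_cross_point_eq {e e' : CrossingEdge K ψ d c} {x : V}
    (h1 : e'.lo ∈ ({e.lo, e.hi, x} : Finset V)) (h2 : e'.hi ∈ ({e.lo, e.hi, x} : Finset V))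
    (hne : e' ≠ e) : ∃ s : ℝ, 0 < s ∧ cross (ψ e.hi - ψ e.lo) (e'.point - ψ e.lo) =
      s * cross (ψ e.hi - ψ e.lo) (ψ x - ψ e.lo) := by
  simp only [Finset.mem_insert, Finset.mem_singleton] at h1 h2
  have ha := e.lo_lt
  have hb := e.lt_hi
  have ha' := e'.lo_lt
  have hb' := e'.lt_hi
  rcases h1 with h1 | h1 | h1
  · rcases h2 with h2 | h2 | h2
    · rw [h2] at hb'; linarith
    · exact absurd (CrossingEdge.ext h1 h2) hne
    · refine ⟨e'.time, e'.time_pos, ?_⟩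
      rw [point, h1, h2, add_sub_cancel_left, map_smul, smul_eq_mul]
  · rw [h1] at ha'; linarith
  · rcases h2 with h2 | h2 | h2
    · rw [h2] at hb'; linarith
    · refine ⟨1 - e'.time, by linarith [e'.time_lt_one], ?_⟩
      have : e'.point - ψ e.lo = (1 - e'.time) • (ψ x - ψ e.lo) +
          e'.time • (ψ e.hi - ψ e.lo) := by
        rw [point, h1, h2]
        apply plane_ext <;> simp <;> ring
      rw [this, map_add, map_smul, map_smul, cross_self, smul_zero, add_zero, smul_eq_mul]
    · rw [h1] at ha'; rw [h2] at hb'; linarith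

lemma cross_pos_iff {e e' : CrossingEdge K ψ d c} (hd : d ≠ 0) {x : V}
    (h1 : e'.lo ∈ ({e.lo, e.hi, x} : Finset V)) (h2 : e'.hi ∈ ({e.lo, e.hi, x} : Finset V))
    (hne : e' ≠ e) : 0 < cross (ψ e.hi - ψ e.lo) (ψ x - ψ e.lo) ↔ e.pos < e'.pos := by
  obtain ⟨s, hs, h3⟩ := exists_cross_point_eq h1 h2 hne
  obtain ⟨k, hk, h4⟩ := e.exists_cross_eq hd
  have h5 := h4 _ e'.cross_point
  rw [h3] at h5
  rw [← mul_pos_iff_of_pos_left hs, h5, mul_pos_iff_of_pos_left hk, sub_pos]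
  rfl

lemma exists_other (hc : ∀ v, cross d (ψ v) ≠ c) (e : CrossingEdge K ψ d c) {x : V}
    (ht : ({e.lo, e.hi, x} : Finset V) ∈ triangles K) : ∃ e' : CrossingEdge K ψ d c,
      e'.lo ∈ ({e.lo, e.hi, x} : Finset V) ∧ e'.hi ∈ ({e.lo, e.hi, x} : Finset V) ∧ e' ≠ e := by
  obtain ⟨-, hx1, hx2⟩ := ne_of_mem_triangles ht
  rcases lt_or_gt_of_ne (hc x) with h | h
  · refine ⟨⟨(x, e.hi), adj_of_mem_triangle ht (by simp) (by simp) hx2.symm, h, e.lt_hi⟩,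
      by simp [lo], by simp [hi], fun h => hx1 ?_⟩
    rw [← h]; rfl
  · refine ⟨⟨(e.lo, x), adj_of_mem_triangle ht (by simp) (by simp) hx1, e.lo_lt, h⟩,
      by simp [lo], by simp [hi], fun h => hx2 ?_⟩
    rw [← h]; rfl

lemma other_unique {e e' e'' : CrossingEdge K ψ d c} {x : V}
    (h1 : e'.lo ∈ ({e.lo, e.hi, x} : Finset V)) (h2 : e'.hi ∈ ({e.lo, e.hi, x} : Finset V))
    (hne : e' ≠ e) (h3 : e''.lo ∈ ({e.lo, e.hi, x} : Finset V))
    (h4 : e''.hi ∈ ({e.lo, e.hi, x} : Finset V)) (hne' : e'' ≠ e) : e' = e'' := by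
  have hlo : ∀ f : CrossingEdge K ψ d c, f.lo ∈ ({e.lo, e.hi, x} : Finset V) →
      f.hi ∈ ({e.lo, e.hi, x} : Finset V) → f ≠ e →
      (f.lo = e.lo ∧ f.hi = x) ∨ (f.lo = x ∧ f.hi = e.hi) := by
    intro f hf1 hf2 hf
    simp only [Finset.mem_insert, Finset.mem_singleton] at hf1 hf2
    have ha := e.lo_lt
    have hb := e.lt_hi
    have ha' := f.lo_lt
    have hb' := f.lt_hi
    rcases hf1 with hf1 | hf1 | hf1
    · rcases hf2 with hf2 | hf2 | hf2
      · rw [hf2] at hb'; linarith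
      · exact absurd (CrossingEdge.ext hf1 hf2) hf
      · exact Or.inl ⟨hf1, hf2⟩
    · rw [hf1] at ha'; linarith
    · rcases hf2 with hf2 | hf2 | hf2
      · rw [hf2] at hb'; linarith
      · exact Or.inr ⟨hf1, hf2⟩
      · rw [hf1] at ha'; rw [hf2] at hb'; linarith
  have ha' := e'.lo_lt
  have hb' := e'.lt_hi
  have ha'' := e''.lo_lt
  have hb'' := e''.lt_hi
  rcases hlo e' h1 h2 hne with ⟨p1, p2⟩ | ⟨p1, p2⟩ <;>
    rcases hlo e'' h3 h4 hne' with ⟨q1, q2⟩ | ⟨q1, q2⟩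
  · exact CrossingEdge.ext (p1.trans q1.symm) (p2.trans q2.symm)
  · rw [p2] at hb'; rw [q1] at ha''; linarith
  · rw [p1] at ha'; rw [q2] at hb''; linarith
  · exact CrossingEdge.ext (p1.trans q1.symm) (p2.trans q2.symm)

/-- `e'` follows `e` along the line: they are the two crossing edges of a triangle. -/
def Next (e e' : CrossingEdge K ψ d c) : Prop :=
  ∃ t ∈ triangles K, e.lo ∈ t ∧ e.hi ∈ t ∧ e'.lo ∈ t ∧ e'.hi ∈ t ∧ e.pos < e'.pos

lemma Next.exists_triangle {e e' : CrossingEdge K ψ d c} (h : Next e e') :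
    ∃ x, ({e.lo, e.hi, x} : Finset V) ∈ triangles K ∧ e'.lo ∈ ({e.lo, e.hi, x} : Finset V) ∧
      e'.hi ∈ ({e.lo, e.hi, x} : Finset V) := by
  obtain ⟨t, ht, h1, h2, h3, h4, -⟩ := h
  obtain ⟨x, rfl⟩ := exists_third_vertex ht h1 h2 e.adj.1
  exact ⟨x, ht, h3, h4⟩

lemma Next.pos_lt {e e' : CrossingEdge K ψ d c} (h : Next e e') : e.pos < e'.pos := by
  obtain ⟨-, -, -, -, -, -, h⟩ := h
  exact h

lemma Next.rightUnique (hd : d ≠ 0) (hU : IsUnfolded K ψ) :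
    Relator.RightUnique (Next : CrossingEdge K ψ d c → CrossingEdge K ψ d c → Prop) := by
  intro e e' e'' h' h''
  obtain ⟨x, hx, h1, h2⟩ := h'.exists_triangle
  obtain ⟨y, hy, h3, h4⟩ := h''.exists_triangle
  have n1 : e' ≠ e := fun h => (h ▸ h'.pos_lt).ne rfl
  have n2 : e'' ≠ e := fun h => (h ▸ h''.pos_lt).ne rfl
  have hxy : x = y := by
    by_contra hxy
    have := hU.opposite _ _ _ _ hx hy hxy
    have := mul_pos ((cross_pos_iff hd h1 h2 n1).2 h'.pos_lt)
      ((cross_pos_iff hd h3 h4 n2).2 h''.pos_lt)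
    linarith
  subst hxy
  exact other_unique h1 h2 n1 h3 h4 n2

lemma Next.leftUnique (hd : d ≠ 0) (hU : IsUnfolded K ψ) :
    Relator.RightUnique (Function.swap
      (Next : CrossingEdge K ψ d c → CrossingEdge K ψ d c → Prop)) := by
  have hsw : ∀ {e e' : CrossingEdge K ψ d c}, Next e' e →
      ∃ x, ({e.lo, e.hi, x} : Finset V) ∈ triangles K ∧ e'.lo ∈ ({e.lo, e.hi, x} : Finset V) ∧
      e'.hi ∈ ({e.lo, e.hi, x} : Finset V) := by
    rintro e e' ⟨t, ht, h1, h2, h3, h4, -⟩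
    obtain ⟨x, rfl⟩ := exists_third_vertex ht h3 h4 e.adj.1
    exact ⟨x, ht, h1, h2⟩
  intro e e' e'' h' h''
  obtain ⟨x, hx, h1, h2⟩ := hsw h'
  obtain ⟨y, hy, h3, h4⟩ := hsw h''
  have n1 : e' ≠ e := fun h => (h ▸ Next.pos_lt h').ne rfl
  have n2 : e'' ≠ e := fun h => (h ▸ Next.pos_lt h'').ne rfl
  have hxy : x = y := by
    by_contra hxy
    have := hU.opposite _ _ _ _ hx hy hxy
    have g1 := mt (cross_pos_iff hd h1 h2 n1).1 (Next.pos_lt h').not_gt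
    have g2 := mt (cross_pos_iff hd h3 h4 n2).1 (Next.pos_lt h'').not_gt
    nlinarith
  subst hxy
  exact other_unique h1 h2 n1 h3 h4 n2

lemma eq_or_pos_lt {e e' : CrossingEdge K ψ d c} (h : Relation.ReflTransGen Next e e') :
    e = e' ∨ e.pos < e'.pos := by
  induction h with
  | refl => exact Or.inl rfl
  | tail _ h ih =>
    right
    rcases ih with rfl | ih
    · exact h.pos_lt
    · exact ih.trans h.pos_lt

end CrossingEdge

lemma IsConvexPolygon.side_nonneg (hφ : IsConvexPolygon φ) (k : ZMod n) :
    ∃ κ : ℝ, κ ≠ 0 ∧ (∀ j, j ≠ k → j ≠ k + 1 → 0 < κ * cross (φ (k + 1) - φ k) (φ j - φ k)) ∧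
      ∀ z ∈ polygonRegion φ, 0 ≤ κ * cross (φ (k + 1) - φ k) (z - φ k) := by
  have h1 := zmod_one_ne_zero hφ.three_le
  have h2 := zmod_two_ne_zero hφ.three_le
  obtain ⟨κ, hκ⟩ := hφ.exists_side k
  have hnn : ∀ l, 0 ≤ κ * cross (φ (k + 1) - φ k) (φ l - φ k) := by
    intro l
    by_cases h1 : l = k
    · simp [h1]
    by_cases h2 : l = k + 1
    · simp [h2, cross_self]
    exact (hκ l h1 h2).le
  refine ⟨κ, ?_, hκ, fun z hz => ?_⟩
  · rintro rfl
    have := hκ (k - 1) (fun h => h1 (by linear_combination -h))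
      (fun h => h2 (by linear_combination -h))
    simp at this
  · have e : ∀ z, κ * cross (φ (k + 1) - φ k) (z - φ k) =
        cross (κ • (φ (k + 1) - φ k)) z - κ * cross (φ (k + 1) - φ k) (φ k) := by
      intro z
      rw [map_sub]
      simp only [cross_apply, PiLp.smul_apply, smul_eq_mul]
      ring
    have := le_cross_of_mem_polygonRegion (φ := φ) (d := κ • (φ (k + 1) - φ k))
      (c := κ * cross (φ (k + 1) - φ k) (φ k)) (fun i => by
        have := hnn i
        rw [e] at this
        linarith) hz
    rw [e]
    linarith

/-- The properties of a Tutte map from which its injectivity follows: it fixes the boundary, has no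
folds, stays in the polygon, and keeps interior vertices off every supporting line. -/
structure IsUnfoldedInPolygon (K : AbstractSimplicialComplex V) (b : ZMod n → V)
    (φ : ZMod n → Plane) (ψ : V → Plane) : Prop where
  boundary : ∀ i, ψ (b i) = φ i
  mem : ∀ v, ψ v ∈ polygonRegion φ
  unfolded : IsUnfolded K ψ
  above : ∀ v, v ∉ Set.range b → ∀ d c, d ≠ 0 → (∀ i, c ≤ cross d (φ i)) → c < cross d (ψ v)

lemma pair_eq_cases {α : Type*} [DecidableEq α] {u v x y : α} (huv : u ≠ v)
    (h : ({u, v} : Finset α) = {x, y}) : (u = x ∧ v = y) ∨ (u = y ∧ v = x) := by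
  have hu : u ∈ ({x, y} : Finset α) := h ▸ by simp
  have hv : v ∈ ({x, y} : Finset α) := h ▸ by simp
  simp only [Finset.mem_insert, Finset.mem_singleton] at hu hv
  rcases hu with rfl | rfl <;> rcases hv with rfl | rfl
  · exact absurd rfl huv
  · exact Or.inl ⟨rfl, rfl⟩
  · exact Or.inr ⟨rfl, rfl⟩
  · exact absurd rfl huv

namespace IsUnfoldedInPolygon

variable {d : Plane} {c : ℝ}

/-- The polygon lies on the same side of a boundary edge as its triangle. -/
lemma boundary_side (hψ : IsUnfoldedInPolygon K b φ ψ) (hφ : IsConvexPolygon φ) {u v x : V}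
    {k : ZMod n} (huv : u ≠ v) (h : ({u, v} : Finset V) = {b k, b (k + 1)}) {z : Plane}
    (hz : z ∈ polygonRegion φ) :
    0 ≤ cross (ψ v - ψ u) (z - ψ u) * cross (ψ v - ψ u) (ψ x - ψ u) := by
  obtain ⟨κ, hκ0, -, hκ⟩ := hφ.side_nonneg k
  have h1 := hκ z hz
  have h2 := hκ _ (hψ.mem x)
  have h3 : 0 ≤ κ ^ 2 * (cross (φ (k + 1) - φ k) (z - φ k) *
      cross (φ (k + 1) - φ k) (ψ x - φ k)) := by
    have := mul_nonneg h1 h2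
    linarith
  have h4 := nonneg_of_mul_nonneg_right h3 (by positivity)
  rcases pair_eq_cases huv h with ⟨rfl, rfl⟩ | ⟨rfl, rfl⟩
  · rwa [hψ.boundary, hψ.boundary]
  · rw [hψ.boundary, hψ.boundary]
    have e : ∀ y, cross (φ k - φ (k + 1)) (y - φ (k + 1)) =
        - cross (φ (k + 1) - φ k) (y - φ k) := by
      intro y
      simp only [cross_apply, PiLp.sub_apply]
      ring
    rw [e, e]
    linarith

lemma point_mem (hψ : IsUnfoldedInPolygon K b φ ψ) (e : CrossingEdge K ψ d c) :
    e.point ∈ polygonRegion φ :=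
  (convex_convexHull ℝ (Set.range φ)).segment_subset (hψ.mem _) (hψ.mem _) e.point_mem_segment

/-- A crossing edge with no successor is a boundary edge, and leftmost on the line. -/
lemma last_crossing (hψ : IsUnfoldedInPolygon K b φ ψ) (hD : IsDiskTriangulation K b)
    (hφ : IsConvexPolygon φ) (hd : d ≠ 0) (hc : ∀ v, cross d (ψ v) ≠ c)
    {e : CrossingEdge K ψ d c} (he : ∀ e', ¬ CrossingEdge.Next e e') :
    (∃ k, ({e.lo, e.hi} : Finset V) = {b k, b (k + 1)}) ∧
      ∀ e' : CrossingEdge K ψ d c, e'.pos ≤ e.pos := by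
  have hneg : ∀ x, ({e.lo, e.hi, x} : Finset V) ∈ triangles K →
      ¬ 0 < cross (ψ e.hi - ψ e.lo) (ψ x - ψ e.lo) := by
    intro x hx hpos
    obtain ⟨e', h1, h2, hne⟩ := e.exists_other hc hx
    exact he e' ⟨_, hx, by simp, by simp, h1, h2, (CrossingEdge.cross_pos_iff hd h1 h2 hne).1 hpos⟩
  have hbd : ∃ k, ({e.lo, e.hi} : Finset V) = {b k, b (k + 1)} := by
    by_contra! hbd
    obtain ⟨⟨x, hx, hpos⟩, -⟩ := hψ.unfolded.exists_left_right hD e.adj hbd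
    exact hneg x hx hpos
  refine ⟨hbd, fun e' => ?_⟩
  obtain ⟨k, hk⟩ := hbd
  obtain ⟨x, hx⟩ := hD.exists_triangle e.adj
  have h1 := hneg x hx
  have h2 := hψ.unfolded.nondegenerate _ _ _ hx
  have h3 := hψ.boundary_side hφ (x := x) e.adj.1 hk (hψ.point_mem e')
  obtain ⟨s, hs, h4⟩ := e.exists_cross_eq hd
  rw [h4 _ e'.cross_point] at h3
  have h5 : cross (ψ e.hi - ψ e.lo) (ψ x - ψ e.lo) < 0 := lt_of_le_of_ne (not_lt.1 h1) h2
  have h6 : s * (e'.pos - e.pos) ≤ 0 := nonpos_of_mul_nonneg_left h3 h5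
  have := nonpos_of_mul_nonpos_right h6 hs
  linarith

lemma last_crossing_unique (hψ : IsUnfoldedInPolygon K b φ ψ) (hD : IsDiskTriangulation K b)
    (hφ : IsConvexPolygon φ) (hd : d ≠ 0) (hc : ∀ v, cross d (ψ v) ≠ c)
    {e e' : CrossingEdge K ψ d c} (he : ∀ f, ¬ CrossingEdge.Next e f)
    (he' : ∀ f, ¬ CrossingEdge.Next e' f) : e = e' := by
  obtain ⟨⟨k, hk⟩, h1⟩ := hψ.last_crossing hD hφ hd hc he
  obtain ⟨⟨m, hm⟩, h2⟩ := hψ.last_crossing hD hφ hd hc he'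
  have hp := CrossingEdge.point_eq_of_pos_eq hd (le_antisymm (h2 e) (h1 e'))
  obtain ⟨κ, hκ0, hκ1, hκ⟩ := hφ.side_nonneg k
  -- The crossing point of `e'` lies on the side `k`, so both endpoints of `e'` do.
  have hz : ∀ f : CrossingEdge K ψ d c, κ * cross (φ (k + 1) - φ k) (f.point - φ k) =
      (1 - f.time) * (κ * cross (φ (k + 1) - φ k) (ψ f.lo - φ k)) +
        f.time * (κ * cross (φ (k + 1) - φ k) (ψ f.hi - φ k)) := by
    intro f
    simp only [CrossingEdge.point, cross_apply, PiLp.sub_apply, PiLp.add_apply, PiLp.smul_apply,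
      smul_eq_mul]
    ring
  have hon : ∀ f : CrossingEdge K ψ d c, ({f.lo, f.hi} : Finset V) = {b k, b (k + 1)} →
      κ * cross (φ (k + 1) - φ k) (f.point - φ k) = 0 := by
    intro f hf
    rw [hz]
    rcases pair_eq_cases f.adj.1 hf with ⟨h, h'⟩ | ⟨h, h'⟩ <;>
      simp [h, h', hψ.boundary, cross_self]
  have hzero := hon e hk
  rw [hp, hz e'] at hzero
  have hA := hκ _ (hψ.mem e'.lo)
  have hB := hκ _ (hψ.mem e'.hi)
  have ht0 := e'.time_pos
  have ht1 := e'.time_lt_one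
  have hA0 : κ * cross (φ (k + 1) - φ k) (ψ e'.lo - φ k) = 0 := by nlinarith
  have hB0 : κ * cross (φ (k + 1) - φ k) (ψ e'.hi - φ k) = 0 := by nlinarith
  have hend : ∀ j, κ * cross (φ (k + 1) - φ k) (φ j - φ k) = 0 → j = k ∨ j = k + 1 := by
    intro j hj
    by_contra! hcon
    exact (hκ1 j hcon.1 hcon.2).ne' hj
  have hmk : m = k := by
    have hmm : (m = k ∨ m = k + 1) ∧ (m + 1 = k ∨ m + 1 = k + 1) := by
      rcases pair_eq_cases e'.adj.1 hm with ⟨h, h'⟩ | ⟨h, h'⟩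
      · rw [h, hψ.boundary] at hA0
        rw [h', hψ.boundary] at hB0
        exact ⟨hend _ hA0, hend _ hB0⟩
      · rw [h, hψ.boundary] at hA0
        rw [h', hψ.boundary] at hB0
        exact ⟨hend _ hB0, hend _ hA0⟩
    rcases hmm with ⟨h | h, h' | h'⟩
    · exact h
    · exact h
    · exact absurd (show (2 : ZMod n) = 0 by linear_combination h' - h)
        (zmod_two_ne_zero hφ.three_le)
    · exact add_right_cancel h'
  subst hmk
  rcases pair_eq_cases e.adj.1 (hk.trans hm.symm) with ⟨h, h'⟩ | ⟨h, h'⟩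
  · exact CrossingEdge.ext h h'
  · have ha := e.lo_lt
    have hb := e'.lt_hi
    rw [h] at ha
    linarith

/-- The crossing edges of a line are linearly ordered by the successor relation. -/
lemma crossing_total (hψ : IsUnfoldedInPolygon K b φ ψ) (hD : IsDiskTriangulation K b)
    (hφ : IsConvexPolygon φ) (hd : d ≠ 0) (hc : ∀ v, cross d (ψ v) ≠ c)
    (e e' : CrossingEdge K ψ d c) :
    Relation.ReflTransGen CrossingEdge.Next e e' ∨ Relation.ReflTransGen CrossingEdge.Next e' e := by
  have : Finite (CrossingEdge K ψ d c) := Subtype.finite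
  have hlast : ∀ e : CrossingEdge K ψ d c, ∃ f, Relation.ReflTransGen CrossingEdge.Next e f ∧
      ∀ f', ¬ CrossingEdge.Next f f' := by
    intro e
    have hfin : {f | Relation.ReflTransGen CrossingEdge.Next e f}.Finite := Set.toFinite _
    obtain ⟨f, hf, hmax⟩ := Set.exists_max_image _ (fun f : CrossingEdge K ψ d c => f.pos) hfin
      ⟨e, Relation.ReflTransGen.refl⟩
    exact ⟨f, hf, fun f' hff' =>
      absurd (hmax f' (Relation.ReflTransGen.tail hf hff')) (not_le.2 hff'.pos_lt)⟩
  obtain ⟨f, hef, hf⟩ := hlast e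
  obtain ⟨f', hef', hf'⟩ := hlast e'
  obtain rfl := hψ.last_crossing_unique hD hφ hd hc hf hf'
  rw [← Relation.reflTransGen_swap] at hef hef'
  rcases Relation.ReflTransGen.total_of_right_unique
    (CrossingEdge.Next.leftUnique hd hψ.unfolded) hef hef' with h | h
  · rw [Relation.reflTransGen_swap] at h
    exact Or.inr h
  · rw [Relation.reflTransGen_swap] at h
    exact Or.inl h

/-- If an edge meets a triangle on a line through no vertex, it is an edge of the triangle. -/
lemma crossing_mem_triangle (hψ : IsUnfoldedInPolygon K b φ ψ) (hD : IsDiskTriangulation K b)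
    (hφ : IsConvexPolygon φ) (hd : d ≠ 0) (hc : ∀ v, cross d (ψ v) ≠ c)
    (e : CrossingEdge K ψ d c) {t : Finset V} (ht : t ∈ triangles K)
    (hmem : e.point ∈ convexHull ℝ (ψ '' t)) : e.lo ∈ t ∧ e.hi ∈ t := by
  have hlow : ∃ u ∈ t, cross d (ψ u) < c := by
    by_contra! hcon
    have : e.point ∈ {x | c < cross d x} :=
      convexHull_min (by
        rintro _ ⟨v, hv, rfl⟩
        exact lt_of_le_of_ne (hcon v hv) (hc v).symm) (convex_halfSpace_gt (cross d).isLinear c) hmem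
    exact (this : c < cross d e.point).ne' e.cross_point
  have hupp : ∃ u ∈ t, c < cross d (ψ u) := by
    by_contra! hcon
    have : e.point ∈ {x | cross d x < c} :=
      convexHull_min (by
        rintro _ ⟨v, hv, rfl⟩
        exact lt_of_le_of_ne (hcon v hv) (hc v)) (convex_halfSpace_lt (cross d).isLinear c) hmem
    exact (this : cross d e.point < c).ne e.cross_point
  obtain ⟨u, hu, huc⟩ := hlow
  obtain ⟨v, hv, hvc⟩ := hupp
  have huv : u ≠ v := by rintro rfl; linarith
  obtain ⟨e₁, hu₁, hv₁⟩ : ∃ e₁ : CrossingEdge K ψ d c, e₁.lo ∈ t ∧ e₁.hi ∈ t :=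
    ⟨⟨(u, v), adj_of_mem_triangle ht hu hv huv, huc, hvc⟩, hu, hv⟩
  obtain ⟨e₂, hu₂, hv₂, hne⟩ : ∃ e₂ : CrossingEdge K ψ d c, e₂.lo ∈ t ∧ e₂.hi ∈ t ∧ e₂ ≠ e₁ := by
    obtain ⟨x, rfl⟩ := exists_third_vertex ht hu₁ hv₁ e₁.adj.1
    exact e₁.exists_other hc ht
  have hside : ∀ f f' : CrossingEdge K ψ d c, f.lo ∈ t → f.hi ∈ t → f'.lo ∈ t → f'.hi ∈ t →
      f' ≠ f → 0 ≤ (e.pos - f.pos) * (f'.pos - f.pos) := by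
    intro f f' h1 h2 h3 h4 hff
    obtain ⟨x, rfl⟩ := exists_third_vertex ht h1 h2 f.adj.1
    obtain ⟨s, hs, h5⟩ := CrossingEdge.exists_cross_point_eq h3 h4 hff
    obtain ⟨k, hk, h6⟩ := f.exists_cross_eq hd
    set D := cross (ψ f.hi - ψ f.lo) (ψ x - ψ f.lo) with hDdef
    have h8 : D * cross (ψ f.hi - ψ f.lo) (ψ f.lo) ≤ D * cross (ψ f.hi - ψ f.lo) e.point := by
      have hconv : Convex ℝ {y | cross (D • (ψ f.hi - ψ f.lo)) (ψ f.lo) ≤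
          cross (D • (ψ f.hi - ψ f.lo)) y} :=
        convex_halfSpace_ge (LinearMap.isLinear _) _
      have hpt : ψ '' (({f.lo, f.hi, x} : Finset V) : Set V) ⊆
          {y | cross (D • (ψ f.hi - ψ f.lo)) (ψ f.lo) ≤ cross (D • (ψ f.hi - ψ f.lo)) y} := by
        rintro _ ⟨w, hw, rfl⟩
        have : 0 ≤ D * cross (ψ f.hi - ψ f.lo) (ψ w - ψ f.lo) := by
          simp only [Finset.coe_insert, Finset.coe_singleton, Set.mem_insert_iff,
            Set.mem_singleton_iff] at hw
          rcases hw with rfl | rfl | rfl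
          · simp
          · rw [cross_self, mul_zero]
          · exact mul_self_nonneg _
        rw [map_sub, mul_sub, sub_nonneg, ← cross_smul_left, ← cross_smul_left] at this
        exact this
      have := convexHull_min hpt hconv hmem
      rw [← cross_smul_left, ← cross_smul_left]
      exact this
    replace h8 : 0 ≤ D * cross (ψ f.hi - ψ f.lo) (e.point - ψ f.lo) := by
      rw [map_sub, mul_sub]
      linarith
    have g1 := h6 _ e.cross_point
    have g2 := h6 _ f'.cross_point
    rw [h5] at g2
    rw [g1] at h8
    have g3 : 0 ≤ s * (D *
        (k * (-dot d e.point - f.pos))) := mul_nonneg hs.le h8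
    have g4 : 0 ≤ k ^ 2 * ((e.pos - f.pos) * (f'.pos - f.pos)) := by
      calc (0 : ℝ) ≤ _ := g3
        _ = (s * D) * (k * (-dot d e.point - f.pos)) := by
          ring
        _ = k ^ 2 * ((e.pos - f.pos) * (f'.pos - f.pos)) := by
          rw [g2, CrossingEdge.pos, CrossingEdge.pos, CrossingEdge.pos]; ring
    exact nonneg_of_mul_nonneg_right g4 (by positivity)
  have key : ∀ f f' : CrossingEdge K ψ d c, f.lo ∈ t → f.hi ∈ t → f'.lo ∈ t → f'.hi ∈ t →
      f.pos < f'.pos → e = f ∨ e = f' := by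
    intro f f' h1 h2 h3 h4 hlt
    have hff : f' ≠ f := by rintro rfl; exact lt_irrefl _ hlt
    have g1 : f.pos ≤ e.pos := by
      have := nonneg_of_mul_nonneg_left (hside f f' h1 h2 h3 h4 hff) (by linarith)
      linarith
    have g2 : e.pos ≤ f'.pos := by
      have := hside f' f h3 h4 h1 h2 hff.symm
      nlinarith
    rcases hψ.crossing_total hD hφ hd hc e f with h | h
    · rcases CrossingEdge.eq_or_pos_lt h with h | h
      · exact Or.inl h
      · linarith
    · rcases Relation.ReflTransGen.cases_head h with h | ⟨y, hy, h⟩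
      · exact Or.inl h.symm
      · right
        have : y = f' := CrossingEdge.Next.rightUnique hd hψ.unfolded hy
          ⟨t, ht, h1, h2, h3, h4, hlt⟩
        subst this
        rcases CrossingEdge.eq_or_pos_lt h with h | h
        · exact h.symm
        · linarith
  rcases lt_trichotomy e₁.pos e₂.pos with h | h | h
  · rcases key e₁ e₂ hu₁ hv₁ hu₂ hv₂ h with rfl | rfl
    exacts [⟨hu₁, hv₁⟩, ⟨hu₂, hv₂⟩]
  · exfalso
    obtain ⟨x, rfl⟩ := exists_third_vertex ht hu₁ hv₁ e₁.adj.1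
    obtain ⟨s, hs, h5⟩ := CrossingEdge.exists_cross_point_eq hu₂ hv₂ hne
    rw [← CrossingEdge.point_eq_of_pos_eq hd h, e₁.cross_point_sub] at h5
    exact (mul_ne_zero hs.ne' (hψ.unfolded.nondegenerate _ _ _ ht)) h5.symm
  · rcases key e₂ e₁ hu₂ hv₂ hu₁ hv₁ h with rfl | rfl
    exacts [⟨hu₂, hv₂⟩, ⟨hu₁, hv₁⟩]

end IsUnfoldedInPolygon

end Disk

/-! ### Unfolded maps are embeddings of the 1-skeleton -/

lemma exists_generic_direction {V : Type*} [Finite V] (ψ : V → Plane) {x : Plane}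
    (hx : ∀ v, ψ v ≠ x) : ∃ d : Plane, d ≠ 0 ∧ ∀ v, cross d (ψ v) ≠ cross d x := by
  obtain ⟨s, hs⟩ := (Set.finite_range fun v => (ψ v - x) 1 / (ψ v - x) 0).exists_notMem
  refine ⟨!₂[1, s], fun h => ?_, fun v hv => hs ⟨v, ?_⟩⟩
  · have := congrArg (fun y : Plane => y 0) h
    simp at this
  · have h1 : cross !₂[1, s] (ψ v - x) = 0 := by rw [map_sub, hv, sub_self]
    rw [cross_apply] at h1
    simp only [Matrix.cons_val_zero, Matrix.cons_val_one, one_mul] at h1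
    have h0 : (ψ v - x) 0 ≠ 0 := by
      intro h0
      rw [h0, mul_zero, sub_zero] at h1
      exact hx v (sub_eq_zero.1 (plane_ext h0 h1))
    show (ψ v - x) 1 / (ψ v - x) 0 = s
    rw [div_eq_iff h0]
    linarith

section Disk

variable {V : Type*} [Fintype V] [DecidableEq V] {n : ℕ} {K : AbstractSimplicialComplex V}
  {b : ZMod n → V} {φ : ZMod n → Plane} {ψ : V → Plane}

lemma exists_crossingEdge {d : Plane} {c : ℝ} (hc : ∀ v, cross d (ψ v) ≠ c) {u w : V}
    (huw : (edgeGraph K).Adj u w) {x : Plane} (hx : x ∈ segment ℝ (ψ u) (ψ w))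
    (hxc : cross d x = c) : ∃ e : CrossingEdge K ψ d c, e.point = x ∧
      ((e.lo = u ∧ e.hi = w) ∨ (e.lo = w ∧ e.hi = u)) := by
  have main : ∀ u w, (edgeGraph K).Adj u w → x ∈ segment ℝ (ψ u) (ψ w) → cross d (ψ u) < c →
      ∃ e : CrossingEdge K ψ d c, e.point = x ∧ (e.lo = u ∧ e.hi = w) := by
    rintro u w huw ⟨α, β, hα, hβ, hαβ, rfl⟩ hu
    rw [map_add, map_smul, map_smul, smul_eq_mul, smul_eq_mul, show α = 1 - β by linarith] at hxc
    have hw : c < cross d (ψ w) := by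
      by_contra hw
      have hw' : cross d (ψ w) < c := lt_of_le_of_ne (not_lt.1 hw) (hc w)
      rcases hβ.lt_or_eq with h | h
      · nlinarith [mul_pos h (sub_pos.2 hw'), mul_nonneg hα (sub_pos.2 hu).le]
      · rw [← h] at hxc
        linarith
    refine ⟨⟨(u, w), huw, hu, hw⟩, ?_, rfl, rfl⟩
    have hne : cross d (ψ w) - cross d (ψ u) ≠ 0 := by linarith
    have ht : CrossingEdge.time (⟨(u, w), huw, hu, hw⟩ : CrossingEdge K ψ d c) = β := by
      show (c - cross d (ψ u)) / (cross d (ψ w) - cross d (ψ u)) = β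
      rw [div_eq_iff hne]
      linarith
    show ψ u + CrossingEdge.time (⟨(u, w), huw, hu, hw⟩ : CrossingEdge K ψ d c) •
      (ψ w - ψ u) = _
    rw [ht, show α = 1 - β by linarith, sub_smul, one_smul, smul_sub]
    abel
  rcases lt_or_gt_of_ne (hc u) with h | h
  · obtain ⟨e, he, h'⟩ := main u w huw hx h
    exact ⟨e, he, Or.inl h'⟩
  · have hw : cross d (ψ w) < c := by
      obtain ⟨α, β, hα, hβ, hαβ, rfl⟩ := hx
      rw [map_add, map_smul, map_smul, smul_eq_mul, smul_eq_mul] at hxc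
      by_contra hw
      have hw' : c < cross d (ψ w) := lt_of_le_of_ne (not_lt.1 hw) (hc w).symm
      rw [show α = 1 - β by linarith] at hxc
      rcases hβ.lt_or_eq with h' | h'
      · nlinarith [mul_pos h' (sub_pos.2 hw'), mul_nonneg hα (sub_pos.2 h).le]
      · rw [← h'] at hxc
        linarith
    obtain ⟨e, he, h'⟩ := main w u huw.symm (by rwa [segment_symm]) hw
    exact ⟨e, he, Or.inr h'⟩

lemma IsUnfolded.ne_of_adj (hU : IsUnfolded K ψ) (hD : IsDiskTriangulation K b) {u v : V}
    (huv : (edgeGraph K).Adj u v) : ψ u ≠ ψ v := by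
  intro h
  obtain ⟨x, hx⟩ := hD.exists_triangle huv
  apply hU.nondegenerate _ _ _ hx
  rw [h, sub_self, cross_apply]
  simp

namespace IsUnfoldedInPolygon

/-- If a point that is no vertex lies on an edge and in a triangle, the edge belongs to the
triangle. -/
lemma edge_subset_triangle (hψ : IsUnfoldedInPolygon K b φ ψ) (hD : IsDiskTriangulation K b)
    (hφ : IsConvexPolygon φ) {u w : V} (huw : (edgeGraph K).Adj u w) {x : Plane}
    (hx : ∀ v, ψ v ≠ x) (hxe : x ∈ segment ℝ (ψ u) (ψ w)) {t : Finset V} (ht : t ∈ triangles K)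
    (hxt : x ∈ convexHull ℝ (ψ '' t)) : u ∈ t ∧ w ∈ t := by
  obtain ⟨d, hd, hc⟩ := exists_generic_direction ψ hx
  obtain ⟨e, he, h⟩ := exists_crossingEdge hc huw hxe rfl
  have := hψ.crossing_mem_triangle hD hφ hd hc e ht (by rwa [he])
  rcases h with ⟨h1, h2⟩ | ⟨h1, h2⟩
  · rwa [h1, h2] at this
  · rw [h1, h2] at this
    exact this.symm

/-- Vertices do not lie on edges not containing them. -/
lemma notMem_segment (hψ : IsUnfoldedInPolygon K b φ ψ) (hD : IsDiskTriangulation K b)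
    (hφ : IsConvexPolygon φ) {u v w : V} (huw : (edgeGraph K).Adj u w) (hvu : v ≠ u)
    (hvw : v ≠ w) : ψ v ∉ segment ℝ (ψ u) (ψ w) := by
  classical
  intro hmem
  by_cases hv : v ∈ Set.range b
  · -- A corner of the polygon is strictly lowest for some functional.
    obtain ⟨i, rfl⟩ := hv
    obtain ⟨d, hdi⟩ := hφ.exists_strict_min i
    have hd : d ≠ 0 := by
      rintro rfl
      have := hdi (i + 1) (fun h => zmod_one_ne_zero hφ.three_le (by linear_combination h))
      simp [cross_apply] at this
    have hmin : ∀ j, cross d (φ i) ≤ cross d (φ j) := by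
      intro j
      by_cases h : j = i
      · rw [h]
      · exact (hdi j h).le
    have hlt : ∀ x, b i ≠ x → cross d (φ i) < cross d (ψ x) := by
      intro x hx
      by_cases hxb : x ∈ Set.range b
      · obtain ⟨j, rfl⟩ := hxb
        rw [hψ.boundary]
        exact hdi j fun h => hx (by rw [h])
      · exact hψ.above x hxb d _ hd hmin
    obtain ⟨α, β, hα, hβ, hαβ, h⟩ := hmem
    have h1 := congrArg (cross d) h
    rw [map_add, map_smul, map_smul, smul_eq_mul, smul_eq_mul, hψ.boundary] at h1
    have h2 := hlt u hvu
    have h3 := hlt w hvw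
    rw [show α = 1 - β by linarith] at h1 hα
    rcases hβ.lt_or_eq with h4 | h4
    · nlinarith
    · rw [← h4] at h1
      linarith
  · have main : ∀ u w, (edgeGraph K).Adj u w → v ≠ u → v ≠ w → ψ w ≠ ψ v →
        ψ v ∈ segment ℝ (ψ u) (ψ w) → False := by
      intro u w huw hvu hvw hne hmem
      obtain ⟨hN, hL, hR⟩ := hψ.unfolded.surrounding hD hv
        (N := Finset.univ.filter fun u => (edgeGraph K).Adj v u) (by simp)
      obtain ⟨p, hp, q, hq, ht, α, β, hα, hβ, hd⟩ := exists_sector_of_surrounding hN hL hR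
        (d := ψ w - ψ v) (sub_ne_zero.2 hne)
      -- Move a little along the edge from `ψ v`, avoiding all vertices.
      have hδ : (0 : ℝ) < 1 / (1 + α + β) := by positivity
      have hinf : (Set.Ioo (0 : ℝ) (1 / (1 + α + β))).Infinite := Set.Ioo_infinite hδ
      have hinj : Function.Injective fun s : ℝ => ψ v + s • (ψ w - ψ v) := by
        intro s s' hss
        have : (s - s') • (ψ w - ψ v) = 0 := by
          rw [sub_smul, sub_eq_zero]
          exact add_left_cancel hss
        rcases smul_eq_zero.1 this with h | h
        · linarith
        · exact absurd h (sub_ne_zero.2 hne)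
      obtain ⟨_, ⟨s, hs, rfl⟩, hz⟩ := (hinf.image hinj.injOn).exists_notMem_finite
        (Set.finite_range ψ)
      have hs1 : s * (1 + α + β) < 1 := by
        have := hs.2
        rwa [lt_div_iff₀ (by positivity)] at this
      have hs0 : 0 < s := hs.1
      have hzt : ψ v + s • (ψ w - ψ v) ∈ convexHull ℝ (ψ '' (({v, p, q} : Finset V) : Set V)) := by
        have hconv := convex_convexHull ℝ (ψ '' (({v, p, q} : Finset V) : Set V))
        have hin : ∀ x ∈ ({v, p, q} : Finset V),
            ψ x ∈ convexHull ℝ (ψ '' (({v, p, q} : Finset V) : Set V)) := fun x hx =>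
          subset_convexHull ℝ _ ⟨x, hx, rfl⟩
        have hcomb := hconv.sum_mem (t := Finset.univ) (w := ![1 - s * α - s * β, s * α, s * β])
          (z := ![ψ v, ψ p, ψ q]) (by
            intro i _
            fin_cases i
            · simp; nlinarith
            · simp; positivity
            · simp; positivity) (by simp [Fin.sum_univ_three]; ring) (by
            intro i _
            fin_cases i
            · exact hin v (by simp)
            · exact hin p (by simp)
            · exact hin q (by simp))
        have e : ψ v + s • (ψ w - ψ v) =
            ∑ i, ![1 - s * α - s * β, s * α, s * β] i • ![ψ v, ψ p, ψ q] i := by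
          rw [hd, Fin.sum_univ_three]
          apply plane_ext <;> simp <;> ring
        rw [e]
        exact hcomb
      have hze : ψ v + s • (ψ w - ψ v) ∈ segment ℝ (ψ u) (ψ w) := by
        refine (convex_segment _ _).add_smul_sub_mem hmem (right_mem_segment ℝ _ _)
          ⟨hs0.le, ?_⟩
        nlinarith [mul_nonneg hs0.le hα, mul_nonneg hs0.le hβ]
      obtain ⟨hu, hw⟩ := hψ.edge_subset_triangle hD hφ huw (fun x hx => hz ⟨x, hx⟩) hze ht hzt
      have htri : ({u, w, v} : Finset V) ∈ triangles K := by
        rw [← eq_insert_pair_of_mem ht.2 hu hw (by simp) huw.1 hvu.symm hvw.symm]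
        exact ht
      apply hψ.unfolded.nondegenerate _ _ _ htri
      obtain ⟨γ, δ, -, -, hγδ, h⟩ := hmem
      rw [← h, show γ = 1 - δ by linarith,
        show (1 - δ) • ψ u + δ • ψ w - ψ u = δ • (ψ w - ψ u) by
          rw [sub_smul, one_smul, smul_sub]; abel, map_smul, cross_self, smul_zero]
    by_cases hne : ψ w = ψ v
    · exact main w u huw.symm hvw hvu (fun h => hψ.unfolded.ne_of_adj hD huw (h.trans hne.symm))
        (by rwa [segment_symm])
    · exact main u w huw hvu hvw hne hmem

/-- Distinct edges do not cross. -/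
lemma edge_eq_of_mem (hψ : IsUnfoldedInPolygon K b φ ψ) (hD : IsDiskTriangulation K b)
    (hφ : IsConvexPolygon φ) {u w u' w' : V} (huw : (edgeGraph K).Adj u w)
    (huw' : (edgeGraph K).Adj u' w') {s r : ℝ} (hs0 : 0 < s) (hs1 : s < 1) (hr0 : 0 < r)
    (hr1 : r < 1) (h : (1 - s) • ψ u + s • ψ w = (1 - r) • ψ u' + r • ψ w') :
    (u' = u ∧ w' = w) ∨ (u' = w ∧ w' = u) := by
  set x := (1 - s) • ψ u + s • ψ w with hx
  have hxs : x ∈ segment ℝ (ψ u) (ψ w) := ⟨1 - s, s, by linarith, hs0.le, by ring, rfl⟩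
  have hxs' : x ∈ segment ℝ (ψ u') (ψ w') := ⟨1 - r, r, by linarith, hr0.le, by ring, h.symm⟩
  have hne := hψ.unfolded.ne_of_adj hD huw
  have hsub : x - ψ u = s • (ψ w - ψ u) := by
    rw [hx, sub_smul, one_smul, smul_sub]; abel
  have hxv : ∀ v, ψ v ≠ x := by
    intro v hv
    by_cases h1 : v = u
    · subst h1
      rw [← hv, sub_self, eq_comm, smul_eq_zero] at hsub
      rcases hsub with h | h
      · linarith
      · exact hne (sub_eq_zero.1 h).symm
    by_cases h2 : v = w
    · subst h2
      have : (1 - s) • (ψ v - ψ u) = 0 := by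
        rw [sub_smul, one_smul, ← hsub, hv]
        abel
      rcases smul_eq_zero.1 this with h | h
      · linarith
      · exact hne (sub_eq_zero.1 h).symm
    exact hψ.notMem_segment hD hφ huw h1 h2 (hv ▸ hxs)
  obtain ⟨y, hy⟩ := hD.exists_triangle huw
  have hxt : x ∈ convexHull ℝ (ψ '' (({u, w, y} : Finset V) : Set V)) := by
    have hin : ∀ z ∈ ({u, w, y} : Finset V),
        ψ z ∈ convexHull ℝ (ψ '' (({u, w, y} : Finset V) : Set V)) := fun z hz =>
      subset_convexHull ℝ _ ⟨z, hz, rfl⟩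
    exact (convex_convexHull ℝ _).segment_subset (hin u (by simp)) (hin w (by simp)) hxs
  obtain ⟨hu', hw'⟩ := hψ.edge_subset_triangle hD hφ huw' hxv hxs' hy hxt
  have hcr : cross (ψ w - ψ u) (x - ψ u) = 0 := by rw [hsub, map_smul, cross_self, smul_zero]
  have hnd := hψ.unfolded.nondegenerate _ _ _ hy
  have hcr' : (1 - r) * cross (ψ w - ψ u) (ψ u' - ψ u) + r * cross (ψ w - ψ u) (ψ w' - ψ u) = 0 := by
    rw [← hcr, h]
    simp only [cross_apply, PiLp.sub_apply, PiLp.add_apply, PiLp.smul_apply, smul_eq_mul]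
    ring
  have hr1' : 1 - r ≠ 0 := by linarith
  simp only [Finset.mem_insert, Finset.mem_singleton] at hu' hw'
  rcases hu' with rfl | rfl | rfl <;> rcases hw' with rfl | rfl | rfl
  · exact absurd rfl huw'.1
  · exact Or.inl ⟨rfl, rfl⟩
  · rw [sub_self, map_zero, mul_zero, zero_add] at hcr'
    exact absurd hcr' (mul_ne_zero hr0.ne' hnd)
  · exact Or.inr ⟨rfl, rfl⟩
  · exact absurd rfl huw'.1
  · rw [cross_self, mul_zero, zero_add] at hcr'
    exact absurd hcr' (mul_ne_zero hr0.ne' hnd)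
  · rw [sub_self, map_zero, mul_zero, add_zero] at hcr'
    exact absurd hcr' (mul_ne_zero hr1' hnd)
  · rw [cross_self, mul_zero, add_zero] at hcr'
    exact absurd hcr' (mul_ne_zero hr1' hnd)
  · exact absurd rfl huw'.1

end IsUnfoldedInPolygon

lemma oneSkeleton_cases {w : V → ℝ} (hw : w ∈ oneSkeleton K) :
    (∃ v, w = Pi.single v 1) ∨ ∃ u v, ∃ s : ℝ, (edgeGraph K).Adj u v ∧ 0 < s ∧ s < 1 ∧
      w = (1 - s) • Pi.single u (1 : ℝ) + s • Pi.single v (1 : ℝ) := by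
  obtain ⟨⟨h0, h1⟩, t, ht, hcard, hsupp⟩ := hw
  have hpos : 0 < t.card := Finset.card_pos.2 ((K.isRelLowerSet_faces ht).1)
  have hsum : ∑ v ∈ t, w v = 1 := by
    rw [← h1]
    exact Finset.sum_subset (Finset.subset_univ _) fun v _ hv =>
      by_contra fun h => hv (hsupp v h)
  rcases (by omega : t.card = 1 ∨ t.card = 2) with hc | hc
  · obtain ⟨v, rfl⟩ := Finset.card_eq_one.1 hc
    rw [Finset.sum_singleton] at hsum
    left
    refine ⟨v, funext fun x => ?_⟩
    by_cases hx : x = v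
    · rw [hx, Pi.single_eq_same, hsum]
    · rw [Pi.single_eq_of_ne hx]
      exact by_contra fun h => hx (Finset.mem_singleton.1 (hsupp x h))
  · obtain ⟨u, v, huv, rfl⟩ := Finset.card_eq_two.1 hc
    rw [Finset.sum_pair huv] at hsum
    have hw : w = (1 - w v) • Pi.single u (1 : ℝ) + w v • Pi.single v (1 : ℝ) := by
      funext x
      by_cases hxu : x = u
      · subst hxu
        simp [Pi.single_eq_of_ne huv]
        linarith
      by_cases hxv : x = v
      · subst hxv
        simp [Pi.single_eq_of_ne hxu]
      · simp only [Pi.add_apply, Pi.smul_apply, Pi.single_eq_of_ne hxu, Pi.single_eq_of_ne hxv,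
          smul_zero, add_zero]
        by_contra h
        have := hsupp x h
        simp only [Finset.mem_insert, Finset.mem_singleton] at this
        exact this.elim hxu hxv
    rcases (h0 v).lt_or_eq with hv | hv
    · rcases (h0 u).lt_or_eq with hu | hu
      · exact Or.inr ⟨u, v, w v, ⟨huv, ht⟩, hv, by linarith, hw⟩
      · left
        refine ⟨v, ?_⟩
        rw [hw, show w v = 1 by linarith]
        simp
    · left
      refine ⟨u, ?_⟩
      rw [hw, ← hv]
      simp

lemma sum_single_smul (ψ : V → Plane) (v : V) :
    ∑ x, (Pi.single v 1 : V → ℝ) x • ψ x = ψ v := by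
  rw [Finset.sum_eq_single v]
  · simp
  · intro x _ hx; simp [hx]
  · simp

lemma sum_edge_smul (ψ : V → Plane) (u v : V) (s : ℝ) :
    ∑ x, ((1 - s) • Pi.single u 1 + s • Pi.single v 1 : V → ℝ) x • ψ x =
      (1 - s) • ψ u + s • ψ v := by
  simp only [Pi.add_apply, Pi.smul_apply, smul_eq_mul, add_smul, mul_smul, Finset.sum_add_distrib,
    ← Finset.smul_sum, sum_single_smul]

/-- The straight-line map of an unfolded map is injective. -/
lemma IsUnfoldedInPolygon.injective (hψ : IsUnfoldedInPolygon K b φ ψ)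
    (hD : IsDiskTriangulation K b) (hφ : IsConvexPolygon φ) :
    Function.Injective (straightLineMap K ψ) := by
  have hvv : ∀ v v', ψ v = ψ v' → v = v' := by
    intro v v' h
    by_contra hne
    obtain ⟨u⟩ := (hD.link_connected v').nonempty
    obtain ⟨x, hx⟩ := hD.exists_triangle u.2
    obtain ⟨h1, h2, h3⟩ := ne_of_mem_triangles hx
    by_cases hu : v = u.1
    · refine hψ.notMem_segment hD hφ (u := v') (w := x)
        (adj_of_mem_triangle hx (by simp) (by simp) h2) hne (by rw [hu]; exact h3) ?_
      rw [h]; exact left_mem_segment _ _ _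
    · refine hψ.notMem_segment hD hφ (u := v') (w := u.1) u.2 hne hu ?_
      rw [h]; exact left_mem_segment _ _ _
  have hve : ∀ v u y, ∀ s : ℝ, (edgeGraph K).Adj u y → 0 < s → s < 1 →
      ψ v ≠ (1 - s) • ψ u + s • ψ y := by
    intro v u y s huy hs0 hs1 h
    have hne := hψ.unfolded.ne_of_adj hD huy
    by_cases h1 : v = u
    · subst h1
      have : s • (ψ y - ψ v) = 0 := by
        have h' : ψ v - ((1 - s) • ψ v + s • ψ y) = 0 := sub_eq_zero.2 h
        rw [sub_smul, one_smul] at h'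
        rw [smul_sub, ← neg_eq_zero, ← h']
        abel
      rcases smul_eq_zero.1 this with h | h
      · linarith
      · exact hne (sub_eq_zero.1 h).symm
    by_cases h2 : v = y
    · subst h2
      have : (1 - s) • (ψ v - ψ u) = 0 := by
        have h' : ψ v - ((1 - s) • ψ u + s • ψ v) = 0 := sub_eq_zero.2 h
        rw [smul_sub, ← h', sub_smul, one_smul]
        abel
      rcases smul_eq_zero.1 this with h | h
      · linarith
      · exact hne (sub_eq_zero.1 h).symm
    exact hψ.notMem_segment hD hφ huy h1 h2 ⟨1 - s, s, by linarith, hs0.le, by ring, h.symm⟩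
  rintro ⟨w, hw⟩ ⟨w', hw'⟩ h
  rw [Subtype.mk.injEq]
  simp only [straightLineMap] at h
  rcases oneSkeleton_cases hw with ⟨v, rfl⟩ | ⟨u, y, s, huy, hs0, hs1, rfl⟩ <;>
    rcases oneSkeleton_cases hw' with ⟨v', rfl⟩ | ⟨u', y', s', huy', hs0', hs1', rfl⟩
  · rw [sum_single_smul, sum_single_smul] at h
    rw [hvv v v' h]
  · rw [sum_single_smul, sum_edge_smul] at h
    exact absurd h (hve _ _ _ _ huy' hs0' hs1')
  · rw [sum_single_smul, sum_edge_smul] at h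
    exact absurd h.symm (hve _ _ _ _ huy hs0 hs1)
  · rw [sum_edge_smul, sum_edge_smul] at h
    have hne := hψ.unfolded.ne_of_adj hD huy
    rcases hψ.edge_eq_of_mem hD hφ huy huy' hs0 hs1 hs0' hs1' h with ⟨rfl, rfl⟩ | ⟨rfl, rfl⟩
    · have : (s - s') • (ψ y' - ψ u') = 0 := by
        have h' := sub_eq_zero.2 h
        rw [← h']
        apply plane_ext <;> simp <;> ring
      rcases smul_eq_zero.1 this with h | h
      · rw [sub_eq_zero.1 h]
      · exact absurd (sub_eq_zero.1 h).symm hne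
    · have : (s - (1 - s')) • (ψ u' - ψ y') = 0 := by
        have h' := sub_eq_zero.2 h
        rw [← h']
        apply plane_ext <;> simp <;> ring
      rcases smul_eq_zero.1 this with h | h
      · rw [sub_eq_zero.1 h, sub_sub_cancel, add_comm]
      · exact absurd (sub_eq_zero.1 h).symm hne

lemma isCompact_oneSkeleton : IsCompact (oneSkeleton K) := by
  classical
  have : oneSkeleton K = stdSimplex ℝ V ∩
      ⋃ s ∈ {s : Finset V | s ∈ K.faces ∧ s.card ≤ 2}, {w : V → ℝ | ∀ v, v ∉ s → w v = 0} := by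
    ext w
    simp only [oneSkeleton, Set.mem_ofPred_eq, Set.mem_inter_iff, Set.mem_iUnion, exists_prop]
    refine and_congr_right fun _ => ?_
    constructor
    · rintro ⟨s, hs, hc, h⟩
      exact ⟨s, ⟨hs, hc⟩, fun v hv => by_contra fun hw => hv (h v hw)⟩
    · rintro ⟨s, ⟨hs, hc⟩, h⟩
      exact ⟨s, hs, hc, fun v hw => by_contra fun hv => hw (h v hv)⟩
  rw [this]
  refine (isCompact_stdSimplex ℝ V).inter_right (Set.Finite.isClosed_biUnion (Set.toFinite _) ?_)
  intro s _
  simp only [Set.ofPred_forall]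
  exact isClosed_iInter fun v => isClosed_iInter fun _ =>
    isClosed_eq (continuous_apply v) continuous_const

lemma isEmbedding_straightLineMap (h : Function.Injective (straightLineMap K ψ)) :
    Topology.IsEmbedding (straightLineMap K ψ) := by
  have : CompactSpace (oneSkeleton K) := isCompact_iff_compactSpace.1 isCompact_oneSkeleton
  have hcont : Continuous (straightLineMap K ψ) :=
    continuous_finsetSum _ fun v _ =>
      ((continuous_apply v).comp continuous_subtype_val).smul continuous_const
  exact (hcont.isClosedEmbedding h).isEmbedding

/-- Tutte's theorem: a convex combination map is a geodesic triangulation. -/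
theorem IsConvexCombinationMap.mem_geodesicTriangulations (hD : IsDiskTriangulation K b)
    (hφ : IsConvexPolygon φ) (hψ : IsConvexCombinationMap K b φ ψ) :
    ψ ∈ geodesicTriangulations K b φ := by
  have h : IsUnfoldedInPolygon K b φ ψ := ⟨hψ.boundary, hψ.mem_polygonRegion hD hφ,
    hψ.isUnfolded hD hφ, fun v hv d c hd hc => hψ.lt_of_notMem_range hD hφ hd hc hv⟩
  exact ⟨h.boundary, h.mem, isEmbedding_straightLineMap (h.injective hD hφ)⟩

end Disk

/-! ### Embedded 1-skeleta are unfolded -/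

section Disk

variable {V : Type*} [Fintype V] [DecidableEq V] {n : ℕ} {K : AbstractSimplicialComplex V}
  {b : ZMod n → V} {φ : ZMod n → Plane} {ψ : V → Plane}

lemma edge_point_mem_oneSkeleton {u w : V} (huw : (edgeGraph K).Adj u w) {s : ℝ} (hs0 : 0 ≤ s)
    (hs1 : s ≤ 1) :
    ((1 - s) • Pi.single u 1 + s • Pi.single w 1 : V → ℝ) ∈ oneSkeleton K := by
  refine ⟨(convex_stdSimplex ℝ V) (single_mem_stdSimplex ℝ u) (single_mem_stdSimplex ℝ w)
    (by linarith) hs0 (by ring), {u, w}, huw.2, Finset.card_le_two, fun v hv => ?_⟩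
  by_contra h
  simp only [Finset.mem_insert, Finset.mem_singleton, not_or] at h
  exact hv (by simp [h.1, h.2])

lemma eq_of_edge_points_eq (h : Function.Injective (straightLineMap K ψ)) {u w u' w' : V}
    (huw : (edgeGraph K).Adj u w) (huw' : (edgeGraph K).Adj u' w') {s r : ℝ} (hs0 : 0 ≤ s)
    (hs1 : s ≤ 1) (hr0 : 0 ≤ r) (hr1 : r ≤ 1)
    (he : (1 - s) • ψ u + s • ψ w = (1 - r) • ψ u' + r • ψ w') :
    ((1 - s) • Pi.single u 1 + s • Pi.single w 1 : V → ℝ) =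
      (1 - r) • Pi.single u' 1 + r • Pi.single w' 1 := by
  have := @h ⟨_, edge_point_mem_oneSkeleton huw hs0 hs1⟩
    ⟨_, edge_point_mem_oneSkeleton huw' hr0 hr1⟩ (by
      simp only [straightLineMap, sum_edge_smul]
      exact he)
  exact congrArg Subtype.val this

lemma disjoint_edges (h : Function.Injective (straightLineMap K ψ)) {u w u' w' : V}
    (huw : (edgeGraph K).Adj u w) (huw' : (edgeGraph K).Adj u' w') (h1 : u ≠ u') (h2 : u ≠ w')
    (h3 : w ≠ u') (h4 : w ≠ w') {x : Plane} (hx : x ∈ segment ℝ (ψ u) (ψ w)) :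
    x ∉ segment ℝ (ψ u') (ψ w') := by
  rintro ⟨α', β', hα', hβ', hαβ', he'⟩
  obtain ⟨α, β, hα, hβ, hαβ, he⟩ := hx
  obtain rfl : α = 1 - β := by linarith
  obtain rfl : α' = 1 - β' := by linarith
  have := eq_of_edge_points_eq h huw huw' hβ (by linarith) hβ' (by linarith) (he.trans he'.symm)
  have e1 := congrFun this u
  have e2 := congrFun this w
  simp [h1, h2, huw.1] at e1
  simp [h3, h4, huw.1.symm] at e2
  linarith

lemma vertex_notMem_edge (h : Function.Injective (straightLineMap K ψ))
    (hD : IsDiskTriangulation K b) {u v w : V} (huw : (edgeGraph K).Adj u w) (h1 : v ≠ u)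
    (h2 : v ≠ w) : ψ v ∉ segment ℝ (ψ u) (ψ w) := by
  rintro ⟨α, β, hα, hβ, hαβ, he⟩
  obtain rfl : α = 1 - β := by linarith
  obtain ⟨x⟩ := (hD.link_connected v).nonempty
  have := eq_of_edge_points_eq h x.2 huw le_rfl zero_le_one hβ (by linarith)
    (by rw [he, sub_zero, one_smul, zero_smul, add_zero])
  have e := congrFun this v
  simp [h1, h2] at e

lemma nondegenerate_of_injective (h : Function.Injective (straightLineMap K ψ))
    (hD : IsDiskTriangulation K b) {u v x : V} (ht : ({u, v, x} : Finset V) ∈ triangles K) :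
    cross (ψ v - ψ u) (ψ x - ψ u) ≠ 0 := by
  intro hc
  obtain ⟨huv, hux, hvx⟩ := ne_of_mem_triangles ht
  have auv := adj_of_mem_triangle ht (by simp) (by simp) huv
  have aux := adj_of_mem_triangle ht (by simp) (by simp) hux
  have avx := adj_of_mem_triangle ht (by simp) (by simp) hvx
  have hne : ψ v - ψ u ≠ 0 := by
    intro h0
    refine vertex_notMem_edge h hD aux huv.symm hvx ?_
    rw [sub_eq_zero.1 h0]
    exact left_mem_segment _ _ _
  obtain ⟨s, hs⟩ := eq_smul_of_cross_eq_zero hne hc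
  have hx : ψ x = ψ u + s • (ψ v - ψ u) := by rw [← hs]; abel
  rcases le_or_gt s 0 with h0 | h0
  · refine vertex_notMem_edge h hD avx huv hux ⟨-s / (1 - s), 1 / (1 - s), ?_, ?_, ?_, ?_⟩
    · exact div_nonneg (by linarith) (by linarith)
    · exact div_nonneg (by linarith) (by linarith)
    · have : 1 - s ≠ 0 := by linarith
      field_simp
      ring
    · have : 1 - s ≠ 0 := by linarith
      rw [hx]
      apply plane_ext <;> simp <;> field_simp <;> ring
  rcases le_or_gt s 1 with h1 | h1
  · refine vertex_notMem_edge h hD auv hux.symm hvx.symm ⟨1 - s, s, by linarith, h0.le, by ring, ?_⟩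
    rw [hx]
    apply plane_ext <;> simp <;> ring
  · refine vertex_notMem_edge h hD aux huv.symm hvx ⟨1 - 1 / s, 1 / s, ?_, ?_, ?_, ?_⟩
    · rw [sub_nonneg, div_le_one h0]
      exact h1.le
    · positivity
    · ring
    · rw [hx]
      apply plane_ext <;> simp <;> field_simp <;> ring

lemma sum_triangle {M : Type*} [AddCommMonoid M] {u v x : V} (huv : u ≠ v) (hux : u ≠ x)
    (hvx : v ≠ x) (f : V → M) : ∑ y ∈ {u, v, x}, f y = f u + f v + f x := by
  rw [Finset.sum_insert (by simp [huv, hux]), Finset.sum_pair hvx, add_assoc]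

/-- Barycentric coordinates with respect to a nondegenerate triangle. -/
lemma exists_barycentric (h : Function.Injective (straightLineMap K ψ))
    (hD : IsDiskTriangulation K b) {t : Finset V} (ht : t ∈ triangles K) (p : Plane) :
    ∃ μ : V → ℝ, ∑ x ∈ t, μ x = 1 ∧ ∑ x ∈ t, μ x • ψ x = p := by
  obtain ⟨u, v, x, huv, hux, hvx, rfl⟩ := Finset.card_eq_three.1 ht.2
  have hc := nondegenerate_of_injective h hD ht
  have e := cross_smul_eq (ψ v - ψ u) (ψ x - ψ u) (p - ψ u)
  set c := cross (ψ v - ψ u) (ψ x - ψ u) with hcdef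
  set α := cross (p - ψ u) (ψ x - ψ u) / c with hα
  set β := -(cross (p - ψ u) (ψ v - ψ u)) / c with hβ
  have e' : p - ψ u = α • (ψ v - ψ u) + β • (ψ x - ψ u) := by
    rw [hα, hβ, div_eq_inv_mul, div_eq_inv_mul, mul_smul, mul_smul, neg_smul, ← smul_add,
      ← sub_eq_add_neg, ← e, inv_smul_smul₀ hc]
  refine ⟨fun y => if y = u then 1 - α - β else if y = v then α else β, ?_, ?_⟩
  · rw [sum_triangle huv hux hvx]
    simp [huv.symm, hux.symm, hvx.symm]
    ring
  · rw [sum_triangle huv hux hvx]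
    simp only [huv.symm, hux.symm, hvx.symm, if_true, if_false]
    rw [← sub_add_cancel p (ψ u), e']
    apply plane_ext <;> simp <;> ring

/-- A point of a triangle with a vanishing barycentric coordinate lies on an edge. -/
lemma mem_segment_of_barycentric_eq_zero {t : Finset V} (ht : t ∈ triangles K) {μ : V → ℝ}
    (h0 : ∀ x ∈ t, 0 ≤ μ x) (h1 : ∑ x ∈ t, μ x = 1) {x : V} (hx : x ∈ t) (hμ : μ x = 0) :
    ∃ y ∈ t, ∃ z ∈ t, (edgeGraph K).Adj y z ∧ ∑ x ∈ t, μ x • ψ x ∈ segment ℝ (ψ y) (ψ z) := by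
  obtain ⟨y, z, hxy, hxz, hyz, rfl⟩ := exists_eq_insert_pair ht.2 hx
  refine ⟨y, by simp, z, by simp, adj_of_mem_triangle ht (by simp) (by simp) hyz,
    μ y, μ z, h0 y (by simp), h0 z (by simp), ?_, ?_⟩
  · rw [← h1, sum_triangle hxy hxz hyz, hμ, zero_add]
  · rw [sum_triangle hxy hxz hyz, hμ, zero_smul, zero_add]

/-- A segment leaving an open triangle meets one of its edges. -/
lemma exists_exit {t : Finset V} (ht : t ∈ triangles K) {μ ν : V → ℝ} (h0 : ∀ x ∈ t, 0 < μ x)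
    (h1 : ∑ x ∈ t, μ x = 1) (h1' : ∑ x ∈ t, ν x = 1) {x₀ : V} (hx₀ : x₀ ∈ t) (hν : ν x₀ < 0) :
    ∃ y ∈ t, ∃ z ∈ t, (edgeGraph K).Adj y z ∧ ∃ q ∈ segment ℝ (ψ y) (ψ z),
      q ∈ segment ℝ (∑ x ∈ t, μ x • ψ x) (∑ x ∈ t, ν x • ψ x) := by
  obtain ⟨x, hx, hmin⟩ := Finset.exists_min_image (t.filter fun x => ν x < 0)
    (fun x => μ x / (μ x - ν x)) ⟨x₀, by simp [hx₀, hν]⟩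
  rw [Finset.mem_filter] at hx
  set s := μ x / (μ x - ν x) with hs
  have hμx := h0 x hx.1
  have hpos : 0 < μ x - ν x := by linarith [hx.2]
  have hs0 : 0 ≤ s := (div_pos hμx hpos).le
  have hs1 : s ≤ 1 := by
    rw [hs, div_le_one hpos]
    linarith [hx.2]
  have hnn : ∀ y ∈ t, 0 ≤ (1 - s) * μ y + s * ν y := by
    intro y hy
    have hμy := h0 y hy
    rcases le_or_gt 0 (ν y) with h | h
    · have := mul_nonneg (sub_nonneg.2 hs1) hμy.le
      have := mul_nonneg hs0 h
      linarith
    · have := hmin y (by simp [hy, h])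
      rw [le_div_iff₀ (by linarith)] at this
      linarith
  have hzero : (1 - s) * μ x + s * ν x = 0 := by
    rw [hs]
    field_simp
    ring
  have hsum : ∑ x ∈ t, ((1 - s) * μ x + s * ν x) = 1 := by
    rw [Finset.sum_add_distrib, ← Finset.mul_sum, ← Finset.mul_sum, h1, h1']
    ring
  obtain ⟨y, hy, z, hz, hyz, hq⟩ := mem_segment_of_barycentric_eq_zero (ψ := ψ) ht hnn hsum hx.1 hzero
  refine ⟨y, hy, z, hz, hyz, _, hq, 1 - s, s, by linarith, hs0, by ring, ?_⟩
  simp only [add_smul, mul_smul, Finset.sum_add_distrib, Finset.smul_sum]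

/-- No vertex is mapped into a triangle that does not contain it: the vertices inside a triangle
could be joined to the boundary only through the triangle, but a triangle does not separate. -/
lemma notMem_triangle_of_injective (h : Function.Injective (straightLineMap K ψ))
    (hD : IsDiskTriangulation K b) (hφ : IsConvexPolygon φ) (hb : ∀ i, ψ (b i) = φ i)
    (hmem : ∀ v, ψ v ∈ polygonRegion φ) {t : Finset V} (ht : t ∈ triangles K) {v : V} (hv : v ∉ t)
    {μ : V → ℝ} (h0 : ∀ x ∈ t, 0 ≤ μ x) (h1 : ∑ x ∈ t, μ x = 1) :
    ∑ x ∈ t, μ x • ψ x ≠ ψ v := by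
  classical
  have hpos : ∀ v ∉ t, ∀ μ : V → ℝ, (∀ x ∈ t, 0 ≤ μ x) → ∑ x ∈ t, μ x = 1 →
      ∑ x ∈ t, μ x • ψ x = ψ v → ∀ x ∈ t, 0 < μ x := by
    intro v hv μ h0 h1 he x hx
    refine lt_of_le_of_ne (h0 x hx) fun hμ => ?_
    obtain ⟨y, hy, z, hz, hyz, hq⟩ :=
      mem_segment_of_barycentric_eq_zero (ψ := ψ) ht h0 h1 hx hμ.symm
    rw [he] at hq
    exact vertex_notMem_edge h hD (v := v) hyz (fun e => hv (e ▸ hy)) (fun e => hv (e ▸ hz)) hq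
  intro he
  let C : Finset V := Finset.univ.filter fun v => v ∉ t ∧ ∃ μ : V → ℝ, (∀ x ∈ t, 0 ≤ μ x) ∧
    ∑ x ∈ t, μ x = 1 ∧ ∑ x ∈ t, μ x • ψ x = ψ v
  have hC : ∀ v, v ∈ C ↔ v ∉ t ∧ ∃ μ : V → ℝ, (∀ x ∈ t, 0 ≤ μ x) ∧
    ∑ x ∈ t, μ x = 1 ∧ ∑ x ∈ t, μ x • ψ x = ψ v := fun v => by simp [C]
  refine triangle_not_separating (hD.isTriangulatedSphere hφ.three_le)
    (image_some_mem_sphereTriangles.2 ht) (C := C.image some) (N := none)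
    ⟨some v, Finset.mem_image_of_mem _ ((hC v).2 ⟨hv, μ, h0, h1, he⟩)⟩ ?_ ?_ (by simp) (by simp)
  · intro c hc hct
    obtain ⟨x, hx, rfl⟩ := Finset.mem_image.1 hc
    obtain ⟨y, hy, hyx⟩ := Finset.mem_image.1 hct
    rw [Option.some.injEq] at hyx
    exact ((hC x).1 hx).1 (hyx ▸ hy)
  · intro c hc u hcu
    obtain ⟨x, hx, rfl⟩ := Finset.mem_image.1 hc
    obtain ⟨hxt, μ, h0, h1, he⟩ := (hC x).1 hx
    have hp := hpos x hxt μ h0 h1 he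
    cases u with
    | none =>
      -- A corner of the polygon is no interior point of a triangle in the polygon.
      exfalso
      obtain ⟨i, rfl⟩ := IsDiskTriangulation.tAdj_none_iff.1 hcu
      obtain ⟨d, hdi⟩ := hφ.exists_strict_min i
      have hd : d ≠ 0 := by
        rintro rfl
        have := hdi (i + 1) (fun h => zmod_one_ne_zero hφ.three_le (by linear_combination h))
        simp [cross_apply] at this
      have hmin : ∀ j, cross d (φ i) ≤ cross d (φ j) := by
        intro j
        by_cases h : j = i
        · rw [h]
        · exact (hdi j h).le
      have hle : ∀ v, 0 ≤ cross d (ψ v) - cross d (φ i) := fun v =>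
        sub_nonneg.2 (le_cross_of_mem_polygonRegion hmin (hmem v))
      have hz : ∑ x ∈ t, μ x * (cross d (ψ x) - cross d (φ i)) = 0 := by
        have := congrArg (cross d) he
        rw [map_sum, hb] at this
        simp only [map_smul, smul_eq_mul] at this
        simp only [mul_sub, Finset.sum_sub_distrib, ← Finset.sum_mul, h1, this]
        ring
      have hlev : ∀ x ∈ t, cross d (ψ x) = cross d (φ i) := by
        intro x hx
        have := (Finset.sum_eq_zero_iff_of_nonneg fun y hy =>
          mul_nonneg (h0 y hy) (hle y)).1 hz x hx
        rcases mul_eq_zero.1 this with h | h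
        · exact absurd h (hp x hx).ne'
        · exact sub_eq_zero.1 h
      obtain ⟨u, v, y, -, -, -, rfl⟩ := Finset.card_eq_three.1 ht.2
      apply nondegenerate_of_injective h hD ht
      apply cross_eq_zero_of_parallel hd
      · rw [map_sub, hlev v (by simp), hlev u (by simp), sub_self]
      · rw [map_sub, hlev y (by simp), hlev u (by simp), sub_self]
    | some u =>
      have hxu := hD.tAdj_some_iff.1 hcu
      by_cases hut : u ∈ t
      · exact Or.inr (Finset.mem_image_of_mem _ hut)
      left
      refine Finset.mem_image_of_mem _ ((hC u).2 ⟨hut, ?_⟩)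
      obtain ⟨ν, hν1, hν⟩ := exists_barycentric h hD ht (ψ u)
      refine ⟨ν, ?_, hν1, hν⟩
      by_contra hneg
      push Not at hneg
      obtain ⟨x₀, hx₀, hlt⟩ := hneg
      obtain ⟨y, hy, z, hz, hyz, q, hq, hq'⟩ := exists_exit (ψ := ψ) ht hp h1 hν1 hx₀ hlt
      rw [he, hν] at hq'
      exact disjoint_edges h hxu hyz (fun e => hxt (e ▸ hy)) (fun e => hxt (e ▸ hz))
        (fun e => hut (e ▸ hy)) (fun e => hut (e ▸ hz)) hq' hq

/-- A straight-line embedding of the 1-skeleton in the polygon has no folds. -/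
theorem isUnfolded_of_injective (h : Function.Injective (straightLineMap K ψ))
    (hD : IsDiskTriangulation K b) (hφ : IsConvexPolygon φ) (hb : ∀ i, ψ (b i) = φ i)
    (hmem : ∀ v, ψ v ∈ polygonRegion φ) : IsUnfolded K ψ := by
  refine ⟨fun u v x ht => nondegenerate_of_injective h hD ht, fun u v x y hx hy hxy => ?_⟩
  by_contra hneg
  have hcx := nondegenerate_of_injective h hD hx
  have hcy := nondegenerate_of_injective h hD hy
  obtain ⟨huv, hux, hvx⟩ := ne_of_mem_triangles hx
  obtain ⟨-, huy, hvy⟩ := ne_of_mem_triangles hy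
  have hprod : 0 < cross (ψ v - ψ u) (ψ x - ψ u) * cross (ψ v - ψ u) (ψ y - ψ u) :=
    lt_of_le_of_ne (not_lt.1 hneg) (mul_ne_zero hcx hcy).symm
  obtain ⟨μ, hμ1, hμ⟩ := exists_barycentric h hD hx (ψ y)
  rw [sum_triangle huv hux hvx] at hμ1 hμ
  have hτ : 0 < μ x := by
    have e : cross (ψ v - ψ u) (ψ y - ψ u) = μ x * cross (ψ v - ψ u) (ψ x - ψ u) := by
      rw [← hμ, show μ u = 1 - μ v - μ x by linarith]
      simp only [cross_apply, PiLp.sub_apply, PiLp.add_apply, PiLp.smul_apply, smul_eq_mul]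
      ring
    rw [e] at hprod
    by_contra hle
    nlinarith [mul_self_nonneg (cross (ψ v - ψ u) (ψ x - ψ u))]
  have aux := adj_of_mem_triangle hx (by simp) (by simp) hux
  have avx := adj_of_mem_triangle hx (by simp) (by simp) hvx
  have auy := adj_of_mem_triangle hy (by simp) (by simp) huy
  have avy := adj_of_mem_triangle hy (by simp) (by simp) hvy
  rcases le_or_gt 0 (μ u) with hu | hu <;> rcases le_or_gt 0 (μ v) with hv | hv
  · refine notMem_triangle_of_injective h hD hφ hb hmem hx (v := y) (μ := μ) ?_ ?_ ?_ ?_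
    · simp [huy.symm, hvy.symm, hxy.symm]
    · simp only [Finset.mem_insert, Finset.mem_singleton]
      rintro _ (rfl | rfl | rfl)
      exacts [hu, hv, hτ.le]
    · rwa [sum_triangle huv hux hvx]
    · rwa [sum_triangle huv hux hvx]
  · -- The edges `vy` and `ux` cross.
    have hne : 1 - μ v ≠ 0 := by linarith
    refine disjoint_edges h avy aux huv.symm hvx huy.symm hxy.symm
      (x := (1 - μ v)⁻¹ • (ψ y - μ v • ψ v)) ⟨-μ v / (1 - μ v), 1 / (1 - μ v), ?_, ?_, ?_, ?_⟩
      ⟨μ u / (1 - μ v), μ x / (1 - μ v), ?_, ?_, ?_, ?_⟩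
    · exact div_nonneg (by linarith) (by linarith)
    · exact div_nonneg (by linarith) (by linarith)
    · field_simp; ring
    · apply plane_ext <;> simp <;> field_simp <;> ring
    · exact div_nonneg (by linarith) (by linarith)
    · exact div_nonneg (by linarith) (by linarith)
    · field_simp; linarith
    · rw [← hμ]
      apply plane_ext <;> simp <;> field_simp <;> ring
  · -- The edges `uy` and `vx` cross.
    have hne : 1 - μ u ≠ 0 := by linarith
    refine disjoint_edges h auy avx huv hux hvy.symm hxy.symm
      (x := (1 - μ u)⁻¹ • (ψ y - μ u • ψ u)) ⟨-μ u / (1 - μ u), 1 / (1 - μ u), ?_, ?_, ?_, ?_⟩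
      ⟨μ v / (1 - μ u), μ x / (1 - μ u), ?_, ?_, ?_, ?_⟩
    · exact div_nonneg (by linarith) (by linarith)
    · exact div_nonneg (by linarith) (by linarith)
    · field_simp; ring
    · apply plane_ext <;> simp <;> field_simp <;> ring
    · exact div_nonneg (by linarith) (by linarith)
    · exact div_nonneg (by linarith) (by linarith)
    · field_simp; linarith
    · rw [← hμ]
      apply plane_ext <;> simp <;> field_simp <;> ring
  · -- Now `x` lies in the triangle `uvy`.
    have hx0 := hτ.ne'
    refine notMem_triangle_of_injective h hD hφ hb hmem hy (v := x)
      (μ := fun z => if z = u then -μ u / μ x else if z = v then -μ v / μ x else 1 / μ x)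
      ?_ ?_ ?_ ?_
    · simp [hux.symm, hvx.symm, hxy]
    · simp only [Finset.mem_insert, Finset.mem_singleton]
      rintro _ (rfl | rfl | rfl)
      · simp only [if_true]
        exact div_nonneg (by linarith) hτ.le
      · simp only [huv.symm, if_true, if_false]
        exact div_nonneg (by linarith) hτ.le
      · simp only [huy.symm, hvy.symm, if_false]
        positivity
    · rw [sum_triangle huv huy hvy]
      simp only [huv.symm, huy.symm, hvy.symm, if_true, if_false]
      field_simp
      linarith
    · rw [sum_triangle huv huy hvy]
      simp only [huv.symm, huy.symm, hvy.symm, if_true, if_false]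
      rw [← hμ]
      apply plane_ext <;> simp <;> field_simp <;> ring

/-! ### Positive weights balancing the neighbours of a vertex -/

/-- Vectors that surround the origin have a vanishing combination with positive coefficients: the
negative of each of them is a nonnegative combination of them. -/
lemma exists_pos_weights {N : Finset V} {e : V → Plane}
    (hN : ∀ u ∈ N, ∃ p ∈ N, ∃ q ∈ N, ∃ α β : ℝ, 0 ≤ α ∧ 0 ≤ β ∧ - e u = α • e p + β • e q) :
    ∃ w : V → ℝ, (∀ u, 0 < w u) ∧ ∑ u ∈ N, w u • e u = 0 := by
  have key : ∀ u, ∃ μ : V → ℝ, (∀ x, 0 ≤ μ x) ∧ (u ∈ N → ∑ x ∈ N, μ x • e x = - e u) := by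
    intro u
    by_cases hu : u ∈ N
    · obtain ⟨p, hp, q, hq, α, β, hα, hβ, h⟩ := hN u hu
      refine ⟨fun x => (if x = p then α else 0) + (if x = q then β else 0), fun x => ?_, fun _ => ?_⟩
      · exact add_nonneg (by split_ifs <;> simp [hα]) (by split_ifs <;> simp [hβ])
      · simp only [add_smul, ite_smul, zero_smul, Finset.sum_add_distrib, Finset.sum_ite_eq', hp,
          hq, if_true]
        exact h.symm
    · exact ⟨0, fun _ => le_rfl, fun h => absurd h hu⟩
  choose μ hμ0 hμ using key
  refine ⟨fun x => 1 + ∑ u ∈ N, μ u x, fun x => ?_, ?_⟩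
  · have := Finset.sum_nonneg fun u (_ : u ∈ N) => hμ0 u x
    linarith
  · simp only [add_smul, one_smul, Finset.sum_add_distrib, Finset.sum_smul]
    rw [Finset.sum_comm, Finset.sum_congr rfl hμ, Finset.sum_neg_distrib, add_neg_cancel]

lemma IsUnfolded.exists_pos_weights (hU : IsUnfolded K ψ) (hD : IsDiskTriangulation K b) {v : V}
    (hv : v ∉ Set.range b) {N : Finset V} (hN : ∀ u, u ∈ N ↔ (edgeGraph K).Adj v u) :
    ∃ w : V → ℝ, (∀ u, 0 < w u) ∧ ∑ u ∈ N, w u • (ψ u - ψ v) = 0 := by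
  obtain ⟨hne, hL, hR⟩ := hU.surrounding hD hv hN
  refine PlanarTriangulation.exists_pos_weights fun u hu => ?_
  have hd : -(ψ u - ψ v) ≠ 0 := neg_ne_zero.2 (sub_ne_zero.2 (hU.ne_of_adj hD ((hN u).1 hu)).symm)
  obtain ⟨p, hp, q, hq, -, h⟩ := exists_sector_of_surrounding hne hL hR hd
  exact ⟨p, hp, q, hq, h⟩

end Disk

/-! ### The retraction of the space of weights onto the geodesic triangulations -/

/-- Systems of positive weights, one for each ordered pair of vertices. Only the weights `w v u`
with `v` an interior vertex and `u` a neighbour of `v` matter. -/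
def positiveWeights (V : Type*) : Set (V → V → ℝ) := {w | ∀ v u, 0 < w v u}

lemma contractibleSpace_positiveWeights (V : Type*) : ContractibleSpace (positiveWeights V) := by
  exact Convex.contractibleSpace (fun w hw w' hw' α β hα hβ hαβ v u =>
    convex_Ioi (0 : ℝ) (Set.mem_Ioi.2 (hw v u)) (Set.mem_Ioi.2 (hw' v u)) hα hβ hαβ) ⟨1, fun v u => one_pos⟩

/-- The positive weights on the neighbours `N` of `v` for which `v` is their mean. -/
def balancingWeights {V : Type*} (N : Finset V) (v : V) (ψ : V → Plane) : Set (V → ℝ) :=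
  {w | (∀ u, 0 < w u) ∧ ∑ u ∈ N, w u • (ψ u - ψ v) = 0}

lemma convex_balancingWeights {V : Type*} (N : Finset V) (v : V) (ψ : V → Plane) :
    Convex ℝ (balancingWeights N v ψ) := by
  intro w hw w' hw' α β hα hβ hαβ
  refine ⟨fun u => convex_Ioi (0 : ℝ) (Set.mem_Ioi.2 (hw.1 u)) (Set.mem_Ioi.2 (hw'.1 u)) hα hβ hαβ, ?_⟩
  simp only [Pi.add_apply, Pi.smul_apply, smul_eq_mul, add_smul, mul_smul,
    Finset.sum_add_distrib, ← Finset.smul_sum, hw.2, hw'.2, smul_zero, add_zero]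

section Disk

variable {V : Type*} [Fintype V] [DecidableEq V] {n : ℕ} {K : AbstractSimplicialComplex V}
  {b : ZMod n → V} {φ : ZMod n → Plane} {ψ : V → Plane}

/-- The right-hand side of the Dirichlet problem for the coordinate `k`: the prescribed value at a
boundary vertex and `0` at an interior one. -/
noncomputable def boundaryData (b : ZMod n → V) (φ : ZMod n → Plane) (k : Fin 2) : V → ℝ :=
  Function.extend b (fun i => φ i k) 0

/-- Tutte's drawing: the boundary vertices are placed at the corners of the polygon, and every
interior vertex is the mean of its neighbours with weights `w`. -/
noncomputable def tutteMap (K : AbstractSimplicialComplex V) (b : ZMod n → V) (φ : ZMod n → Plane)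
    (w : V → V → ℝ) (v : V) : Plane :=
  WithLp.toLp 2 fun k =>
    ((dirichletMatrix (edgeGraph K) (Set.range b)ᶜ w)⁻¹.mulVec (boundaryData b φ k)) v

lemma isUnit_det_dirichletMatrix (hD : IsDiskTriangulation K b) {w : V → V → ℝ}
    (hw : w ∈ positiveWeights V) :
    IsUnit (dirichletMatrix (edgeGraph K) (Set.range b)ᶜ w).det :=
  isUnit_iff_ne_zero.2 (det_dirichletMatrix_ne_zero hD.connected
    ⟨b 0, Set.notMem_compl_iff.2 (Set.mem_range_self 0)⟩ fun v u _ => hw v u)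

lemma dirichletMatrix_mulVec_tutteMap (hD : IsDiskTriangulation K b) {w : V → V → ℝ}
    (hw : w ∈ positiveWeights V) (k : Fin 2) :
    (dirichletMatrix (edgeGraph K) (Set.range b)ᶜ w).mulVec (fun v => tutteMap K b φ w v k) =
      boundaryData b φ k := by
  show Matrix.mulVec _ (Matrix.mulVec _ _) = _
  rw [Matrix.mulVec_mulVec, Matrix.mul_nonsing_inv _ (isUnit_det_dirichletMatrix hD hw),
    Matrix.one_mulVec]

lemma tutteMap_eq (hD : IsDiskTriangulation K b) {w : V → V → ℝ} (hw : w ∈ positiveWeights V)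
    (h : ∀ k, (dirichletMatrix (edgeGraph K) (Set.range b)ᶜ w).mulVec (fun v => ψ v k) =
      boundaryData b φ k) : tutteMap K b φ w = ψ := by
  funext v
  ext k
  show Matrix.mulVec _ _ v = _
  rw [← h k, Matrix.mulVec_mulVec, Matrix.nonsing_inv_mul _ (isUnit_det_dirichletMatrix hD hw),
    Matrix.one_mulVec]

lemma continuous_tutteMap (hD : IsDiskTriangulation K b) :
    Continuous fun w : positiveWeights V => tutteMap K b φ w.1 := by
  have hM : Continuous fun w : positiveWeights V =>
      dirichletMatrix (edgeGraph K) (Set.range b)ᶜ w.1 := by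
    have hw : ∀ v u, Continuous fun w : positiveWeights V => w.1 v u := fun v u =>
      (continuous_apply u).comp ((continuous_apply v).comp continuous_subtype_val)
    refine continuous_pi fun v => continuous_pi fun u => ?_
    unfold dirichletMatrix
    split_ifs
    · exact (hw _ _).sub (continuous_finsetSum _ fun x _ => by
        split_ifs
        exacts [hw _ _, continuous_const])
    · exact (hw _ _).sub continuous_const
    · exact continuous_const.sub (continuous_finsetSum _ fun x _ => by
        split_ifs
        exacts [hw _ _, continuous_const])
    · exact continuous_const
    · exact continuous_const
    · exact continuous_const
  have hinv : Continuous fun w : positiveWeights V =>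
      (dirichletMatrix (edgeGraph K) (Set.range b)ᶜ w.1)⁻¹ := by
    simp only [Matrix.inv_def, Ring.inverse_eq_inv']
    exact (hM.matrix_det.inv₀ fun w => (isUnit_det_dirichletMatrix hD w.2).ne_zero).smul
      hM.matrix_adjugate
  refine continuous_pi fun v => (PiLp.continuous_toLp 2 _).comp (continuous_pi fun k => ?_)
  exact (continuous_apply v).comp (hinv.matrix_mulVec continuous_const)

lemma isConvexCombinationMap_tutteMap (hD : IsDiskTriangulation K b) {w : V → V → ℝ}
    (hw : w ∈ positiveWeights V) : IsConvexCombinationMap K b φ (tutteMap K b φ w) := by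
  classical
  have h := dirichletMatrix_mulVec_tutteMap (φ := φ) hD hw
  refine ⟨fun i => ?_, fun v hv d => ?_⟩
  · ext k
    have := congrFun (h k) (b i)
    rwa [dirichletMatrix_mulVec, if_neg (Set.notMem_compl_iff.2 (Set.mem_range_self i)), boundaryData,
      hD.boundary_injective.extend_apply] at this
  · have hk : ∀ k, ∑ u, (if (edgeGraph K).Adj v u then w v u else 0) *
        (tutteMap K b φ w u k - tutteMap K b φ w v k) = 0 := by
      intro k
      have := congrFun (h k) v
      rw [dirichletMatrix_mulVec, if_pos (Set.mem_compl hv), boundaryData, Function.extend_apply' _ _ _ hv] at this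
      exact this
    refine flat_or_regular_of_sum_eq_zero (w := w v) (fun u _ => hw v u) ?_
    have := congrArg₂ (fun x y => d 0 * x - d 1 * y) (hk 1) (hk 0)
    simp only [mul_zero, sub_zero, Finset.mul_sum, ← Finset.sum_sub_distrib] at this
    refine Eq.trans (Finset.sum_congr rfl fun u _ => ?_) this
    rw [cross_apply, cross_apply]
    ring

/-- Balancing weights can be chosen continuously near a given map: correcting the weights of two
neighbours in independent directions by Cramer's rule restores the balance. -/
lemma exists_local_balancingWeights {N : Finset V} {v i j : V} (hi : i ∈ N) (hj : j ∈ N)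
    {ψ₀ : V → Plane} (hij : cross (ψ₀ i - ψ₀ v) (ψ₀ j - ψ₀ v) ≠ 0) {w : V → ℝ}
    (hw : w ∈ balancingWeights N v ψ₀) :
    ∃ U ∈ nhds ψ₀, ∃ g : (V → Plane) → V → ℝ, ContinuousOn g U ∧
      ∀ ψ ∈ U, g ψ ∈ balancingWeights N v ψ := by
  let r : (V → Plane) → Plane := fun ψ => ∑ u ∈ N, w u • (ψ u - ψ v)
  let c : (V → Plane) → ℝ := fun ψ => cross (ψ i - ψ v) (ψ j - ψ v)
  let g : (V → Plane) → V → ℝ := fun ψ u =>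
    w u + ((if u = i then - (cross (r ψ) (ψ j - ψ v)) / c ψ else 0) +
      (if u = j then cross (r ψ) (ψ i - ψ v) / c ψ else 0))
  have hcross : ∀ f h : (V → Plane) → Plane, Continuous f → Continuous h →
      Continuous fun ψ => cross (f ψ) (h ψ) := by
    intro f h hf hh
    simp only [cross_apply]
    fun_prop
  have hsub : ∀ u, Continuous fun ψ : V → Plane => ψ u - ψ v := fun u =>
    (continuous_apply u).sub (continuous_apply v)
  have hr : Continuous r := continuous_finsetSum _ fun u _ => (hsub u).const_smul (w u)
  have hc : Continuous c := hcross _ _ (hsub i) (hsub j)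
  have hg : ContinuousOn g {ψ | c ψ ≠ 0} := by
    refine continuousOn_pi.2 fun u => continuousOn_const.add (ContinuousOn.add ?_ ?_)
    · split_ifs
      · exact (hcross _ _ hr (hsub j)).neg.continuousOn.div hc.continuousOn fun _ h => h
      · exact continuousOn_const
    · split_ifs
      · exact (hcross _ _ hr (hsub i)).continuousOn.div hc.continuousOn fun _ h => h
      · exact continuousOn_const
  have hU : {ψ | c ψ ≠ 0} ∈ nhds ψ₀ := (isOpen_ne_fun hc continuous_const).mem_nhds hij
  have hg₀ : g ψ₀ = w := by
    have : r ψ₀ = 0 := hw.2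
    funext u
    simp only [g, this, cross_apply]
    simp
  have hpos : ∀ᶠ ψ in nhds ψ₀, ∀ u ∈ (Finset.univ : Finset V), 0 < g ψ u := by
    rw [Filter.eventually_all_finset]
    intro u _
    have h1 : ContinuousAt (fun ψ => g ψ u) ψ₀ :=
      (continuous_apply u).continuousAt.comp (hg.continuousAt hU)
    refine h1.eventually (lt_mem_nhds ?_)
    show 0 < g ψ₀ u
    rw [hg₀]
    exact hw.1 u
  refine ⟨_, Filter.inter_mem hU hpos, g, hg.mono Set.inter_subset_left,
    fun ψ hψ => ⟨fun u => hψ.2 u (Finset.mem_univ u), ?_⟩⟩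
  have hψc : c ψ ≠ 0 := hψ.1
  simp only [g, add_smul, ite_smul, zero_smul, Finset.sum_add_distrib, Finset.sum_ite_eq', hi, hj,
    if_true]
  have e := cross_smul_eq (ψ i - ψ v) (ψ j - ψ v) (r ψ)
  rw [neg_div, neg_smul, div_eq_inv_mul, div_eq_inv_mul, mul_smul, mul_smul, ← smul_neg,
    ← smul_add, neg_add_eq_sub, ← neg_sub (_ • (ψ i - ψ v)), ← e, smul_neg]
  change r ψ + -((c ψ)⁻¹ • (c ψ • r ψ)) = 0
  rw [inv_smul_smul₀ hψc, add_neg_cancel]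

lemma isUnfolded_of_mem_geodesicTriangulations (hD : IsDiskTriangulation K b)
    (hφ : IsConvexPolygon φ) (hψ : ψ ∈ geodesicTriangulations K b φ) : IsUnfolded K ψ :=
  isUnfolded_of_injective hψ.2.2.injective hD hφ hψ.1 hψ.2.1

/-- Balancing weights can be chosen continuously on the space of geodesic triangulations. -/
lemma exists_continuous_balancingWeights (hD : IsDiskTriangulation K b) (hφ : IsConvexPolygon φ)
    {v : V} (hv : v ∉ Set.range b) {N : Finset V} (hN : ∀ u, u ∈ N ↔ (edgeGraph K).Adj v u) :
    ∃ g : C(geodesicTriangulations K b φ, V → ℝ), ∀ ψ, g ψ ∈ balancingWeights N v ψ.1 := by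
  refine exists_continuous_forall_mem_convex_of_local
    (fun ψ => convex_balancingWeights N v ψ.1) fun ψ₀ => ?_
  have hU := isUnfolded_of_mem_geodesicTriangulations hD hφ ψ₀.2
  obtain ⟨⟨i, hi⟩, hL, -⟩ := hU.surrounding hD hv hN
  obtain ⟨j, hj, hij⟩ := hL i hi
  obtain ⟨w, hw⟩ := hU.exists_pos_weights hD hv hN
  obtain ⟨U, hU, g, hg, h⟩ := exists_local_balancingWeights hi hj hij.ne' hw
  exact ⟨Subtype.val ⁻¹' U, continuous_subtype_val.continuousAt.preimage_mem_nhds hU,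
    g ∘ Subtype.val, hg.comp continuous_subtype_val.continuousOn fun _ h => h,
    fun ψ hψ => h _ hψ⟩

/-- The space of geodesic triangulations is contractible: it is a retract of the space of
weights. -/
theorem contractibleSpace_geodesicTriangulations (hD : IsDiskTriangulation K b)
    (hφ : IsConvexPolygon φ) : ContractibleSpace (geodesicTriangulations K b φ) := by
  classical
  have hsec : ∀ v, ∃ g : C(geodesicTriangulations K b φ, V → ℝ), ∀ ψ, (∀ u, 0 < g ψ u) ∧
      (v ∉ Set.range b →
        g ψ ∈ balancingWeights (Finset.univ.filter fun u => (edgeGraph K).Adj v u) v ψ.1) := by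
    intro v
    by_cases hv : v ∈ Set.range b
    · exact ⟨ContinuousMap.const _ 1, fun ψ => ⟨fun u => one_pos, fun h => absurd hv h⟩⟩
    · obtain ⟨g, hg⟩ := exists_continuous_balancingWeights hD hφ hv
        (N := Finset.univ.filter fun u => (edgeGraph K).Adj v u) (by simp)
      exact ⟨g, fun ψ => ⟨(hg ψ).1, fun _ => hg ψ⟩⟩
  choose g hg using hsec
  let σ : C(geodesicTriangulations K b φ, positiveWeights V) :=
    ⟨fun ψ => ⟨fun v => g v ψ, fun v => (hg v ψ).1⟩,
      (continuous_pi fun v => (g v).continuous).subtype_mk _⟩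
  let ρ : C(positiveWeights V, geodesicTriangulations K b φ) :=
    ⟨fun w => ⟨tutteMap K b φ w.1,
        (isConvexCombinationMap_tutteMap hD w.2).mem_geodesicTriangulations hD hφ⟩,
      (continuous_tutteMap hD).subtype_mk _⟩
  have hid : ρ.comp σ = ContinuousMap.id _ := by
    ext1 ψ
    refine Subtype.ext (tutteMap_eq hD (σ ψ).2 fun k => ?_)
    funext v
    rw [dirichletMatrix_mulVec, boundaryData]
    by_cases hv : v ∈ Set.range b
    · rw [if_neg (Set.notMem_compl_iff.2 hv)]
      obtain ⟨i, rfl⟩ := hv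
      rw [hD.boundary_injective.extend_apply]
      exact congrArg (fun x : Plane => x k) (ψ.2.1 i)
    · rw [if_pos (Set.mem_compl hv), Function.extend_apply' _ _ _ hv]
      have := congrArg (fun x : Plane => x k) ((hg v ψ).2 hv).2
      simp only [WithLp.ofLp_sum, Finset.sum_apply, Finset.sum_filter] at this
      refine Eq.trans (Finset.sum_congr rfl fun u _ => ?_) this
      by_cases hu : (edgeGraph K).Adj v u
      · rw [if_pos hu, if_pos hu]
        rfl
      · rw [if_neg hu, if_neg hu, zero_mul]
        rfl
  rw [contractible_iff_id_nullhomotopic, ← hid]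
  have := contractibleSpace_positiveWeights V
  exact ((id_nullhomotopic (positiveWeights V)).comp_left σ).comp_right ρ

end Disk

end PlanarTriangulation

theorem theorem3p5 {V : Type*} [Fintype V] [DecidableEq V] {n : ℕ}
    (K : AbstractSimplicialComplex V) (b : ZMod n → V)
    (hT : PlanarTriangulation.IsDiskTriangulation K b)
    (φ : ZMod n → Plane) (hφ : PlanarTriangulation.IsConvexPolygon φ) :
    ContractibleSpace (PlanarTriangulation.geodesicTriangulations K b φ) :=
  PlanarTriangulation.contractibleSpace_geodesicTriangulations hT hφ
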